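/- A finite quantum group is given by a finite Hopf $C^*$-algebra, i.e. a finite-dimensional $C^*$-algebra $A$ with a comultiplication $\Delta:A\to A\otimes A$, a counit $\varepsilon:A\to\mathbb C$ and an antipode $S:A\to A^{op}$ that are $*$-morphisms and satisfy the Hopf algebra axioms. It is a quantum permutation group acting on $N$ points if it is equipped with an $N\times N$ magic unitary matrix $u=(u_{ij})$ over $A$ (all entries are projections, and on each row and each column they are mutually orthogonal and sum up to $1$) whose entries generate $A$ and satisfy $\Delta(u_{ij})=\sum_k u_{ik}\otimes u_{kj}$, $\varepsilon(u_{ij})=\delta_{ij}$, $S(u_{ij})=u_{ji}$. For $i\in\{1,\dots,2n\}$ let $i'=i-1$, $i^*=i/2$ if $i$ is even and $i'=i+1$, $i^*=(i+1)/2$ if $i$ is odd. For a symmetric matrix $p\in M_n(\{\pm1\})$ with $p_{ii}=1$, let $C_p(S_{2n})$ be the universal $C^*$-algebra generated by the entries of a $2n\times 2n$ magic unitary matrix $u$ subject to the relations, for all $i,j,k,l$, $$(3+p_{i^*j^*})u_{kj}u_{li}+(1-p_{i^*j^*})u_{kj}u_{li'}+(1-p_{i^*j^*})u_{kj'}u_{li}+(p_{i^*j^*}-1)u_{kj'}u_{li'}$$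 $$=(3+p_{l^*k^*})u_{li}u_{kj}+(1-p_{l^*k^*})u_{l'i}u_{kj}+(1-p_{l^*k^*})u_{li}u_{k'j}+(p_{l^*k^*}-1)u_{l'i}u_{k'j}.$$ Theorem. For every $n$ there are $n$ such matrices $p^{(1)},\dots,p^{(n)}$ such that each $A_k=C_{p^{(k)}}(S_{2n})$, with its matrix $u$, is (the function algebra of) a finite quantum permutation group acting on $2n$ points, and: 1. as a Hopf algebra, $A_k$ is a 2-cocycle twist of $C(S_{2n})$: it is isomorphic to the coalgebra $C(S_{2n})$ with the same unit and with the product $x\cdot y=\sigma(x_1,y_1)\,x_2y_2\,\sigma^{-1}(x_3,y_3)$, for a (normalized, convolution invertible) Hopf 2-cocycle $\sigma$ that is the pull-back, under restriction of functions, of a Hopf 2-cocycle on $C(\mathbb Z_2^n)$, where $\mathbb Z_2^n\subset S_{2n}$ is the subgroup generated by the transpositions $(i\ i')$; 2. $A_k$ has the same tensor category of representations as $S_{2n}$: the category of finite-dimensional corepresentations of $A_k$ is equivalent, as a $\mathbb C$-linear monoidal category, to the category of finite-dimensional complex representations of $S_{2n}$; 3. $A_1,\dots,A_n$ are pairwise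 non-isomorphic as Hopf algebras. In particular there are at least $n$ pairwise non-isomorphic finite quantum permutation groups acting on $2n$ points and having the same tensor category of representations as $S_{2n}$. -/

import Mathlib

open scoped TensorProduct
open CategoryTheory

/-! ### The function algebra of a finite group -/

/-- The algebra `C(G)` of complex functions on a group `G`, under pointwise operations. It is a
type synonym of `G → ℂ`, because it carries the coalgebra structure dual to the multiplication
of `G`: `Δ f (x, y) = f (x * y)`, `ε f = f 1`, `S f x = f x⁻¹`. -/
def FunAlg (G : Type) : Type := G → ℂ

namespace FunAlg
variable {G : Type}

noncomputable instance : CommRing (FunAlg G) := inferInstanceAs (CommRing (G → ℂ))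
noncomputable instance : Algebra ℂ (FunAlg G) := inferInstanceAs (Algebra ℂ (G → ℂ))

lemma ext {f g : FunAlg G} (h : ∀ x, f x = g x) : f = g := funext h

/-- Evaluation at a point. -/
noncomputable def eval (x : G) : FunAlg G →ₐ[ℂ] ℂ := Pi.evalAlgHom ℂ (fun _ : G => ℂ) x

lemma eval_apply (x : G) (f : FunAlg G) : eval x f = f x := rfl

lemma sum_apply {ι : Type} (s : Finset ι) (f : ι → FunAlg G) (x : G) :
    (∑ i ∈ s, f i) x = ∑ i ∈ s, f i x := by
  exact map_sum (eval x) f s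

variable [DecidableEq G]

/-- The indicator function of a point. -/
def delta (x : G) : FunAlg G := fun y => if y = x then 1 else 0

lemma delta_apply (x y : G) : delta x y = if y = x then 1 else 0 := rfl

lemma delta_mul_delta (x y : G) : delta x * delta y = if x = y then delta x else 0 := by
  refine ext fun z => ?_
  change delta x z * delta y z = _
  split_ifs with h
  · simp [delta_apply, h]
  · change _ = (0 : ℂ)
    simp only [delta_apply]
    split_ifs with h1 h2 <;> simp_all


/-- The antipode `f ↦ (x ↦ f x⁻¹)`. -/
def invFun [Group G] : FunAlg G →ₗ[ℂ] FunAlg G where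
  toFun f := fun x => f x⁻¹
  map_add' _ _ := rfl
  map_smul' _ _ := rfl

lemma invFun_delta [Group G] (g : G) : invFun (delta g) = delta g⁻¹ := by
  refine ext fun x => ?_
  change delta g x⁻¹ = _
  simp [delta_apply, inv_eq_iff_eq_inv]

variable [Fintype G]

lemma eq_sum (f : FunAlg G) : f = ∑ x, f x • delta x := by
  refine ext fun y => ?_
  rw [sum_apply]
  change f y = ∑ x, f x * delta x y
  simp only [delta_apply, mul_ite, mul_one, mul_zero]
  exact ((Finset.sum_ite_eq Finset.univ y (fun x => f x)).trans (if_pos (Finset.mem_univ y))).symm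

lemma sum_delta : ∑ x : G, delta x = (1 : FunAlg G) := by
  refine ext fun y => ?_
  rw [sum_apply]
  change _ = (1 : ℂ)
  simp [delta_apply]

lemma linearMap_ext {M : Type} [AddCommMonoid M] [Module ℂ M] {F F' : FunAlg G →ₗ[ℂ] M}
    (h : ∀ x, F (delta x) = F' (delta x)) : F = F' := by
  ext f
  rw [eq_sum f]
  simp only [map_sum, map_smul, h]

variable [Group G]

/-- The comultiplication `f ↦ ((x, y) ↦ f (x * y))`, where `C(G) ⊗ C(G)` is spanned by the
`δ_x ⊗ δ_y`. -/
noncomputable def comulFun : FunAlg G →ₗ[ℂ] FunAlg G ⊗[ℂ] FunAlg G where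
  toFun f := ∑ x, ∑ y, f (x * y) • (delta x ⊗ₜ[ℂ] delta y)
  map_add' f g := by
    simp only [← Finset.sum_add_distrib, ← add_smul]; rfl
  map_smul' c f := by
    simp only [Finset.smul_sum, smul_smul]; rfl

lemma comulFun_delta (g : G) :
    comulFun (delta g) = ∑ x, delta x ⊗ₜ[ℂ] delta (x⁻¹ * g) := by
  refine Finset.sum_congr rfl fun x _ => ?_
  simp [delta_apply, ← eq_inv_mul_iff_mul_eq]

noncomputable instance : Coalgebra ℂ (FunAlg G) where
  comul := comulFun
  counit := (eval 1).toLinearMap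
  coassoc := by
    refine linearMap_ext fun g => ?_
    simp only [LinearMap.comp_apply, LinearEquiv.coe_coe, comulFun_delta, map_sum,
      LinearMap.rTensor_tmul, LinearMap.lTensor_tmul, TensorProduct.sum_tmul,
      TensorProduct.tmul_sum, TensorProduct.assoc_tmul]
    rw [Finset.sum_comm]
    refine Finset.sum_congr rfl fun y _ => ?_
    refine Fintype.sum_equiv (Equiv.mulLeft y⁻¹) _ _ fun x => ?_
    simp [mul_assoc]
  rTensor_counit_comp_comul := by
    refine linearMap_ext fun g => ?_
    simp only [LinearMap.comp_apply, comulFun_delta, map_sum, LinearMap.rTensor_tmul,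
      AlgHom.toLinearMap_apply, eval_apply, delta_apply]
    rw [Finset.sum_eq_single 1] <;> simp +contextual [eq_comm]
  lTensor_counit_comp_comul := by
    refine linearMap_ext fun g => ?_
    simp only [LinearMap.comp_apply, comulFun_delta, map_sum, LinearMap.lTensor_tmul,
      AlgHom.toLinearMap_apply, eval_apply, delta_apply]
    rw [Finset.sum_eq_single g]
    · simp
    · intro x _ hx
      rw [if_neg, TensorProduct.tmul_zero]
      rw [eq_inv_mul_iff_mul_eq, mul_one]
      exact hx
    · simp

lemma comul_eq (f : FunAlg G) : Coalgebra.comul (R := ℂ) f =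
    ∑ x, ∑ y, f (x * y) • (delta x ⊗ₜ[ℂ] delta y) := rfl

lemma comul_delta (g : G) :
    Coalgebra.comul (R := ℂ) (delta g) = ∑ x, delta x ⊗ₜ[ℂ] delta (x⁻¹ * g) := comulFun_delta g

lemma counit_eq (f : FunAlg G) : Coalgebra.counit (R := ℂ) f = f 1 := rfl

lemma comul_mul (f g : FunAlg G) : Coalgebra.comul (R := ℂ) (f * g) =
    Coalgebra.comul (R := ℂ) f * Coalgebra.comul (R := ℂ) g := by
  simp only [comul_eq, Finset.sum_mul_sum, smul_mul_smul_comm,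
    Algebra.TensorProduct.tmul_mul_tmul, delta_mul_delta]
  refine Finset.sum_congr rfl fun x _ => Eq.symm ?_
  rw [Finset.sum_eq_single x]
  · refine Finset.sum_congr rfl fun y _ => ?_
    rw [Finset.sum_eq_single y]
    · rw [if_pos rfl, if_pos rfl]
      rfl
    · intro z _ hz
      rw [if_neg hz.symm, TensorProduct.tmul_zero, smul_zero]
    · simp
  · intro z _ hz
    refine Finset.sum_eq_zero fun y _ => Finset.sum_eq_zero fun w _ => ?_
    rw [if_neg hz.symm, TensorProduct.zero_tmul, smul_zero]
  · simp

noncomputable instance : Bialgebra ℂ (FunAlg G) :=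
  Bialgebra.mk' ℂ (FunAlg G) rfl rfl
    (by
      rw [comul_eq, Algebra.TensorProduct.one_def, ← sum_delta, TensorProduct.sum_tmul]
      refine Finset.sum_congr rfl fun x _ => ?_
      rw [TensorProduct.tmul_sum]
      refine Finset.sum_congr rfl fun y _ => ?_
      rw [sum_delta]
      exact one_smul _ _)
    (fun {a b} => comul_mul a b)

noncomputable instance : HopfAlgebra ℂ (FunAlg G) where
  antipode := invFun
  mul_antipode_rTensor_comul := by
    refine linearMap_ext fun g => ?_
    simp only [LinearMap.comp_apply, comul_delta, map_sum, LinearMap.rTensor_tmul,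
      invFun_delta, LinearMap.mul'_apply, delta_mul_delta, counit_eq, delta_apply,
      Algebra.linearMap_apply]
    rcases eq_or_ne 1 g with rfl | hg
    · simp only [mul_one, if_true, map_one, ← sum_delta]
      exact Fintype.sum_equiv (Equiv.inv G) _ _ fun _ => rfl
    · rw [if_neg hg, map_zero]
      refine Finset.sum_eq_zero fun x _ => if_neg fun h => hg ?_
      exact mul_left_cancel ((mul_one x⁻¹).trans h)
  mul_antipode_lTensor_comul := by
    refine linearMap_ext fun g => ?_
    simp only [LinearMap.comp_apply, comul_delta, map_sum, LinearMap.lTensor_tmul,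
      invFun_delta, LinearMap.mul'_apply, delta_mul_delta, counit_eq, delta_apply,
      Algebra.linearMap_apply, mul_inv_rev, inv_inv]
    rcases eq_or_ne 1 g with rfl | hg
    · simp only [inv_one, one_mul, if_true, map_one, ← sum_delta]
    · rw [if_neg hg, map_zero]
      refine Finset.sum_eq_zero fun x _ => if_neg fun h => hg ?_
      exact (inv_eq_one.mp (mul_right_cancel (h.symm.trans (one_mul x).symm))).symm

end FunAlg

/-! ### Corepresentations -/

/-- A finite-dimensional (right) corepresentation of `A`, that is, a finite-dimensional
representation of the quantum group with function algebra `A`. -/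
structure Corep (A : Type) [Ring A] [Bialgebra ℂ A] where
  V : Type
  [addCommGroup : AddCommGroup V]
  [module : Module ℂ V]
  [finite : Module.Finite ℂ V]
  coact : V →ₗ[ℂ] V ⊗[ℂ] A
  coassoc : ∀ v, TensorProduct.assoc ℂ V A A (coact.rTensor A (coact v)) =
    (Coalgebra.comul (R := ℂ) (A := A)).lTensor V (coact v)
  counit : ∀ v, TensorProduct.rid ℂ V
    ((Coalgebra.counit (R := ℂ) (A := A)).lTensor V (coact v)) = v

namespace Corep

attribute [instance] addCommGroup module finite

variable {A : Type} [Ring A] [Bialgebra ℂ A]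

/-- Intertwiners: linear maps `f` with `ρ ∘ f = (f ⊗ id) ∘ ρ`. -/
def intertwiners (X Y : Corep A) : Submodule ℂ (X.V →ₗ[ℂ] Y.V) where
  carrier := {f | ∀ v, Y.coact (f v) = f.rTensor A (X.coact v)}
  add_mem' := by
    intro f g hf hg v
    simp only [Set.mem_ofPred_eq] at hf hg
    simp [hf v, hg v, LinearMap.rTensor_add]
  zero_mem' := by intro v; simp
  smul_mem' := by
    intro c f hf v
    simp only [Set.mem_ofPred_eq] at hf
    simp [hf v, LinearMap.rTensor_smul]

lemma comp_mem {X Y Z : Corep A} (f : intertwiners X Y) (g : intertwiners Y Z) :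
    g.1 ∘ₗ f.1 ∈ intertwiners X Z := by
  intro v
  rw [LinearMap.comp_apply, g.2, f.2, LinearMap.rTensor_comp, LinearMap.comp_apply]

lemma id_mem (X : Corep A) : (LinearMap.id : X.V →ₗ[ℂ] X.V) ∈ intertwiners X X := by
  intro v; simp

noncomputable instance category : Category (Corep A) where
  Hom X Y := intertwiners X Y
  id X := ⟨LinearMap.id, id_mem X⟩
  comp f g := ⟨g.1 ∘ₗ f.1, comp_mem f g⟩

/-- The linear map underlying a morphism. -/
def lin {X Y : Corep A} (f : X ⟶ Y) : X.V →ₗ[ℂ] Y.V := f.1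

/-- The morphism given by a linear intertwiner. -/
def mkHom {X Y : Corep A} (f : X.V →ₗ[ℂ] Y.V)
    (hf : ∀ v, Y.coact (f v) = f.rTensor A (X.coact v)) : X ⟶ Y := ⟨f, hf⟩

lemma lin_comm {X Y : Corep A} (f : X ⟶ Y) (v : X.V) :
    Y.coact (lin f v) = (lin f).rTensor A (X.coact v) := f.2 v

lemma hom_ext {X Y : Corep A} {f g : X ⟶ Y} (h : lin f = lin g) : f = g := Subtype.ext h

noncomputable instance preadditive : Preadditive (Corep A) where
  homGroup X Y := inferInstanceAs (AddCommGroup (intertwiners X Y))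
  add_comp _ _ _ _ _ _ := Subtype.ext (LinearMap.comp_add _ _ _)
  comp_add _ _ _ _ _ _ := Subtype.ext (LinearMap.add_comp _ _ _)

noncomputable instance linear : Linear ℂ (Corep A) where
  homModule X Y := inferInstanceAs (Module ℂ (intertwiners X Y))
  smul_comp _ _ _ _ _ _ := Subtype.ext (LinearMap.comp_smul _ _ _)
  comp_smul _ _ _ _ _ _ := Subtype.ext (LinearMap.smul_comp _ _ _)

/-- `(v ⊗ a) ⊗ (w ⊗ b) ↦ (v ⊗ w) ⊗ a b`. -/
noncomputable def mulLast (V W : Type) [AddCommGroup V] [Module ℂ V] [AddCommGroup W] [Module ℂ W]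
    (A : Type) [Ring A] [Algebra ℂ A] :
    (V ⊗[ℂ] A) ⊗[ℂ] (W ⊗[ℂ] A) →ₗ[ℂ] (V ⊗[ℂ] W) ⊗[ℂ] A :=
  (LinearMap.mul' ℂ A).lTensor (V ⊗[ℂ] W) ∘ₗ
    (TensorProduct.tensorTensorTensorComm ℂ V A W A).toLinearMap

@[simp] lemma mulLast_tmul (V W : Type) [AddCommGroup V] [Module ℂ V] [AddCommGroup W]
    [Module ℂ W] (A : Type) [Ring A] [Algebra ℂ A] (v : V) (w : W) (a b : A) :
    mulLast V W A ((v ⊗ₜ a) ⊗ₜ (w ⊗ₜ b)) = (v ⊗ₜ w) ⊗ₜ (a * b) := rfl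

/-- The coaction `v ⊗ w ↦ v₀ ⊗ w₀ ⊗ v₁ w₁` on a tensor product. -/
noncomputable def tensorCoact (X Y : Corep A) :
    X.V ⊗[ℂ] Y.V →ₗ[ℂ] (X.V ⊗[ℂ] Y.V) ⊗[ℂ] A :=
  mulLast X.V Y.V A ∘ₗ TensorProduct.map X.coact Y.coact

@[simp] lemma tensorCoact_tmul (X Y : Corep A) (v : X.V) (w : Y.V) :
    tensorCoact X Y (v ⊗ₜ w) = mulLast X.V Y.V A (X.coact v ⊗ₜ Y.coact w) := rfl

lemma tensorCoact_coassoc_aux (X Y : Corep A) (s : X.V ⊗[ℂ] A) (t : Y.V ⊗[ℂ] A) :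
    TensorProduct.assoc ℂ (X.V ⊗[ℂ] Y.V) A A
      ((tensorCoact X Y).rTensor A (mulLast X.V Y.V A (s ⊗ₜ t))) =
    mulLast X.V Y.V (A ⊗[ℂ] A) (TensorProduct.assoc ℂ X.V A A (X.coact.rTensor A s) ⊗ₜ
      TensorProduct.assoc ℂ Y.V A A (Y.coact.rTensor A t)) := by
  induction s with
  | zero => simp
  | add s s' hs hs' => simp only [TensorProduct.add_tmul, map_add, hs, hs']
  | tmul v a =>
    induction t with
    | zero => simp
    | add t t' ht ht' => simp only [TensorProduct.tmul_add, map_add, ht, ht']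
    | tmul w b =>
      simp only [mulLast_tmul, LinearMap.rTensor_tmul, tensorCoact_tmul]
      generalize X.coact v = s
      generalize Y.coact w = t
      induction s with
      | zero => simp
      | add s s' hs hs' => simp only [TensorProduct.add_tmul, map_add, hs, hs']
      | tmul v a =>
        induction t with
        | zero => simp
        | add t t' ht ht' =>
          simp only [TensorProduct.tmul_add, TensorProduct.add_tmul, map_add, ht, ht']
        | tmul w b => simp

lemma tensorCoact_comul_aux (X Y : Corep A) (s : X.V ⊗[ℂ] A) (t : Y.V ⊗[ℂ] A) :
    (Coalgebra.comul (R := ℂ) (A := A)).lTensor (X.V ⊗[ℂ] Y.V) (mulLast X.V Y.V A (s ⊗ₜ t)) =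
    mulLast X.V Y.V (A ⊗[ℂ] A) ((Coalgebra.comul (R := ℂ) (A := A)).lTensor X.V s ⊗ₜ
      (Coalgebra.comul (R := ℂ) (A := A)).lTensor Y.V t) := by
  induction s with
  | zero => simp
  | add s s' hs hs' => simp only [TensorProduct.add_tmul, map_add, hs, hs']
  | tmul v a =>
    induction t with
    | zero => simp
    | add t t' ht ht' => simp only [TensorProduct.tmul_add, map_add, ht, ht']
    | tmul w b => simp

lemma tensorCoact_counit_aux (X Y : Corep A) (s : X.V ⊗[ℂ] A) (t : Y.V ⊗[ℂ] A) :
    TensorProduct.rid ℂ (X.V ⊗[ℂ] Y.V)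
      ((Coalgebra.counit (R := ℂ) (A := A)).lTensor (X.V ⊗[ℂ] Y.V)
        (mulLast X.V Y.V A (s ⊗ₜ t))) =
    (TensorProduct.rid ℂ X.V ((Coalgebra.counit (R := ℂ) (A := A)).lTensor X.V s)) ⊗ₜ
      (TensorProduct.rid ℂ Y.V ((Coalgebra.counit (R := ℂ) (A := A)).lTensor Y.V t)) := by
  induction s with
  | zero => simp
  | add s s' hs hs' => simp only [TensorProduct.add_tmul, map_add, hs, hs']
  | tmul v a =>
    induction t with
    | zero => simp
    | add t t' ht ht' => simp only [TensorProduct.tmul_add, map_add, ht, ht']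
    | tmul w b =>
      simp only [mulLast_tmul, LinearMap.lTensor_tmul, TensorProduct.rid_tmul,
        Bialgebra.counit_mul, TensorProduct.tmul_smul, ← TensorProduct.smul_tmul', smul_smul]
      rw [mul_comm]

/-- The tensor product of corepresentations. -/
noncomputable def tensor (X Y : Corep A) : Corep A where
  V := X.V ⊗[ℂ] Y.V
  coact := tensorCoact X Y
  coassoc v := by
    induction v with
    | zero => simp
    | add v w hv hw => simp only [map_add, hv, hw]
    | tmul v w =>
      rw [tensorCoact_tmul, tensorCoact_coassoc_aux, tensorCoact_comul_aux, X.coassoc, Y.coassoc]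
  counit v := by
    induction v with
    | zero => simp
    | add v w hv hw => simp only [map_add, hv, hw]
    | tmul v w => rw [tensorCoact_tmul, tensorCoact_counit_aux, X.counit, Y.counit]

/-- The trivial corepresentation `1 ↦ 1 ⊗ 1`. -/
noncomputable def trivial (A : Type) [Ring A] [Bialgebra ℂ A] : Corep A where
  V := ℂ
  coact := (TensorProduct.mk ℂ ℂ A).flip 1
  coassoc v := by simp [Algebra.TensorProduct.one_def]
  counit v := by simp

lemma map_mem {X X' Y Y' : Corep A} (f : X ⟶ X') (g : Y ⟶ Y') (v : (tensor X Y).V) :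
    (tensor X' Y').coact (TensorProduct.map (lin f) (lin g) v) =
      (TensorProduct.map (lin f) (lin g)).rTensor A ((tensor X Y).coact v) := by
  have key : ∀ (v : X.V) (w : Y.V),
      mulLast X'.V Y'.V A (X'.coact (lin f v) ⊗ₜ Y'.coact (lin g w)) =
      (TensorProduct.map (lin f) (lin g)).rTensor A
        (mulLast X.V Y.V A (X.coact v ⊗ₜ Y.coact w)) := by
    intro v w
    rw [lin_comm, lin_comm]
    generalize X.coact v = s
    generalize Y.coact w = t
    induction s with
    | zero => simp
    | add s s' hs hs' => simp only [TensorProduct.add_tmul, map_add, hs, hs']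
    | tmul v a =>
      induction t with
      | zero => simp
      | add t t' ht ht' => simp only [TensorProduct.tmul_add, map_add, ht, ht']
      | tmul w b => simp
  exact LinearMap.congr_fun (TensorProduct.ext' (g := tensorCoact X' Y' ∘ₗ _)
    (h := LinearMap.rTensor A _ ∘ₗ tensorCoact X Y) key) v

/-- The tensor product of intertwiners. -/
noncomputable def tensorMap {X X' Y Y' : Corep A} (f : X ⟶ X') (g : Y ⟶ Y') :
    tensor X Y ⟶ tensor X' Y' :=
  mkHom (TensorProduct.map (lin f) (lin g)) (map_mem f g)

/-- The isomorphism given by a bijective linear intertwiner. -/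
noncomputable def mkIso {X Y : Corep A} (e : X.V ≃ₗ[ℂ] Y.V)
    (he : ∀ v, Y.coact (e v) = e.toLinearMap.rTensor A (X.coact v)) : X ≅ Y where
  hom := mkHom e.toLinearMap he
  inv := mkHom e.symm.toLinearMap (fun w => by
    obtain ⟨v, rfl⟩ := e.surjective w
    rw [LinearEquiv.coe_coe, e.symm_apply_apply, he, ← LinearMap.comp_apply,
      ← LinearMap.rTensor_comp]
    simp)
  hom_inv_id := hom_ext (LinearMap.ext fun v => e.symm_apply_apply v)
  inv_hom_id := hom_ext (LinearMap.ext fun v => e.apply_symm_apply v)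

lemma assoc_comm (X Y Z : Corep A) (v : (tensor (tensor X Y) Z).V) :
    (tensor X (tensor Y Z)).coact (TensorProduct.assoc ℂ X.V Y.V Z.V v) =
      (TensorProduct.assoc ℂ X.V Y.V Z.V).toLinearMap.rTensor A
        ((tensor (tensor X Y) Z).coact v) := by
  have key : ∀ (x : X.V) (y : Y.V) (z : Z.V),
      mulLast X.V (Y.V ⊗[ℂ] Z.V) A (X.coact x ⊗ₜ mulLast Y.V Z.V A (Y.coact y ⊗ₜ Z.coact z)) =
      (TensorProduct.assoc ℂ X.V Y.V Z.V).toLinearMap.rTensor A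
        (mulLast (X.V ⊗[ℂ] Y.V) Z.V A
          (mulLast X.V Y.V A (X.coact x ⊗ₜ Y.coact y) ⊗ₜ Z.coact z)) := by
    intro x y z
    generalize X.coact x = r
    generalize Y.coact y = s
    generalize Z.coact z = t
    induction r with
    | zero => simp
    | add r r' hr hr' => simp only [TensorProduct.add_tmul, map_add, hr, hr']
    | tmul x a =>
      induction s with
      | zero => simp
      | add s s' hs hs' =>
        simp only [TensorProduct.tmul_add, TensorProduct.add_tmul, map_add, hs, hs']
      | tmul y b =>
        induction t with
        | zero => simp
        | add t t' ht ht' => simp only [TensorProduct.tmul_add, map_add, ht, ht']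
        | tmul z c => simp [mul_assoc]
  exact LinearMap.congr_fun (TensorProduct.ext_threefold
    (g := tensorCoact X (tensor Y Z) ∘ₗ (TensorProduct.assoc ℂ X.V Y.V Z.V).toLinearMap)
    (h := LinearMap.rTensor A _ ∘ₗ tensorCoact (tensor X Y) Z) key) v

lemma lid_comm (X : Corep A) (v : (tensor (trivial A) X).V) :
    X.coact (TensorProduct.lid ℂ X.V v) =
      (TensorProduct.lid ℂ X.V).toLinearMap.rTensor A ((tensor (trivial A) X).coact v) := by
  have key : ∀ (c : ℂ) (x : X.V), X.coact (TensorProduct.lid ℂ X.V (c ⊗ₜ x)) =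
      (TensorProduct.lid ℂ X.V).toLinearMap.rTensor A
        (mulLast ℂ X.V A ((c ⊗ₜ 1) ⊗ₜ X.coact x)) := by
    intro c x
    rw [TensorProduct.lid_tmul, map_smul]
    generalize X.coact x = s
    induction s with
    | zero => simp
    | add s s' hs hs' => simp only [TensorProduct.tmul_add, map_add, smul_add, hs, hs']
    | tmul v a => simp [TensorProduct.smul_tmul']
  exact LinearMap.congr_fun (TensorProduct.ext'
    (g := X.coact ∘ₗ (TensorProduct.lid ℂ X.V).toLinearMap)
    (h := LinearMap.rTensor A _ ∘ₗ tensorCoact (trivial A) X) key) v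

lemma rid_comm (X : Corep A) (v : (tensor X (trivial A)).V) :
    X.coact (TensorProduct.rid ℂ X.V v) =
      (TensorProduct.rid ℂ X.V).toLinearMap.rTensor A ((tensor X (trivial A)).coact v) := by
  have key : ∀ (x : X.V) (c : ℂ), X.coact (TensorProduct.rid ℂ X.V (x ⊗ₜ c)) =
      (TensorProduct.rid ℂ X.V).toLinearMap.rTensor A
        (mulLast X.V ℂ A (X.coact x ⊗ₜ (c ⊗ₜ 1))) := by
    intro x c
    rw [TensorProduct.rid_tmul, map_smul]
    generalize X.coact x = s
    induction s with
    | zero => simp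
    | add s s' hs hs' => simp only [TensorProduct.add_tmul, map_add, smul_add, hs, hs']
    | tmul v a => simp [TensorProduct.smul_tmul']
  exact LinearMap.congr_fun (TensorProduct.ext'
    (g := X.coact ∘ₗ (TensorProduct.rid ℂ X.V).toLinearMap)
    (h := LinearMap.rTensor A _ ∘ₗ tensorCoact X (trivial A)) key) v

noncomputable instance monoidalCategoryStruct : MonoidalCategoryStruct (Corep A) where
  tensorObj := tensor
  tensorHom f g := tensorMap f g
  whiskerLeft X _ _ f := tensorMap (𝟙 X) f
  whiskerRight f Y := tensorMap f (𝟙 Y)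
  tensorUnit := trivial A
  associator X Y Z := mkIso (TensorProduct.assoc ℂ X.V Y.V Z.V) (assoc_comm X Y Z)
  leftUnitor X := mkIso (TensorProduct.lid ℂ X.V) (lid_comm X)
  rightUnitor X := mkIso (TensorProduct.rid ℂ X.V) (rid_comm X)

/-- The forgetful functor to vector spaces. -/
noncomputable def forgetToModule (A : Type) [Ring A] [Bialgebra ℂ A] :
    Corep A ⥤ ModuleCat.{0} ℂ where
  obj X := ModuleCat.of ℂ X.V
  map f := ModuleCat.ofHom (lin f)

instance : (forgetToModule A).Faithful where
  map_injective h := hom_ext (ModuleCat.hom_ext_iff.mp h)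

/-- The tensor category of finite-dimensional corepresentations. -/
noncomputable instance monoidalCategory : MonoidalCategory (Corep A) :=
  Monoidal.induced (forgetToModule A)
    { μIso := fun _ _ => Iso.refl _
      εIso := Iso.refl _
      whiskerLeft_eq := fun _ _ _ _ => ModuleCat.hom_ext (TensorProduct.ext' fun _ _ => rfl)
      whiskerRight_eq := fun _ _ => ModuleCat.hom_ext (TensorProduct.ext' fun _ _ => rfl)
      tensorHom_eq := fun _ _ => ModuleCat.hom_ext (TensorProduct.ext' fun _ _ => rfl)
      associator_eq := fun _ _ _ => ModuleCat.hom_ext (TensorProduct.ext_threefold fun _ _ _ => rfl)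
      leftUnitor_eq := fun _ => ModuleCat.hom_ext (TensorProduct.ext' fun _ _ => rfl)
      rightUnitor_eq := fun _ => ModuleCat.hom_ext (TensorProduct.ext' fun _ _ => rfl) }

end Corep

/-! ### Hopf 2-cocycles and twists -/

section Twist

variable {H : Type} [Ring H] [Bialgebra ℂ H]

/-- A (normalized, convolution invertible) Hopf 2-cocycle `σ : H ⊗ H → ℂ`:
`σ(x₁, y₁) σ(x₂ y₂, z) = σ(y₁, z₁) σ(x, y₂ z₂)` and `σ(x, 1) = ε(x) = σ(1, x)`.
`WithConv` carries the convolution product, so that both sides of the first identity are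
convolution products of linear forms on `(H ⊗ H) ⊗ H`. -/
structure IsHopfCocycle (σ : (WithConv (H ⊗[ℂ] H →ₗ[ℂ] ℂ))ˣ) : Prop where
  cocycle :
    WithConv.toConv (LinearMap.mul' ℂ ℂ ∘ₗ
        TensorProduct.map σ.val.ofConv (Coalgebra.counit (R := ℂ) (A := H))) *
      WithConv.toConv (σ.val.ofConv ∘ₗ (LinearMap.mul' ℂ H).rTensor H) =
    WithConv.toConv (LinearMap.mul' ℂ ℂ ∘ₗ
        TensorProduct.map (Coalgebra.counit (R := ℂ) (A := H)) σ.val.ofConv ∘ₗ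
        (TensorProduct.assoc ℂ H H H).toLinearMap) *
      WithConv.toConv (σ.val.ofConv ∘ₗ (LinearMap.mul' ℂ H).lTensor H ∘ₗ
        (TensorProduct.assoc ℂ H H H).toLinearMap)
  right_unit : ∀ x : H, σ.val.ofConv (x ⊗ₜ 1) = Coalgebra.counit (R := ℂ) x
  left_unit : ∀ x : H, σ.val.ofConv (1 ⊗ₜ x) = Coalgebra.counit (R := ℂ) x

/-- The twisted product `x ⊗ y ↦ σ(x₁, y₁) x₂ y₂ σ⁻¹(x₃, y₃)`, as a convolution product of linear
maps `H ⊗ H → H`. -/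
noncomputable def twistMul (σ : (WithConv (H ⊗[ℂ] H →ₗ[ℂ] ℂ))ˣ) : H ⊗[ℂ] H →ₗ[ℂ] H :=
  (WithConv.toConv (Algebra.linearMap ℂ H ∘ₗ σ.val.ofConv) *
    WithConv.toConv (LinearMap.mul' ℂ H) *
    WithConv.toConv (Algebra.linearMap ℂ H ∘ₗ σ⁻¹.val.ofConv)).ofConv

/-- `A` is isomorphic to the twist `H^σ`: the coalgebra `H` with the same unit and with the
twisted product. -/
def IsTwistBy (A : Type) [Ring A] [Bialgebra ℂ A] (σ : (WithConv (H ⊗[ℂ] H →ₗ[ℂ] ℂ))ˣ) : Prop :=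
  ∃ e : A ≃ₗc[ℂ] H, e 1 = 1 ∧ ∀ x y : A, e (x * y) = twistMul σ (e x ⊗ₜ e y)

end Twist

/-- The restriction map `C(G) → C(K)` to a subgroup `K` of `G`. -/
def FunAlg.restrict {G : Type} [Group G] (K : Subgroup G) : FunAlg G →ₗ[ℂ] FunAlg K where
  toFun f := fun x => f x
  map_add' _ _ := rfl
  map_smul' _ _ := rfl

/-- `A` is a 2-cocycle twist of `C(G)`, by a Hopf 2-cocycle on `C(G)` that is induced from the
subgroup `K`: it is the pull-back of a Hopf 2-cocycle on `C(K)` along the restriction map. -/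
def IsTwistInducedFrom (A : Type) [Ring A] [Bialgebra ℂ A] {G : Type} [Group G] [Fintype G]
    [DecidableEq G] (K : Subgroup G) [DecidablePred (· ∈ K)] : Prop :=
  ∃ (τ : (WithConv (FunAlg K ⊗[ℂ] FunAlg K →ₗ[ℂ] ℂ))ˣ)
    (σ : (WithConv (FunAlg G ⊗[ℂ] FunAlg G →ₗ[ℂ] ℂ))ˣ),
    IsHopfCocycle τ ∧ IsHopfCocycle σ ∧
    σ.val.ofConv = τ.val.ofConv ∘ₗ
      TensorProduct.map (FunAlg.restrict K) (FunAlg.restrict K) ∧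
    IsTwistBy A σ

/-! ### The subgroup `Z₂ⁿ` of `S_{2n}` -/

/-- The index `i*` of the pair that contains the point `i`; the points are numbered from `0`, so
that the pairs are `{0, 1}, {2, 3}, …`. -/
def pairIndex {n : ℕ} (i : Fin (2 * n)) : Fin n := ⟨i.val / 2, by omega⟩

/-- The other point `i'` of the pair that contains `i`. -/
def partner {n : ℕ} (i : Fin (2 * n)) : Fin (2 * n) :=
  if h : i.val % 2 = 0 then ⟨i.val + 1, by omega⟩ else ⟨i.val - 1, by omega⟩

/-- The permutations that preserve each of the `n` pairs `{i, i'}`: the subgroup generated by the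
`n` commuting transpositions `(i i')`, which is a copy of `Z₂ⁿ`. -/
def pairSubgroup (n : ℕ) : Subgroup (Equiv.Perm (Fin (2 * n))) where
  carrier := {g | ∀ i, pairIndex (g i) = pairIndex i}
  mul_mem' {g h} hg hh i := (hg (h i)).trans (hh i)
  one_mem' _ := rfl
  inv_mem' {g} hg i := by
    have h := hg (g⁻¹ i)
    rw [show g (g⁻¹ i) = i from g.apply_symm_apply i] at h
    exact h.symm

instance (n : ℕ) : DecidablePred (· ∈ pairSubgroup n) := fun g =>
  inferInstanceAs (Decidable (∀ i, pairIndex (g i) = pairIndex i))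

/-! ### Finite quantum permutation groups -/

/-- A finite Hopf (C*-)algebra, that is, the function algebra of a finite quantum group: a
finite-dimensional C*-algebra with a comultiplication, a counit and an antipode that are
morphisms of C*-algebras `A → A ⊗ A`, `A → ℂ`, `A → Aᵒᵖ`. (The antipode of a Hopf algebra is always
an algebra morphism to the opposite algebra, and the C*-norm of a `*`-algebra is unique.) -/
structure FiniteQuantumGroup where
  A : Type
  [ring : Ring A]
  [hopfAlgebra : HopfAlgebra ℂ A]
  [starRing : StarRing A]
  [starModule : StarModule ℂ A]
  [finite : Module.Finite ℂ A]
  isCStar : ∃ (B : Type) (_ : CStarAlgebra B), Nonempty (A ≃⋆ₐ[ℂ] B)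
  comul_star : ∀ a : A, Coalgebra.comul (R := ℂ) (star a) = star (Coalgebra.comul (R := ℂ) a)
  counit_star : ∀ a : A, Coalgebra.counit (R := ℂ) (star a) = star (Coalgebra.counit (R := ℂ) a)
  antipode_star : ∀ a : A, HopfAlgebra.antipode ℂ (star a) = star (HopfAlgebra.antipode ℂ a)

attribute [instance] FiniteQuantumGroup.ring FiniteQuantumGroup.hopfAlgebra
  FiniteQuantumGroup.starRing FiniteQuantumGroup.starModule FiniteQuantumGroup.finite

/-- Magic unitary matrices: the entries are projections, and on each row and each column these
projections are orthogonal and sum up to `1`. -/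
structure IsMagicUnitary {N : ℕ} {A : Type} [Ring A] [StarRing A]
    (u : Matrix (Fin N) (Fin N) A) : Prop where
  isStarProjection : ∀ i j, IsStarProjection (u i j)
  row_orthogonal : ∀ i j k, j ≠ k → u i j * u i k = 0
  col_orthogonal : ∀ i j k, i ≠ k → u i j * u k j = 0
  row_sum : ∀ i, ∑ j, u i j = 1
  col_sum : ∀ j, ∑ i, u i j = 1

/-- The finite quantum group `Q` acts (faithfully) on `N` points, as a quantum permutation group,
through the magic unitary `u`: the entries of `u` generate the algebra, and
`Δ(u_ij) = ∑ u_ik ⊗ u_kj`, `ε(u_ij) = δ_ij`, `S(u_ij) = u_ji`. In other words, `Q` is a quantum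
subgroup of the quantum permutation group of `N` points. -/
structure IsQuantumPermutationGroup (Q : FiniteQuantumGroup) {N : ℕ}
    (u : Matrix (Fin N) (Fin N) Q.A) : Prop where
  magic : IsMagicUnitary u
  generates : Algebra.adjoin ℂ {a | ∃ i j, a = u i j} = ⊤
  comul_apply : ∀ i j, Coalgebra.comul (R := ℂ) (u i j) = ∑ k, u i k ⊗ₜ[ℂ] u k j
  counit_apply : ∀ i j, Coalgebra.counit (R := ℂ) (u i j) = if i = j then 1 else 0
  antipode_apply : ∀ i j, HopfAlgebra.antipode ℂ (u i j) = u j i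

/-! ### The algebras `C_p(S_{2n})` -/

/-- Symmetric matrices with entries `±1` and with ones on the diagonal. -/
structure IsSignMatrix {n : ℕ} (p : Matrix (Fin n) (Fin n) ℂ) : Prop where
  diag : ∀ i, p i i = 1
  symm : ∀ i j, p i j = p j i
  sign : ∀ i j, p i j = 1 ∨ p i j = -1

/-- The relations between the entries of `u` that define `C_p(S_{2n})`. -/
def TwistedCommutation {n : ℕ} (p : Matrix (Fin n) (Fin n) ℂ) {A : Type} [Ring A] [Algebra ℂ A]
    (u : Matrix (Fin (2 * n)) (Fin (2 * n)) A) : Prop :=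
  ∀ i j k l,
    (3 + p (pairIndex i) (pairIndex j)) • (u k j * u l i) +
      (1 - p (pairIndex i) (pairIndex j)) • (u k j * u l (partner i)) +
      (1 - p (pairIndex i) (pairIndex j)) • (u k (partner j) * u l i) +
      (p (pairIndex i) (pairIndex j) - 1) • (u k (partner j) * u l (partner i)) =
    (3 + p (pairIndex l) (pairIndex k)) • (u l i * u k j) +
      (1 - p (pairIndex l) (pairIndex k)) • (u (partner l) i * u k j) +
      (1 - p (pairIndex l) (pairIndex k)) • (u l i * u (partner k) j) +
      (p (pairIndex l) (pairIndex k) - 1) • (u (partner l) i * u (partner k) j)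

/-- `A`, with the matrix `u`, is the universal C*-algebra `C_p(S_{2n})` generated by the entries of
a magic unitary matrix of size `2n` subject to the relations `TwistedCommutation p`, that is, the
quotient by these relations of the universal C*-algebra of a magic unitary matrix. -/
structure IsTwistedSymmetricAlgebra {n : ℕ} (p : Matrix (Fin n) (Fin n) ℂ) {A : Type} [Ring A]
    [StarRing A] [Algebra ℂ A] (u : Matrix (Fin (2 * n)) (Fin (2 * n)) A) : Prop where
  magic : IsMagicUnitary u
  relations : TwistedCommutation p u
  universal : ∀ (B : Type) [CStarAlgebra B] (v : Matrix (Fin (2 * n)) (Fin (2 * n)) B),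
    IsMagicUnitary v → TwistedCommutation p v → ∃! f : A →⋆ₐ[ℂ] B, ∀ i j, f (u i j) = v i j

/-- The quantum group with function algebra `A` has the same tensor category of representations
as the finite group `G`: there is a `ℂ`-linear monoidal equivalence between the category of
finite-dimensional corepresentations of `A` and that of finite-dimensional complex
representations of `G`. -/
def SameTensorCategory (A : Type) [Ring A] [Bialgebra ℂ A] (G : Type) [Group G] : Prop :=
  ∃ (F : Corep A ⥤ FDRep ℂ G) (_ : F.Additive),
    F.IsEquivalence ∧ F.Linear ℂ ∧ Nonempty F.Monoidal

/-! Let `M = Z₂ⁿ` act on the `2n` points by flips of the pairs. For a finite set of pairs of flips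
`(a, b)`, the element `J = ∏ (1 + a ⊗ 1 + 1 ⊗ b - a ⊗ b) / 2` of `ℂ[M × M]` is a bicharacter on the
dual of `M`; hence it is a 2-cocycle, and `J² = 1`. Read as a linear form on `C(M) ⊗ C(M)` and
pulled back to `C(S_{2n})`, it keeps the coalgebra and replaces the product by `(f · g)(x) = ⟨f ⊗ g,
J (x, x) J⟩` (`TwGroup.mul_eq`, `FunAlg.twistMul_cocycleUnit`). The involution and the antipode are
corrected by `U`, the image of `J` under multiplication. All axioms become identities between `J`
and `U` in group algebras, transported by `linExt`. The left regular representation on `ℓ²` gives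
the C*-norm. Since the coalgebra is unchanged, corepresentations are representations of `S_{2n}`,
and the action of `J` on `V ⊗ W` makes this equivalence monoidal (`TwGroup.act_twistMap`,
`TwGroup.twistMap_assoc`).

To find the twist that gives `C_p(S_{2n})`, let `D` be the graph on the pairs with `p_ab = -1`, and
take the pairs `(a, b)` of `D` with `a < b`. The twisted product `u_kj u_li` is then the pointwise
product, transformed by `pairTwist` in the rows `(k, l)` and in the columns `(j, i)` for the lower
half of `D`; the product in the other order involves the upper half. These operators are commuting
involutions and the two halves compose to `D`, so commutation of the pointwise entries is equivalent
to the defining relations. The whole of `D` would be symmetric and would keep the product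
commutative.

The same equivalence gives universality: a matrix `v` over `B` that satisfies the relations is
spread to a flip-equivariant matrix of `B`-valued functions on `M × M`, whose entries commute for
the twisted product. So `C(S_{2n})` maps to these functions, and evaluation at `1` is a morphism
from the twist to `B` (`TwSym.exists_algHom`).

The algebras are distinguished by their number of characters. A character is a permutation `g` whose
matrix satisfies the relations. If the graph has no isolated vertex, this means that `g` permutes
the pairs by a graph automorphism. For the threshold graphs used here the automorphisms are the
permutations that fix the first `i` vertices, with `0 ≤ i ≤ n - 2`; together with the empty graph,
whose characters are all of `S_{2n}`, this gives `n` strictly decreasing sets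
(`classicalPoints_ssubset`). -/

/-! ### Linear extension to group algebras -/

section LinExt

variable {X Y Z V W : Type} [AddCommGroup V] [Module ℂ V] [AddCommGroup W] [Module ℂ W]

/-- The linear extension of a function on `X` to the space spanned by `X`. -/
noncomputable def linExt (h : X → V) : MonoidAlgebra ℂ X →ₗ[ℂ] V :=
  Finsupp.linearCombination ℂ h ∘ₗ (MonoidAlgebra.coeffLinearEquiv ℂ).toLinearMap

@[simp] lemma linExt_single (h : X → V) (x : X) (c : ℂ) :
    linExt h (MonoidAlgebra.single x c) = c • h x := by
  simp [linExt, MonoidAlgebra.coeffLinearEquiv]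

lemma linearMap_ext_single {F F' : MonoidAlgebra ℂ X →ₗ[ℂ] V}
    (h : ∀ x, F (MonoidAlgebra.single x 1) = F' (MonoidAlgebra.single x 1)) : F = F' := by
  refine MonoidAlgebra.lhom_ext' fun x => LinearMap.ext_ring ?_
  simpa using h x

lemma map_linExt (L : V →ₗ[ℂ] W) (h : X → V) (z : MonoidAlgebra ℂ X) :
    L (linExt h z) = linExt (fun x => L (h x)) z :=
  LinearMap.congr_fun (linearMap_ext_single (F := L ∘ₗ linExt h) fun x => by simp) z

lemma linExt_apply_single (F : MonoidAlgebra ℂ X →ₗ[ℂ] V) (z : MonoidAlgebra ℂ X) :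
    linExt (fun x => F (MonoidAlgebra.single x 1)) z = F z :=
  LinearMap.congr_fun (linearMap_ext_single fun x => by simp) z

lemma linExt_add (h h' : X → V) (z : MonoidAlgebra ℂ X) :
    linExt (fun x => h x + h' x) z = linExt h z + linExt h' z :=
  LinearMap.congr_fun (linearMap_ext_single (F' := linExt h + linExt h') fun x => by simp) z

lemma linExt_smul (c : ℂ) (h : X → V) (z : MonoidAlgebra ℂ X) :
    linExt (fun x => c • h x) z = c • linExt h z :=
  LinearMap.congr_fun (linearMap_ext_single (F' := c • linExt h) fun x => by simp) z

lemma linExt_zero (z : MonoidAlgebra ℂ X) : linExt (fun _ => (0 : V)) z = 0 := by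
  simpa using linExt_smul 0 (fun _ => (0 : V)) z

lemma linExt_sum {ι : Type} (s : Finset ι) (h : ι → X → V) (z : MonoidAlgebra ℂ X) :
    linExt (fun x => ∑ i ∈ s, h i x) z = ∑ i ∈ s, linExt (h i) z := by
  classical
  induction s using Finset.induction_on with
  | empty => simpa using linExt_zero z
  | insert i s hi ih => simp only [Finset.sum_insert hi, linExt_add, ih]

lemma linExt_mul_const {B : Type} [Ring B] [Algebra ℂ B] (h : X → B) (b : B)
    (z : MonoidAlgebra ℂ X) : linExt h z * b = linExt (fun x => h x * b) z :=
  map_linExt (LinearMap.mulRight ℂ b) h z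

lemma const_mul_linExt {B : Type} [Ring B] [Algebra ℂ B] (h : X → B) (b : B)
    (z : MonoidAlgebra ℂ X) : b * linExt h z = linExt (fun x => b * h x) z :=
  map_linExt (LinearMap.mulLeft ℂ b) h z

lemma linExt_swap (h : X → Y → V) (z : MonoidAlgebra ℂ X) (w : MonoidAlgebra ℂ Y) :
    linExt (fun x => linExt (h x) w) z = linExt (fun y => linExt (fun x => h x y) z) w :=
  LinearMap.congr_fun (linearMap_ext_single (F' := linExt (fun y => linExt (fun x => h x y) z))
    (F := { toFun := fun w => linExt (fun x => linExt (h x) w) z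
            map_add' := fun a b => by simp only [map_add, linExt_add]
            map_smul' := fun c a => by simp only [map_smul, linExt_smul, RingHom.id_apply] })
    fun y => by simp) w

/-- The conjugation of coefficients. -/
noncomputable def conjCoeff (X : Type) [Monoid X] : MonoidAlgebra ℂ X →+* MonoidAlgebra ℂ X :=
  MonoidAlgebra.mapRingHom X (starRingEnd ℂ)

@[simp] lemma conjCoeff_single [Monoid X] (x : X) (c : ℂ) :
    conjCoeff X (MonoidAlgebra.single x c) = MonoidAlgebra.single x (star c) := by
  simp [conjCoeff]

lemma star_linExt [Monoid X] [StarAddMonoid V] [StarModule ℂ V] (h : X → V)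
    (z : MonoidAlgebra ℂ X) :
    star (linExt h z) = linExt (fun x => star (h x)) (conjCoeff X z) := by
  induction z using MonoidAlgebra.induction_linear with
  | zero => simp
  | add z z' hz hz' => simp [hz, hz']
  | single x c => simp

variable [Monoid X] [Monoid Y] [Monoid Z]

/-- The morphism of group algebras induced by a morphism of groups. -/
noncomputable abbrev mapG (f : X →* Z) : MonoidAlgebra ℂ X →ₐ[ℂ] MonoidAlgebra ℂ Z :=
  MonoidAlgebra.mapDomainAlgHom ℂ ℂ f

lemma linExt_mapG (h : Z → V) (f : X →* Z) (z : MonoidAlgebra ℂ X) :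
    linExt h (mapG f z) = linExt (fun x => h (f x)) z :=
  LinearMap.congr_fun (linearMap_ext_single (F := linExt h ∘ₗ (mapG f).toLinearMap)
    fun x => by simp) z

/-- Both sides are bilinear in `z` and `w`. This converts an iterated sum into a product in the
group algebra, where identities such as the cocycle identity can be applied. -/
lemma linExt_linExt (h : Z → V) (f : X →* Z) (g : Y →* Z) (z : MonoidAlgebra ℂ X)
    (w : MonoidAlgebra ℂ Y) :
    linExt (fun x => linExt (fun y => h (f x * g y)) w) z = linExt h (mapG f z * mapG g w) := by
  induction z using MonoidAlgebra.induction_linear with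
  | zero => simp
  | add z z' hz hz' => simp only [map_add, add_mul, hz, hz']
  | single x c =>
    induction w using MonoidAlgebra.induction_linear with
    | zero => simp
    | add z z' hz hz' =>
      simp only [linExt_single, map_add, mul_add, smul_add] at *
      rw [hz, hz']
    | single y d => simp [MonoidAlgebra.single_mul_single, smul_smul]

lemma linExt_linExt' (h : Z → V) (f : X →* Z) (g : Y →* Z) (z : MonoidAlgebra ℂ X)
    (w : MonoidAlgebra ℂ Y) :
    linExt (fun x => linExt (fun y => h (g y * f x)) w) z = linExt h (mapG g w * mapG f z) := by
  rw [← linExt_linExt, linExt_swap]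

/-- The right factor `z` becomes the outer sum. This order is what decides, below, in which order
commuting factors have to be written. -/
lemma linExt_mul (h : X → V) (w z : MonoidAlgebra ℂ X) :
    linExt h (w * z) = linExt (fun x => linExt (fun y => h (y * x)) w) z := by
  have := linExt_linExt' h (MonoidHom.id X) (MonoidHom.id X) z w
  simpa using this.symm

lemma linExt_one (h : X → V) : linExt h 1 = h 1 := by
  rw [MonoidAlgebra.one_def, linExt_single, one_smul]

end LinExt

/-! ### The elements `∏ (1 + x + y - x y) / 2` -/

section SignTwist

variable {R S : Type} [CommRing R] [Algebra ℂ R] [CommRing S] [Algebra ℂ S]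

/-- For commuting involutions `x` and `y`, this is the involution that is `-1` on the common
`-1`-eigenspace of `x` and `y`, and `1` on the other common eigenspaces. -/
noncomputable def signTwist (x y : R) : R := (1 / 2 : ℂ) • (1 + x + y - x * y)

lemma two_mul_signTwist (x y : R) : 2 * signTwist x y = 1 + x + y - x * y := by
  rw [signTwist, mul_smul_comm, two_mul, ← two_smul ℂ, smul_smul]
  norm_num

lemma two_mul_cancel {x y : R} (h : 2 * x = 2 * y) : x = y := by
  have := congrArg (fun z => (1 / 2 : ℂ) • z) h
  simpa [two_mul, ← two_smul ℂ, smul_smul] using this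

lemma map_signTwist (f : R →+* S) (x y : R) : f (signTwist x y) = signTwist (f x) (f y) := by
  refine two_mul_cancel ?_
  rw [two_mul_signTwist, ← map_ofNat f 2, ← map_mul, two_mul_signTwist]
  simp

lemma signTwist_one_left (y : R) : signTwist 1 y = 1 :=
  two_mul_cancel (by rw [two_mul_signTwist]; ring)

lemma signTwist_comm (x y : R) : signTwist x y = signTwist y x := by
  simp only [signTwist]; congr 1; ring

/-- Where `y = 1` the element `signTwist x y` is `1`, and where `y = -1` it is `x`; both are
multiplicative in `x`. This bilinearity is the source of all the identities satisfied by the twist.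
-/
lemma signTwist_mul_left (x x' : R) {y : R} (hy : y * y = 1) :
    signTwist (x * x') y = signTwist x y * signTwist x' y := by
  refine two_mul_cancel (two_mul_cancel ?_)
  rw [two_mul_signTwist, show 2 * (2 * (signTwist x y * signTwist x' y)) =
    (2 * signTwist x y) * (2 * signTwist x' y) by ring, two_mul_signTwist, two_mul_signTwist]
  linear_combination (-(1 - x) * (1 - x')) * hy

variable {M N κ κ' : Type} [CommGroup M] [CommGroup N]

/-- The product of the elements `signTwist (x k) (y k)` of the group algebra. -/
noncomputable def twistElt (s : Finset κ) (x y : κ → M) : MonoidAlgebra ℂ M :=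
  ∏ k ∈ s, signTwist (MonoidAlgebra.single (x k) 1) (MonoidAlgebra.single (y k) 1)

lemma mapG_twistElt (f : M →* N) (s : Finset κ) (x y : κ → M) :
    mapG f (twistElt s x y) = twistElt s (fun k => f (x k)) (fun k => f (y k)) := by
  rw [twistElt, map_prod]
  refine Finset.prod_congr rfl fun k _ => ?_
  refine (map_signTwist (mapG f).toRingHom _ _).trans ?_
  simp

lemma conjCoeff_twistElt (s : Finset κ) (x y : κ → M) :
    conjCoeff M (twistElt s x y) = twistElt s x y := by
  rw [twistElt, map_prod]
  refine Finset.prod_congr rfl fun k _ => ?_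
  rw [map_signTwist]
  simp

lemma single_mul_self_of {x : M} (h : x * x = 1) :
    MonoidAlgebra.single x (1 : ℂ) * MonoidAlgebra.single x 1 = 1 := by
  rw [MonoidAlgebra.single_mul_single, h, mul_one, MonoidAlgebra.one_def]

lemma twistElt_mul_left (s : Finset κ) (x x' : κ → M) {y : κ → M} (hy : ∀ k, y k * y k = 1) :
    twistElt s (fun k => x k * x' k) y = twistElt s x y * twistElt s x' y := by
  rw [twistElt, twistElt, twistElt, ← Finset.prod_mul_distrib]
  refine Finset.prod_congr rfl fun k _ => ?_
  rw [← signTwist_mul_left _ _ (single_mul_self_of (hy k)), MonoidAlgebra.single_mul_single,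
    mul_one]

lemma twistElt_comm (s : Finset κ) (x y : κ → M) : twistElt s x y = twistElt s y x :=
  Finset.prod_congr rfl fun _ _ => signTwist_comm _ _

lemma twistElt_mul_right (s : Finset κ) {x : κ → M} (hx : ∀ k, x k * x k = 1) (y y' : κ → M) :
    twistElt s x (fun k => y k * y' k) = twistElt s x y * twistElt s x y' := by
  rw [twistElt_comm, twistElt_mul_left s _ _ hx, twistElt_comm s y, twistElt_comm s y']

lemma twistElt_one_left (s : Finset κ) (y : κ → M) : twistElt s (fun _ => 1) y = 1 :=
  Finset.prod_eq_one fun k _ => by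
    rw [← MonoidAlgebra.one_def, signTwist_one_left]

lemma twistElt_one_right (s : Finset κ) (x : κ → M) : twistElt s x (fun _ => 1) = 1 := by
  rw [twistElt_comm, twistElt_one_left]

/-- By bilinearity the square is the twist of `x² = 1` and `y`. The twist is thus its own inverse,
so the same element twists and untwists. -/
lemma twistElt_mul_self (s : Finset κ) {x y : κ → M} (hx : ∀ k, x k * x k = 1)
    (hy : ∀ k, y k * y k = 1) : twistElt s x y * twistElt s x y = 1 := by
  rw [← twistElt_mul_left s _ _ hy, funext hx, twistElt_one_left]

/-- If `x` acts trivially, the factor acts as `(1 + 1 + y - y) / 2 = 1`; likewise for `y`. -/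
lemma linearMap_signTwist_mul {V : Type} [AddCommGroup V] [Module ℂ V] (E : R →ₗ[ℂ] V) (x y : R)
    (h : (∀ z, E (x * z) = E z) ∨ ∀ z, E (y * z) = E z) (z : R) :
    E (signTwist x y * z) = E z := by
  wlog hx : ∀ z, E (x * z) = E z generalizing x y
  · rw [signTwist_comm]
    exact this y x h.symm (h.resolve_left hx)
  have : signTwist x y * z = (1 / 2 : ℂ) • (z + x * z + y * z - x * (y * z)) := by
    rw [signTwist, smul_mul_assoc]; congr 1; ring
  rw [this, map_smul, map_sub, map_add, map_add, hx, hx, add_sub_cancel_right, ← two_smul ℂ,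
    smul_smul]
  norm_num

/-- Factors that act trivially can be omitted. -/
lemma linearMap_twistElt_mul {V : Type} [AddCommGroup V] [Module ℂ V]
    (E : MonoidAlgebra ℂ M →ₗ[ℂ] V) (s : Finset κ) (Q : κ → Prop) [DecidablePred Q] (x y : κ → M)
    (h : ∀ k ∈ s, ¬ Q k → (∀ z, E (MonoidAlgebra.single (x k) 1 * z) = E z) ∨
      ∀ z, E (MonoidAlgebra.single (y k) 1 * z) = E z) (z : MonoidAlgebra ℂ M) :
    E (twistElt s x y * z) = E (twistElt (s.filter Q) x y * z) := by
  classical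
  induction s using Finset.induction_on generalizing z with
  | empty => simp
  | insert k s hk ih =>
    have ih' := ih fun k' hk' => h k' (Finset.mem_insert_of_mem hk')
    have hins : ∀ t : Finset κ, k ∉ t → twistElt (insert k t) x y =
        signTwist (MonoidAlgebra.single (x k) 1) (MonoidAlgebra.single (y k) 1) *
          twistElt t x y := fun t ht => Finset.prod_insert ht
    by_cases hQ : Q k
    · rw [Finset.filter_insert, if_pos hQ]
      rw [hins s hk, hins _ (by simp [hk]), mul_right_comm, mul_comm, ih', mul_left_comm, ← mul_assoc]
    · rw [hins s hk, mul_assoc,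
        linearMap_signTwist_mul E _ _ (h k (Finset.mem_insert_self _ _) hQ), ih',
        Finset.filter_insert, if_neg hQ]

lemma twistElt_disjSum (s : Finset κ) (t : Finset κ') (x y : κ ⊕ κ' → M) :
    twistElt (s.disjSum t) x y =
      twistElt s (fun k => x (.inl k)) (fun k => y (.inl k)) *
        twistElt t (fun k => x (.inr k)) (fun k => y (.inr k)) :=
  Finset.prod_disjSum _ _ _

end SignTwist

/-! ### Twists of function algebras by an elementary abelian 2-group -/

/-- Finitely many pairs `(a k, b k)` of elements of an elementary abelian 2-group `M`, which define
the bicharacter `(χ, ψ) ↦ ∏ (-1) ^ [χ (a k) = -1 = ψ (b k)]` on the dual of `M`. -/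
structure TwistDatum (M : Type) [CommGroup M] where
  κ : Type
  s : Finset κ
  a : κ → M
  b : κ → M
  sq : ∀ m : M, m * m = 1

namespace TwistDatum

variable {M : Type} [CommGroup M] (T : TwistDatum M)

/-- The bicharacter of `T`, as an element of the group algebra. -/
noncomputable def J : MonoidAlgebra ℂ (M × M) :=
  twistElt T.s (fun k => (T.a k, 1)) (fun k => (1, T.b k))

/-- The restriction of the bicharacter to the diagonal. -/
noncomputable def U : MonoidAlgebra ℂ M := twistElt T.s T.a T.b

lemma J_mul_J : T.J * T.J = 1 :=
  twistElt_mul_self _ (fun _ => by simp [T.sq]) (fun _ => by simp [T.sq])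

lemma U_mul_U : T.U * T.U = 1 := twistElt_mul_self _ (fun k => T.sq _) (fun k => T.sq _)

lemma conjCoeff_J : conjCoeff (M × M) T.J = T.J := conjCoeff_twistElt _ _ _

lemma conjCoeff_U : conjCoeff M T.U = T.U := conjCoeff_twistElt _ _ _

/-- Killing one leg of the bicharacter leaves `1`: this is the normalization of the cocycle, which
makes `1` the unit of the twisted product. -/
lemma mapG_fst_J : mapG (MonoidHom.fst M M) T.J = 1 := by
  rw [J, mapG_twistElt]; exact twistElt_one_right _ _

lemma mapG_snd_J : mapG (MonoidHom.snd M M) T.J = 1 := by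
  rw [J, mapG_twistElt]; exact twistElt_one_left _ _

lemma mapG_mul_J : mapG (MonoidHom.coprod (MonoidHom.id M) (MonoidHom.id M)) T.J = T.U := by
  rw [J, mapG_twistElt, U]; congr 1 <;> ext k <;> simp

/-- `(x, y) ↦ (x, x, y)`. -/
def diagLeft (G : Type) [Monoid G] : G × G →* G × G × G :=
  (MonoidHom.fst G G).prod (MonoidHom.id _)

/-- `(x, y) ↦ (x, y, y)`. -/
def diagRight (G : Type) [Monoid G] : G × G →* G × G × G :=
  (MonoidHom.fst G G).prod ((MonoidHom.snd G G).prod (MonoidHom.snd G G))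

/-- `(x, y) ↦ (x, y, 1)`. -/
def inclLeft (G : Type) [Monoid G] : G × G →* G × G × G :=
  (MonoidHom.fst G G).prod ((MonoidHom.snd G G).prod 1)

@[simp] lemma diagLeft_apply {G : Type} [Monoid G] (x : G × G) :
    diagLeft G x = (x.1, x.1, x.2) := rfl
@[simp] lemma diagRight_apply {G : Type} [Monoid G] (x : G × G) :
    diagRight G x = (x.1, x.2, x.2) := rfl
@[simp] lemma inclLeft_apply {G : Type} [Monoid G] (x : G × G) :
    inclLeft G x = (x.1, x.2, 1) := rfl

/-- The 2-cocycle identity. -/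
lemma cocycle : mapG (inclLeft M) T.J * mapG (diagLeft M) T.J =
    mapG (MonoidHom.inr M (M × M)) T.J * mapG (diagRight M) T.J := by
  simp only [J, mapG_twistElt]
  -- With `J₁₂`, `J₁₃`, `J₂₃` denoting `J` placed in two of the three legs, bilinearity gives `J₁₃
  -- J₂₃` here and `J₁₂ J₁₃` in `h2`. Both sides of the identity are therefore `J₁₂ J₁₃ J₂₃`.
  have h1 : twistElt T.s (fun k => diagLeft M (T.a k, 1)) (fun k => diagLeft M (1, T.b k)) =
      twistElt T.s (fun k => (T.a k, 1, 1)) (fun k => (1, 1, T.b k)) *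
        twistElt T.s (fun k => (1, T.a k, 1)) (fun k => (1, 1, T.b k)) := by
    rw [← twistElt_mul_left _ _ _ (fun k => by simp [T.sq])]
    congr 1 <;> ext k <;> simp
  have h2 : twistElt T.s (fun k => diagRight M (T.a k, 1)) (fun k => diagRight M (1, T.b k)) =
      twistElt T.s (fun k => (T.a k, 1, 1)) (fun k => (1, T.b k, 1)) *
        twistElt T.s (fun k => (T.a k, 1, 1)) (fun k => (1, 1, T.b k)) := by
    rw [← twistElt_mul_right _ (fun k => by simp [T.sq])]
    congr 1 <;> ext k <;> simp
  rw [h1, h2]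
  simp only [inclLeft_apply, MonoidHom.inr_apply]
  ring

/-- Expanding `Δ(U)` bilinearly gives four factors: `U ⊗ U`, `J` and the flip `J₂₁`. The factor `J`
cancels since `J² = 1`. The resulting identity `Δ(U) J = J₂₁ (U ⊗ U)` makes the involution reverse
products. -/
lemma mapG_diag_U : mapG ((MonoidHom.id M).prod (MonoidHom.id M)) T.U * T.J =
    mapG (MonoidHom.snd M M |>.prod (MonoidHom.fst M M)) T.J *
      (mapG (MonoidHom.inl M M) T.U * mapG (MonoidHom.inr M M) T.U) := by
  simp only [J, U, mapG_twistElt]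
  have h : twistElt T.s (fun k => (MonoidHom.id M).prod (MonoidHom.id M) (T.a k))
      (fun k => (MonoidHom.id M).prod (MonoidHom.id M) (T.b k)) =
      (twistElt T.s (fun k => (T.a k, 1)) (fun k => (T.b k, 1)) *
        twistElt T.s (fun k => (T.a k, 1)) (fun k => (1, T.b k))) *
      (twistElt T.s (fun k => (1, T.a k)) (fun k => (T.b k, 1)) *
        twistElt T.s (fun k => (1, T.a k)) (fun k => (1, T.b k))) := by
    rw [← twistElt_mul_right _ (fun k => by simp [T.sq]),
      ← twistElt_mul_right _ (fun k => by simp [T.sq]),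
      ← twistElt_mul_left _ _ _ (fun k => by simp [T.sq])]
    congr 1 <;> ext k <;> simp
  rw [h]
  have h' := T.J_mul_J
  rw [J] at h'
  simp only [MonoidHom.prod_apply, MonoidHom.coe_fst, MonoidHom.coe_snd, MonoidHom.inl_apply,
    MonoidHom.inr_apply]
  linear_combination (twistElt T.s (fun k => (T.a k, 1)) (fun k => (T.b k, 1)) *
    twistElt T.s (fun k => (1, T.a k)) (fun k => (T.b k, 1)) *
    twistElt T.s (fun k => (1, T.a k)) (fun k => (1, T.b k))) * h'

/-- Under `(x, y) ↦ (x y, y)`. -/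
lemma mapG_shear_J : mapG ((MonoidHom.coprod (MonoidHom.id M) (MonoidHom.id M)).prod
    (MonoidHom.snd M M)) T.J = mapG (MonoidHom.inl M M) T.U * T.J := by
  simp only [J, U, mapG_twistElt]
  simp only [MonoidHom.inl_apply]
  rw [← twistElt_mul_right _ (fun k => by simp [T.sq])]
  congr 1 <;> ext k <;> simp

/-- Two copies of the same datum, on `M × M`. -/
def double : TwistDatum (M × M) where
  κ := T.κ ⊕ T.κ
  s := T.s.disjSum T.s
  a := Sum.elim (fun k => (T.a k, 1)) (fun k => (1, T.a k))
  b := Sum.elim (fun k => (T.b k, 1)) (fun k => (1, T.b k))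
  sq _ := Prod.ext (T.sq _) (T.sq _)

lemma double_J : T.double.J =
    mapG ((MonoidHom.inl M M).prodMap (MonoidHom.inl M M)) T.J *
      mapG ((MonoidHom.inr M M).prodMap (MonoidHom.inr M M)) T.J := by
  simp only [J, mapG_twistElt]
  exact twistElt_disjSum _ _ _ _

lemma double_U : T.double.U =
    mapG (MonoidHom.inl M M) T.U * mapG (MonoidHom.inr M M) T.U := by
  simp only [U, mapG_twistElt]
  exact twistElt_disjSum _ _ _ _

end TwistDatum

/-- The functions `X → B`, with the product twisted through an action of `M` on `X`. -/
def TwFun {M : Type} [CommGroup M] (_T : TwistDatum M) {X : Type} (_α : M →* Equiv.Perm X)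
    (B : Type) : Type := X → B

namespace TwFun

variable {M : Type} [CommGroup M] {T : TwistDatum M} {X : Type} {α : M →* Equiv.Perm X} {B : Type}

lemma ext {F G : TwFun T α B} (h : ∀ x, F x = G x) : F = G := funext h

section Ring
variable [Ring B] [Algebra ℂ B]

noncomputable instance : AddCommGroup (TwFun T α B) := inferInstanceAs (AddCommGroup (X → B))
noncomputable instance : Module ℂ (TwFun T α B) := inferInstanceAs (Module ℂ (X → B))

lemma add_apply (F G : TwFun T α B) (x : X) : (F + G) x = F x + G x := rfl
lemma smul_apply (c : ℂ) (F : TwFun T α B) (x : X) : (c • F) x = c • F x := rfl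

lemma zero_apply (x : X) : (0 : TwFun T α B) x = 0 := rfl

noncomputable instance : Mul (TwFun T α B) where
  mul F G := fun x => linExt (fun m : M × M => F (α m.1 x) * G (α m.2 x)) T.J

instance : One (TwFun T α B) where
  one := fun _ => 1

lemma mul_apply (F G : TwFun T α B) (x : X) :
    (F * G) x = linExt (fun m : M × M => F (α m.1 x) * G (α m.2 x)) T.J := rfl

lemma one_apply (x : X) : (1 : TwFun T α B) x = 1 := rfl

lemma perm_mul_apply (m m' : M) (x : X) : α m (α m' x) = α (m * m') x := by
  rw [map_mul]; rfl

noncomputable instance : Ring (TwFun T α B) where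
  left_distrib F G H := ext fun x => by
    simp only [mul_apply, add_apply, mul_add, linExt_add]
  right_distrib F G H := ext fun x => by
    simp only [mul_apply, add_apply, add_mul, linExt_add]
  zero_mul F := ext fun x => by
    simp only [mul_apply, zero_apply, zero_mul, linExt_zero]
  mul_zero F := ext fun x => by
    simp only [mul_apply, zero_apply, mul_zero, linExt_zero]
  one_mul F := ext fun x => by
    simp only [mul_apply, one_apply, one_mul]
    refine (linExt_mapG (fun m => F (α m x)) (MonoidHom.snd M M) T.J).symm.trans ?_
    rw [T.mapG_snd_J, linExt_one, map_one]; rfl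
  mul_one F := ext fun x => by
    simp only [mul_apply, one_apply, mul_one]
    refine (linExt_mapG (fun m => F (α m x)) (MonoidHom.fst M M) T.J).symm.trans ?_
    rw [T.mapG_fst_J, linExt_one, map_one]; rfl
  mul_assoc F G H := ext fun x => by
    simp only [mul_apply, linExt_mul_const, const_mul_linExt, perm_mul_apply]
    -- Each bracketing evaluates the same triple product on one side of the cocycle identity.
    have h1 := linExt_linExt' (fun p : M × M × M => F (α p.1 x) * (G (α p.2.1 x) * H (α p.2.2 x)))
      (TwistDatum.diagLeft M) (TwistDatum.inclLeft M) T.J T.J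
    have h2 := linExt_linExt' (fun p : M × M × M => F (α p.1 x) * (G (α p.2.1 x) * H (α p.2.2 x)))
      (TwistDatum.diagRight M) (MonoidHom.inr M (M × M)) T.J T.J
    rw [← T.cocycle] at h2
    simpa [mul_assoc] using h1.trans h2.symm

noncomputable instance : Algebra ℂ (TwFun T α B) :=
  Algebra.ofModule
    (fun c F G => ext fun x => by
      simp only [mul_apply, smul_apply, smul_mul_assoc, linExt_smul])
    (fun c F G => ext fun x => by
      simp only [mul_apply, smul_apply, mul_smul_comm, linExt_smul])

end Ring
end TwFun

/-! ### Translations, involution and C*-norm of twisted function algebras -/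

namespace TwFun

variable {M : Type} [CommGroup M] {T : TwistDatum M} {X : Type} {α : M →* Equiv.Perm X}

section Untwist
variable {B : Type} [Ring B] [Algebra ℂ B]

/-- The translation of functions by an element of `M`. -/
noncomputable def translate (m : M) : TwFun T α B →ₐ[ℂ] TwFun T α B :=
  AlgHom.ofLinearMap
    { toFun := fun F => fun x => F (α m x)
      map_add' := fun _ _ => rfl
      map_smul' := fun _ _ => rfl } rfl
    -- Commutativity of `M` is what makes translations respect the twisted product.
    (fun F G => ext fun x => by
      change (F * G) (α m x) =
        linExt (fun m' : M × M => F (α m (α m'.1 x)) * G (α m (α m'.2 x))) T.J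
      simp only [mul_apply, perm_mul_apply, mul_comm m])

lemma translate_apply (m : M) (F : TwFun T α B) (x : X) : translate m F x = F (α m x) := rfl

/-- Evaluation at a point. -/
def evalAt (x : X) : TwFun T α B →ₗ[ℂ] B where
  toFun F := F x
  map_add' _ _ := rfl
  map_smul' _ _ := rfl

lemma evalAt_apply (x : X) (F : TwFun T α B) : evalAt x F = F x := rfl

/-- The pointwise product is the twist of the twisted product. -/
lemma evalAt_linExt_translate_mul (F G : TwFun T α B) (x : X) :
    evalAt x (linExt (fun m : M × M => translate m.1 F * translate m.2 G) T.J) = F x * G x := by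
  rw [map_linExt]
  -- The outer combination and the one inside the product multiply to `J² = 1`.
  have h := linExt_mul (fun m : M × M => F (α m.1 x) * G (α m.2 x)) T.J T.J
  rw [T.J_mul_J, linExt_one] at h
  simp only [evalAt_apply, mul_apply, translate_apply, perm_mul_apply]
  simpa [mul_comm] using h.symm

end Untwist

noncomputable instance : Star (TwFun T α ℂ) where
  star F := fun x => linExt (fun m => star (F (α m x))) T.U

lemma star_apply (F : TwFun T α ℂ) (x : X) :
    (star F) x = linExt (fun m => star (F (α m x))) T.U := rfl

noncomputable instance : StarRing (TwFun T α ℂ) where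
  star_involutive F := ext fun x => by
    simp only [star_apply, star_linExt, star_star, T.conjCoeff_U, perm_mul_apply]
    have h := linExt_mul (fun m : M => F (α m x)) T.U T.U
    rw [T.U_mul_U, linExt_one] at h
    simpa using h.symm
  star_add F G := ext fun x => by
    simp only [star_apply, add_apply, star_add, linExt_add]
  star_mul F G := ext fun x => by
    simp only [star_apply, mul_apply, star_linExt, T.conjCoeff_J, perm_mul_apply, star_mul',
      linExt_mul_const, const_mul_linExt]
    have h := congrArg (linExt fun m : M × M => star (F (α m.1 x)) * star (G (α m.2 x)))
      T.mapG_diag_U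
    -- The factors are reordered so that `linExt_mul` nests the sums in the order in which they
    -- occur in the goal.
    rw [mul_comm (mapG _ T.U), mul_comm (mapG _ T.J), mul_comm (mapG _ T.U) (mapG _ T.U)] at h
    simp only [linExt_mul, linExt_mapG, MonoidHom.prod_apply, MonoidHom.id_apply,
      MonoidHom.inl_apply, MonoidHom.inr_apply, MonoidHom.coe_fst, MonoidHom.coe_snd, Prod.fst_mul,
      Prod.snd_mul, one_mul, mul_one] at h
    simp only [h, mul_comm (star (G _))]

instance : StarModule ℂ (TwFun T α ℂ) where
  star_smul c F := ext fun x => by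
    simp only [star_apply, smul_apply, star_smul, linExt_smul]

section Fintype
variable [Fintype X]

instance : Module.Finite ℂ (TwFun T α ℂ) := inferInstanceAs (Module.Finite ℂ (X → ℂ))

/-- Left multiplication is compatible with the involution and the scalar product of `ℓ²(X)`. -/
lemma sum_star_mul_mul (F G H : TwFun T α ℂ) :
    ∑ x, star ((F * G) x) * H x = ∑ x, star (G x) * (star F * H) x := by
  simp only [star_apply, mul_apply, star_linExt, T.conjCoeff_J, const_mul_linExt, linExt_mul_const,
    ← linExt_sum, perm_mul_apply]
  -- The substitution of `m.2 x` for `x` moves the translation from `G` to `H` and replaces `m.1` by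
  -- `m.1 * m.2`; this is the shear whose effect on `J` is to produce the factor `U` of the
  -- involution.
  have h1 : ∀ m : M × M, ∑ x, star (F (α m.1 x) * G (α m.2 x)) * H x =
      ∑ x, star (G x) * (star (F (α (m.1 * m.2) x)) * H (α m.2 x)) := by
    intro m
    refine Fintype.sum_equiv (α m.2) _ _ fun x => ?_
    rw [perm_mul_apply, perm_mul_apply, mul_assoc, T.sq, mul_one, map_one, star_mul', mul_comm (star _),
      mul_assoc]
    rfl
  simp only [h1]
  have h := congrArg (linExt fun m : M × M => ∑ x, star (G x) * (star (F (α m.1 x)) * H (α m.2 x)))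
    T.mapG_shear_J
  simp only [linExt_mul, linExt_mapG] at h
  simpa [linExt_sum, const_mul_linExt] using h

/-- A vector of `ℓ²(X)`, as a function. -/
def ofVec (v : EuclideanSpace ℂ X) : TwFun T α ℂ := v.ofLp

/-- The operator of left multiplication on `ℓ²(X)`. -/
noncomputable def leftMul (F : TwFun T α ℂ) : EuclideanSpace ℂ X →L[ℂ] EuclideanSpace ℂ X :=
  LinearMap.toContinuousLinearMap
    { toFun := fun v => WithLp.toLp 2 (F * ofVec v)
      map_add' := fun v w => congrArg (WithLp.toLp 2) (mul_add F (ofVec v) (ofVec w))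
      map_smul' := fun c v => congrArg (WithLp.toLp 2) (mul_smul_comm c F (ofVec v)) }

lemma leftMul_apply (F : TwFun T α ℂ) (v : EuclideanSpace ℂ X) (x : X) :
    leftMul F v x = (F * ofVec v : TwFun T α ℂ) x := rfl

/-- The left regular representation on `ℓ²(X)`. -/
noncomputable def leftRegular :
    TwFun T α ℂ →⋆ₐ[ℂ] (EuclideanSpace ℂ X →L[ℂ] EuclideanSpace ℂ X) where
  toFun := leftMul
  map_one' := ContinuousLinearMap.ext fun v => PiLp.ext fun x =>
    congrFun (one_mul (ofVec (T := T) (α := α) v)) x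
  map_zero' := ContinuousLinearMap.ext fun v => PiLp.ext fun x =>
    congrFun (zero_mul (ofVec (T := T) (α := α) v)) x
  map_mul' F G := ContinuousLinearMap.ext fun v => PiLp.ext fun x =>
    congrFun (mul_assoc F G (ofVec v)) x
  map_add' F G := ContinuousLinearMap.ext fun v => PiLp.ext fun x =>
    congrFun (add_mul F G (ofVec v)) x
  commutes' c := ContinuousLinearMap.ext fun v => PiLp.ext fun x =>
    congrFun (Algebra.smul_def c (ofVec (T := T) (α := α) v)).symm x
  map_star' F := by
    rw [ContinuousLinearMap.star_eq_adjoint, ContinuousLinearMap.eq_adjoint_iff]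
    intro v w
    have h := sum_star_mul_mul (star F) (ofVec v) (ofVec w)
    have h' : star (star F) = F := star_star F
    rw [h'] at h
    simp only [PiLp.inner_apply, leftMul_apply, RCLike.inner_apply]
    exact (Finset.sum_congr rfl fun x _ => mul_comm _ _).trans
      (h.trans (Finset.sum_congr rfl fun x _ => mul_comm _ _))

/-- An element is recovered from its left multiplication by applying it to `1`. -/
lemma leftRegular_injective : Function.Injective (leftRegular (T := T) (α := α)) := by
  intro F G h
  have h1 : F * 1 = G * 1 :=
    congrArg (fun L : EuclideanSpace ℂ X →L[ℂ] EuclideanSpace ℂ X =>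
      (L (WithLp.toLp 2 (1 : TwFun T α ℂ))).ofLp) h
  rwa [mul_one, mul_one] at h1

/-- The image of the left regular representation is a `*`-algebra of operators, closed because it is
finite-dimensional, hence a C*-algebra. -/
lemma exists_cStarAlgebra :
    ∃ (B : Type) (_ : CStarAlgebra B), Nonempty (TwFun T α ℂ ≃⋆ₐ[ℂ] B) := by
  have h := Submodule.closed_of_finiteDimensional
    (LinearMap.range (leftRegular (T := T) (α := α)).toAlgHom.toLinearMap)
  have : IsClosed (SetLike.coe (leftRegular (T := T) (α := α)).range) := h
  exact ⟨(leftRegular (T := T) (α := α)).range, inferInstance,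
    ⟨StarAlgEquiv.ofInjective _ leftRegular_injective⟩⟩

end Fintype
end TwFun

/-! ### The twisted Hopf algebra of functions on a finite group -/

namespace TwistDatum
variable {M : Type} [CommGroup M] (T : TwistDatum M) {V : Type} [AddCommGroup V] [Module ℂ V]

lemma linExt_U_U (h : M → V) :
    linExt (fun m => linExt (fun m' => h (m' * m)) T.U) T.U = h 1 := by
  rw [← linExt_mul, T.U_mul_U, linExt_one]

lemma linExt_J_mul (h : M → V) : linExt (fun m : M × M => h (m.1 * m.2)) T.J = linExt h T.U := by
  rw [← T.mapG_mul_J, linExt_mapG]; rfl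

end TwistDatum

lemma TwistDatum.inv_eq {M : Type} [CommGroup M] (T : TwistDatum M) (m : M) : m⁻¹ = m :=
  inv_eq_of_mul_eq_one_left (T.sq m)

/-- The action of `M × M` on `G` by left and right translations. -/
def biAct {M G : Type} [CommGroup M] [Group G] (φ : M →* G) : M × M →* Equiv.Perm G where
  toFun m :=
    { toFun := fun x => φ m.1 * x * φ m.2
      invFun := fun x => (φ m.1)⁻¹ * x * (φ m.2)⁻¹
      left_inv := fun x => by group
      right_inv := fun x => by group }
  map_one' := by ext x; simp
  map_mul' m m' := by
    ext x
    change φ (m.1 * m'.1) * x * φ (m.2 * m'.2) = φ m.1 * (φ m'.1 * x * φ m'.2) * φ m.2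
    rw [mul_comm m.2, map_mul, map_mul]; group

lemma biAct_apply {M G : Type} [CommGroup M] [Group G] (φ : M →* G) (m : M × M) (x : G) :
    biAct φ m x = φ m.1 * x * φ m.2 := rfl

/-- The functions on a group `G`, with the product twisted on both sides by the elements of `M`. -/
abbrev TwGroup {M G : Type} [CommGroup M] [Group G] (T : TwistDatum M) (φ : M →* G) : Type :=
  TwFun T.double (biAct φ) ℂ

namespace TwGroup

variable {M G : Type} [CommGroup M] [Group G] {T : TwistDatum M} {φ : M →* G}

lemma mul_eq_nested (f g : TwGroup T φ) (x : G) : (f * g) x = linExt (fun m' => linExt (fun m =>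
    f (φ m.1 * x * φ m'.1) * g (φ m.2 * x * φ m'.2)) T.J) T.J := by
  rw [TwFun.mul_apply, T.double_J, linExt_mul]
  simp only [linExt_mapG]
  simp [biAct_apply, mul_assoc]

variable (T φ) in
/-- The twist of the diagonal element `(x, x)`. -/
noncomputable def diagTwist (x : G) : MonoidAlgebra ℂ (G × G) :=
  mapG (φ.prodMap φ) T.J * MonoidAlgebra.single (x, x) 1 * mapG (φ.prodMap φ) T.J

/-- The two copies of `J` in `T.double` act by left and by right translations, so together they
surround the diagonal element `(x, x)`. -/
lemma mul_eq (f g : TwGroup T φ) (x : G) :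
    (f * g) x = linExt (fun p : G × G => f p.1 * g p.2) (diagTwist T φ x) := by
  rw [mul_eq_nested, diagTwist, linExt_mul]
  simp only [linExt_mul, linExt_mapG]
  simp

lemma star_eq_nested (f : TwGroup T φ) (x : G) : (star f) x =
    linExt (fun m' => linExt (fun m => star (f (φ m * x * φ m'))) T.U) T.U := by
  rw [TwFun.star_apply, T.double_U, linExt_mul]
  simp only [linExt_mapG]
  simp [biAct_apply, mul_assoc]

lemma mapG_J_mul_self : mapG (φ.prodMap φ) T.J * mapG (φ.prodMap φ) T.J = 1 := by
  rw [← map_mul, T.J_mul_J, map_one]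

/-- The two inner copies of `J` cancel. So `x ↦ J (x, x) J` is still multiplicative, which is why
the untouched comultiplication remains a morphism for the twisted product. -/
lemma diagTwist_mul (x y : G) : diagTwist T φ x * diagTwist T φ y = diagTwist T φ (x * y) := by
  simp only [diagTwist]
  rw [show (MonoidAlgebra.single (x * y, x * y) 1 : MonoidAlgebra ℂ (G × G)) =
    MonoidAlgebra.single (x, x) 1 * MonoidAlgebra.single (y, y) 1 by
      simp [MonoidAlgebra.single_mul_single]]
  simp only [mul_assoc]
  rw [← mul_assoc (mapG (φ.prodMap φ) T.J) (mapG (φ.prodMap φ) T.J), mapG_J_mul_self, one_mul]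

lemma diagTwist_one : diagTwist T φ 1 = 1 := by
  rw [diagTwist, show ((1 : G), (1 : G)) = 1 from rfl, ← MonoidAlgebra.one_def, mul_one,
    mapG_J_mul_self]

variable [Fintype G] [DecidableEq G]

noncomputable instance : Coalgebra ℂ (TwGroup T φ) := inferInstanceAs (Coalgebra ℂ (FunAlg G))

lemma counit_eq (f : TwGroup T φ) : Coalgebra.counit (R := ℂ) f = f 1 := rfl

/-- The indicator function of a point. -/
noncomputable def delta (x : G) : TwGroup T φ := FunAlg.delta x

lemma delta_apply (x y : G) : (delta x : TwGroup T φ) y = if y = x then 1 else 0 := rfl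

lemma eq_sum_delta (f : TwGroup T φ) : f = ∑ a, f a • delta a := FunAlg.eq_sum (G := G) f

/-- Evaluation of a tensor at a pair of points. -/
noncomputable def evalTwo (x y : G) : TwGroup T φ ⊗[ℂ] TwGroup T φ →ₗ[ℂ] ℂ :=
  LinearMap.mul' ℂ ℂ ∘ₗ TensorProduct.map (TwFun.evalAt x) (TwFun.evalAt y)

lemma evalTwo_tmul (x y : G) (f g : TwGroup T φ) : evalTwo x y (f ⊗ₜ g) = f x * g y := rfl

lemma evalTwo_comul (x y : G) (f : TwGroup T φ) :
    evalTwo x y (Coalgebra.comul (R := ℂ) f) = f (x * y) := by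
  have h : Coalgebra.comul (R := ℂ) f = ∑ a, ∑ b, f (a * b) •
    ((delta a : TwGroup T φ) ⊗ₜ[ℂ] (delta b : TwGroup T φ)) := rfl
  rw [h]
  simp only [map_sum, map_smul, evalTwo_tmul, delta_apply, smul_eq_mul]
  simp

lemma evalTwo_ext {z w : TwGroup T φ ⊗[ℂ] TwGroup T φ}
    (h : ∀ x y, evalTwo x y z = evalTwo x y w) : z = w := by
  have key : ∀ z : TwGroup T φ ⊗[ℂ] TwGroup T φ, z = ∑ a, ∑ b, evalTwo a b z •
      ((delta a : TwGroup T φ) ⊗ₜ[ℂ] (delta b : TwGroup T φ)) := by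
    intro z
    induction z with
    | zero => simp
    | add z w hz hw =>
      nth_rewrite 1 [hz, hw]
      simp only [map_add, add_smul, Finset.sum_add_distrib]
    | tmul f g =>
      conv_lhs => rw [eq_sum_delta f, eq_sum_delta g]
      simp only [TensorProduct.sum_tmul, TensorProduct.tmul_sum, TensorProduct.smul_tmul_smul,
        evalTwo_tmul]
      exact Finset.sum_comm
  rw [key z, key w]
  simp only [h]

lemma evalTwo_mul (x y : G) (z w : TwGroup T φ ⊗[ℂ] TwGroup T φ) :
    evalTwo x y (z * w) = linExt (fun p : G × G => linExt (fun q : G × G =>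
      evalTwo p.1 q.1 z * evalTwo p.2 q.2 w) (diagTwist T φ y)) (diagTwist T φ x) := by
  induction z with
  | zero => simp [linExt_zero]
  | add z z' hz hz' => simp only [add_mul, map_add, hz, hz', linExt_add]
  | tmul f g =>
    induction w with
    | zero => simp [linExt_zero]
    | add z z' hz hz' => simp only [mul_add, map_add, hz, hz', linExt_add]
    | tmul f' g' =>
      rw [Algebra.TensorProduct.tmul_mul_tmul, evalTwo_tmul, mul_eq, mul_eq, linExt_mul_const]
      simp only [const_mul_linExt, evalTwo_tmul]
      simp only [mul_mul_mul_comm]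

lemma evalTwo_star (x y : G) (z : TwGroup T φ ⊗[ℂ] TwGroup T φ) :
    evalTwo x y (star z) = linExt (fun l' => linExt (fun l => linExt (fun m' => linExt (fun m =>
      star (evalTwo (φ m * x * φ m') (φ l * y * φ l') z)) T.U) T.U) T.U) T.U := by
  induction z with
  | zero => simp [linExt_zero]
  | add z z' hz hz' => simp only [star_add, map_add, hz, hz', linExt_add]
  | tmul f g =>
    rw [TensorProduct.star_tmul, evalTwo_tmul, star_eq_nested, star_eq_nested]
    simp only [const_mul_linExt, linExt_mul_const, evalTwo_tmul, star_mul']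

noncomputable instance : Bialgebra ℂ (TwGroup T φ) :=
  Bialgebra.mk' ℂ (TwGroup T φ) rfl
    (fun {f g} => by
      rw [counit_eq, mul_eq, diagTwist_one, linExt_one]; rfl)
    (evalTwo_ext fun x y => by
      rw [evalTwo_comul, Algebra.TensorProduct.one_def, evalTwo_tmul]
      exact (one_mul (1 : ℂ)).symm)
    (fun {f g} => evalTwo_ext fun x y => by
      rw [evalTwo_comul, evalTwo_mul]
      simp only [evalTwo_comul]
      rw [mul_eq, ← diagTwist_mul]
      have := linExt_linExt (fun p : G × G => f p.1 * g p.2) (MonoidHom.id _) (MonoidHom.id _)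
        (diagTwist T φ x) (diagTwist T φ y)
      simpa using this.symm)

/-- The antipode. -/
noncomputable def antipodeMap : TwGroup T φ →ₗ[ℂ] TwGroup T φ where
  toFun f := fun x => linExt (fun m' => linExt (fun m => f (φ m * x⁻¹ * φ m')) T.U) T.U
  map_add' f g := TwFun.ext fun x => by simp only [TwFun.add_apply, linExt_add]; rfl
  map_smul' c f := TwFun.ext fun x => by
    simp only [TwFun.smul_apply, linExt_smul, RingHom.id_apply]; rfl

lemma antipodeMap_apply (f : TwGroup T φ) (x : G) : antipodeMap f x =
    linExt (fun m' => linExt (fun m => f (φ m * x⁻¹ * φ m')) T.U) T.U := rfl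

/-- Evaluation, on the left antipode identity. -/
lemma mul'_antipodeMap_rTensor_apply (z : TwGroup T φ ⊗[ℂ] TwGroup T φ) (x : G) :
    TwFun.evalAt x (LinearMap.mul' ℂ (TwGroup T φ) (antipodeMap.rTensor _ z)) =
      linExt (fun m' => linExt (fun m => linExt (fun u' => linExt (fun u =>
        evalTwo (φ u * (φ m.1 * x * φ m'.1)⁻¹ * φ u') (φ m.2 * x * φ m'.2) z) T.U) T.U) T.J) T.J := by
  induction z with
  | zero => simp [linExt_zero]
  | add z z' hz hz' => simp only [map_add, hz, hz', linExt_add]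
  | tmul f g =>
    rw [LinearMap.rTensor_tmul, LinearMap.mul'_apply, TwFun.evalAt_apply, mul_eq_nested]
    simp only [antipodeMap_apply, linExt_mul_const, evalTwo_tmul]

lemma mul'_antipodeMap_lTensor_apply (z : TwGroup T φ ⊗[ℂ] TwGroup T φ) (x : G) :
    TwFun.evalAt x (LinearMap.mul' ℂ (TwGroup T φ) (antipodeMap.lTensor _ z)) =
      linExt (fun m' => linExt (fun m => linExt (fun u' => linExt (fun u =>
        evalTwo (φ m.1 * x * φ m'.1) (φ u * (φ m.2 * x * φ m'.2)⁻¹ * φ u') z) T.U) T.U) T.J) T.J := by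
  induction z with
  | zero => simp [linExt_zero]
  | add z z' hz hz' => simp only [map_add, hz, hz', linExt_add]
  | tmul f g =>
    rw [LinearMap.lTensor_tmul, LinearMap.mul'_apply, TwFun.evalAt_apply, mul_eq_nested]
    simp only [antipodeMap_apply, const_mul_linExt, evalTwo_tmul]

/-- The legs of `J` multiply to `U`, and `U² = 1`. This is the cancellation behind both antipode
identities. -/
lemma linExt_J_U {V : Type} [AddCommGroup V] [Module ℂ V] (h : M → V) :
    linExt (fun m : M × M => linExt (fun u => h (m.1 * u * m.2)) T.U) T.J = h 1 := by
  rw [linExt_swap]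
  have h1 : ∀ u, linExt (fun m : M × M => h (m.1 * u * m.2)) T.J =
      linExt (fun u' => h (u' * u)) T.U := fun u => by
    rw [← T.linExt_J_mul]
    simp only [mul_right_comm]
  simp only [h1, T.linExt_U_U]

noncomputable instance : HopfAlgebra ℂ (TwGroup T φ) where
  antipode := antipodeMap
  mul_antipode_rTensor_comul := LinearMap.ext fun f => TwFun.ext fun x => by
    refine (mul'_antipodeMap_rTensor_apply _ x).trans ?_
    simp only [evalTwo_comul]
    -- Elements of `M` are their own inverses, so the left legs of the product and one `U` of the
    -- antipode collect between `x⁻¹` and `x`. Once they sum to `1`, the point `x` disappears and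
    -- the remaining sum collapses in the same way.
    have h1 : ∀ (m m' : M × M) (u u' : M), φ u * (φ m.1 * x * φ m'.1)⁻¹ * φ u' *
        (φ m.2 * x * φ m'.2) = φ u * φ m'.1 * x⁻¹ * φ (m.1 * u' * m.2) * x * φ m'.2 := by
      intro m m' u u'
      rw [mul_inv_rev, mul_inv_rev, ← map_inv, ← map_inv, T.inv_eq, T.inv_eq, map_mul, map_mul]
      group
    have h2 : ∀ m' : M × M, linExt (fun m : M × M => linExt (fun u' => linExt (fun u =>
        f (φ u * φ m'.1 * x⁻¹ * φ (m.1 * u' * m.2) * x * φ m'.2)) T.U) T.U) T.J =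
        linExt (fun u => f (φ (m'.1 * u * m'.2))) T.U := by
      intro m'
      rw [linExt_J_U (T := T) fun y => linExt (fun u =>
        f (φ u * φ m'.1 * x⁻¹ * φ y * x * φ m'.2)) T.U]
      congr 2; ext u
      simp only [map_one, mul_one, inv_mul_cancel_right, ← map_mul, mul_comm u]
    simp only [h1, h2]
    rw [linExt_J_U (T := T) fun y => f (φ y), map_one]
    exact (mul_one (f 1)).symm
  mul_antipode_lTensor_comul := LinearMap.ext fun f => TwFun.ext fun x => by
    refine (mul'_antipodeMap_lTensor_apply _ x).trans ?_
    simp only [evalTwo_comul]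
    have h1 : ∀ (m m' : M × M) (u u' : M), (φ m.1 * x * φ m'.1) * (φ u * (φ m.2 * x * φ m'.2)⁻¹ *
        φ u') = φ m.1 * x * φ (m'.1 * u * m'.2) * x⁻¹ * φ m.2 * φ u' := by
      intro m m' u u'
      rw [mul_inv_rev, mul_inv_rev, ← map_inv, ← map_inv, T.inv_eq, T.inv_eq, map_mul, map_mul]
      group
    simp only [h1]
    -- Here the factors between `x` and `x⁻¹` come from the right translations, so these have to be
    -- summed first.
    rw [linExt_swap]
    have h2 : ∀ m : M × M, linExt (fun m' : M × M => linExt (fun u' => linExt (fun u =>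
        f (φ m.1 * x * φ (m'.1 * u * m'.2) * x⁻¹ * φ m.2 * φ u')) T.U) T.U) T.J =
        linExt (fun u => f (φ (m.1 * u * m.2))) T.U := by
      intro m
      refine (congrArg (fun k => linExt k T.J) (funext fun m' => linExt_swap _ T.U T.U)).trans ?_
      rw [linExt_J_U (T := T) fun y => linExt (fun u =>
        f (φ m.1 * x * φ y * x⁻¹ * φ m.2 * φ u)) T.U]
      congr 2; ext u
      simp only [map_one, mul_one, mul_inv_cancel_right, ← map_mul, mul_right_comm]
    simp only [h2]
    rw [linExt_J_U (T := T) fun y => f (φ y), map_one]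
    exact (mul_one (f 1)).symm

lemma antipode_eq (f : TwGroup T φ) (x : G) : HopfAlgebra.antipode ℂ f x =
    linExt (fun m' => linExt (fun m => f (φ m * x⁻¹ * φ m')) T.U) T.U := rfl

lemma counit_star (f : TwGroup T φ) :
    Coalgebra.counit (R := ℂ) (star f) = star (Coalgebra.counit (R := ℂ) f) := by
  rw [counit_eq, counit_eq, star_eq_nested]
  simpa [← map_mul] using T.linExt_U_U fun y => star (f (φ y))

lemma comul_star (f : TwGroup T φ) :
    Coalgebra.comul (R := ℂ) (star f) = star (Coalgebra.comul (R := ℂ) f) := by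
  refine evalTwo_ext fun x y => ?_
  rw [evalTwo_star, evalTwo_comul, star_eq_nested]
  simp only [evalTwo_comul]
  congr 2; ext l'
  -- The two copies of `U` that meet between `x` and `y` cancel; the outer two remain.
  have h := T.linExt_U_U fun w => linExt (fun m => star (f (φ m * x * φ w * y * φ l'))) T.U
  simp only [map_mul, map_one, mul_one, ← mul_assoc] at h ⊢
  exact h.symm

lemma antipode_star (f : TwGroup T φ) :
    HopfAlgebra.antipode ℂ (star f) = star (HopfAlgebra.antipode ℂ f) := by
  refine TwFun.ext fun x => ?_
  simp only [antipode_eq, star_eq_nested, star_linExt, T.conjCoeff_U, mul_inv_rev, ← map_inv, T.inv_eq]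
  simp only [mul_assoc]
  exact linExt_swap _ T.U T.U

variable (T φ) in
/-- The finite quantum group whose function algebra is the twist of the functions on `G`. -/
noncomputable def quantumGroup : FiniteQuantumGroup where
  A := TwGroup T φ
  isCStar := TwFun.exists_cStarAlgebra
  comul_star := comul_star
  counit_star := counit_star
  antipode_star := antipode_star

end TwGroup

/-! ### Convolution of linear forms, and the cocycle of a twist -/

section Convolution

variable {C D : Type} [AddCommGroup C] [Module ℂ C] [Coalgebra ℂ C] [AddCommGroup D] [Module ℂ D]
  [Coalgebra ℂ D]

/-- The linear form `x ⊗ y ↦ a x * b y`. -/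
noncomputable def boxForm (a : WithConv (C →ₗ[ℂ] ℂ)) (b : WithConv (D →ₗ[ℂ] ℂ)) :
    WithConv (C ⊗[ℂ] D →ₗ[ℂ] ℂ) :=
  WithConv.toConv (LinearMap.mul' ℂ ℂ ∘ₗ TensorProduct.map a.ofConv b.ofConv)

lemma boxForm_tmul (a : WithConv (C →ₗ[ℂ] ℂ)) (b : WithConv (D →ₗ[ℂ] ℂ)) (x : C) (y : D) :
    (boxForm a b).ofConv (x ⊗ₜ y) = a.ofConv x * b.ofConv y := rfl

/-- Convolution on a tensor product of coalgebras is computed leg by leg. This makes evaluation at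
pairs and triples of points multiplicative for convolution. -/
lemma boxForm_mul_boxForm (a a' : WithConv (C →ₗ[ℂ] ℂ)) (b b' : WithConv (D →ₗ[ℂ] ℂ)) :
    boxForm a b * boxForm a' b' = boxForm (a * a') (b * b') := by
  have h := LinearMap.algHom_comp_convMul_distrib (Algebra.TensorProduct.lmul' (S := ℂ) ℂ)
    (WithConv.toConv (TensorProduct.map a.ofConv b.ofConv))
    (WithConv.toConv (TensorProduct.map a'.ofConv b'.ofConv))
  rw [TensorProduct.map_convMul_map] at h
  exact congrArg WithConv.toConv h.symm

lemma boxForm_one : boxForm (1 : WithConv (C →ₗ[ℂ] ℂ)) (1 : WithConv (D →ₗ[ℂ] ℂ)) = 1 := by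
  refine WithConv.ext (TensorProduct.ext' fun x y => ?_)
  rw [boxForm_tmul]
  simp [LinearMap.convOne_def, mul_comm]

end Convolution

/-! ### Linear forms on tensor powers of `C(G)` as elements of group algebras -/

namespace FunAlg
variable {G : Type} [Group G] [Fintype G] [DecidableEq G]

/-- Evaluation at points, as a morphism to the convolution algebra. -/
noncomputable def point : G →* WithConv (FunAlg G →ₗ[ℂ] ℂ) where
  toFun x := WithConv.toConv (eval x).toLinearMap
  map_one' := rfl
  map_mul' x y := by
    refine WithConv.ext (LinearMap.ext fun f => ?_)
    change f (x * y) = LinearMap.mul' ℂ ℂ (TensorProduct.map (eval x).toLinearMap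
      (eval y).toLinearMap (Coalgebra.comul f))
    rw [comul_eq]
    simp only [map_sum, map_smul, TensorProduct.map_tmul, LinearMap.mul'_apply,
      AlgHom.toLinearMap_apply, eval_apply, delta_apply, smul_eq_mul]
    simp

/-- Evaluation at pairs of points. -/
noncomputable def pointTwo : G × G →* WithConv (FunAlg G ⊗[ℂ] FunAlg G →ₗ[ℂ] ℂ) where
  toFun p := boxForm (point p.1) (point p.2)
  map_one' := by simp only [Prod.fst_one, Prod.snd_one, map_one, boxForm_one]
  map_mul' p q := by simp only [Prod.fst_mul, Prod.snd_mul, map_mul, boxForm_mul_boxForm]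

/-- Evaluation at triples of points. -/
noncomputable def pointThree :
    G × G × G →* WithConv ((FunAlg G ⊗[ℂ] FunAlg G) ⊗[ℂ] FunAlg G →ₗ[ℂ] ℂ) where
  toFun p := boxForm (boxForm (point p.1) (point p.2.1)) (point p.2.2)
  map_one' := by simp only [Prod.fst_one, Prod.snd_one, map_one, boxForm_one]
  map_mul' p q := by simp only [Prod.fst_mul, Prod.snd_mul, map_mul, boxForm_mul_boxForm]

/-- The linear form on `C(G) ⊗ C(G)` defined by an element of the group algebra of `G × G`. -/
noncomputable abbrev formTwo :
    MonoidAlgebra ℂ (G × G) →ₐ[ℂ] WithConv (FunAlg G ⊗[ℂ] FunAlg G →ₗ[ℂ] ℂ) :=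
  MonoidAlgebra.lift ℂ _ (G × G) pointTwo

/-- The linear form on `(C(G) ⊗ C(G)) ⊗ C(G)` defined by an element of the group algebra of
`G × G × G`. -/
noncomputable abbrev formThree : MonoidAlgebra ℂ (G × G × G) →ₐ[ℂ]
    WithConv ((FunAlg G ⊗[ℂ] FunAlg G) ⊗[ℂ] FunAlg G →ₗ[ℂ] ℂ) :=
  MonoidAlgebra.lift ℂ _ (G × G × G) pointThree

lemma formTwo_tmul (w : MonoidAlgebra ℂ (G × G)) (f g : FunAlg G) :
    (formTwo w).ofConv (f ⊗ₜ g) = linExt (fun p : G × G => f p.1 * g p.2) w := by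
  induction w using MonoidAlgebra.induction_linear with
  | zero => simp
  | add w w' hw hw' => simp only [map_add, WithConv.ofConv_add, LinearMap.add_apply, hw, hw']
  | single p c =>
    rw [MonoidAlgebra.lift_single, linExt_single]; rfl

lemma formThree_tmul (w : MonoidAlgebra ℂ (G × G × G)) (f g h : FunAlg G) :
    (formThree w).ofConv ((f ⊗ₜ g) ⊗ₜ h) =
      linExt (fun p : G × G × G => f p.1 * g p.2.1 * h p.2.2) w := by
  induction w using MonoidAlgebra.induction_linear with
  | zero => simp
  | add w w' hw hw' => simp only [map_add, WithConv.ofConv_add, LinearMap.add_apply, hw, hw']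
  | single p c =>
    rw [MonoidAlgebra.lift_single, linExt_single]; rfl

variable {M : Type} [CommGroup M] (T : TwistDatum M) (φ : M →* G)

/-- The 2-cocycle of a twist datum. -/
noncomputable def cocycleUnit : (WithConv (FunAlg G ⊗[ℂ] FunAlg G →ₗ[ℂ] ℂ))ˣ where
  val := formTwo (mapG (φ.prodMap φ) T.J)
  inv := formTwo (mapG (φ.prodMap φ) T.J)
  val_inv := by rw [← map_mul, TwGroup.mapG_J_mul_self, map_one]
  inv_val := by rw [← map_mul, TwGroup.mapG_J_mul_self, map_one]

lemma linExt_mapG_J (h : G × G → ℂ) : linExt h (mapG (φ.prodMap φ) T.J) =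
    linExt (fun m => h (φ m.1, φ m.2)) T.J := by
  rw [linExt_mapG]; rfl

lemma cocycleUnit_tmul (f g : FunAlg G) : (cocycleUnit T φ).val.ofConv (f ⊗ₜ g) =
    linExt (fun m : M × M => f (φ m.1) * g (φ m.2)) T.J := by
  rw [cocycleUnit, formTwo_tmul, linExt_mapG_J]

/-- Each of the four forms in the cocycle identity is `formThree` of an image of `J`. As `formThree`
is an algebra morphism for convolution, the identity `T.cocycle` in the group algebra is all that is
needed. -/
lemma isHopfCocycle_cocycleUnit : IsHopfCocycle (cocycleUnit T φ) where
  cocycle := by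
    have h1 : WithConv.toConv (LinearMap.mul' ℂ ℂ ∘ₗ TensorProduct.map (cocycleUnit T φ).val.ofConv
        (Coalgebra.counit (R := ℂ) (A := FunAlg G))) =
        formThree (mapG (φ.prodMap (φ.prodMap φ)) (mapG (TwistDatum.inclLeft M) T.J)) := by
      refine WithConv.ext (TensorProduct.ext_threefold fun f g h => ?_)
      rw [formThree_tmul, linExt_mapG, linExt_mapG]
      refine (congrArg (· * h 1) (cocycleUnit_tmul T φ f g)).trans ?_
      simp [linExt_mul_const]
    have h2 : WithConv.toConv ((cocycleUnit T φ).val.ofConv ∘ₗ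
        (LinearMap.mul' ℂ (FunAlg G)).rTensor (FunAlg G)) =
        formThree (mapG (φ.prodMap (φ.prodMap φ)) (mapG (TwistDatum.diagLeft M) T.J)) := by
      refine WithConv.ext (TensorProduct.ext_threefold fun f g h => ?_)
      rw [formThree_tmul, linExt_mapG, linExt_mapG]
      exact cocycleUnit_tmul T φ (f * g) h
    have h3 : WithConv.toConv (LinearMap.mul' ℂ ℂ ∘ₗ
        TensorProduct.map (Coalgebra.counit (R := ℂ) (A := FunAlg G))
          (cocycleUnit T φ).val.ofConv ∘ₗ
        (TensorProduct.assoc ℂ (FunAlg G) (FunAlg G) (FunAlg G)).toLinearMap) =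
        formThree (mapG (φ.prodMap (φ.prodMap φ)) (mapG (MonoidHom.inr M (M × M)) T.J)) := by
      refine WithConv.ext (TensorProduct.ext_threefold fun f g h => ?_)
      rw [formThree_tmul, linExt_mapG, linExt_mapG]
      refine (congrArg (f 1 * ·) (cocycleUnit_tmul T φ g h)).trans ?_
      simp [const_mul_linExt, mul_assoc]
    have h4 : WithConv.toConv ((cocycleUnit T φ).val.ofConv ∘ₗ
        (LinearMap.mul' ℂ (FunAlg G)).lTensor (FunAlg G) ∘ₗ
        (TensorProduct.assoc ℂ (FunAlg G) (FunAlg G) (FunAlg G)).toLinearMap) =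
        formThree (mapG (φ.prodMap (φ.prodMap φ)) (mapG (TwistDatum.diagRight M) T.J)) := by
      refine WithConv.ext (TensorProduct.ext_threefold fun f g h => ?_)
      rw [formThree_tmul, linExt_mapG, linExt_mapG]
      refine (cocycleUnit_tmul T φ f (g * h)).trans ?_
      simp only [mul_assoc]
      rfl
    rw [h1, h2, h3, h4, ← map_mul, ← map_mul, ← map_mul, ← map_mul, T.cocycle]
  right_unit f := by
    rw [cocycleUnit_tmul, counit_eq]
    have h := linExt_mapG (fun m => f (φ m)) (MonoidHom.fst M M) T.J
    rw [T.mapG_fst_J, linExt_one, map_one] at h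
    rw [h]
    congr 2; ext m; exact mul_one _
  left_unit f := by
    rw [cocycleUnit_tmul, counit_eq]
    have h := linExt_mapG (fun m => f (φ m)) (MonoidHom.snd M M) T.J
    rw [T.mapG_snd_J, linExt_one, map_one] at h
    rw [h]
    congr 2; ext m; exact one_mul _

/-- Evaluation at `x` is an algebra morphism, so it turns the convolution `σ * mul * σ⁻¹` into the
product `J (x, x) J` in the group algebra; `σ⁻¹` is again given by `J`. -/
lemma twistMul_cocycleUnit (f g : FunAlg G) (x : G) :
    twistMul (cocycleUnit T φ) (f ⊗ₜ g) x =
      linExt (fun p : G × G => f p.1 * g p.2) (TwGroup.diagTwist T φ x) := by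
  have h : (eval x).toLinearMap ∘ₗ twistMul (cocycleUnit T φ) =
      (formTwo (TwGroup.diagTwist T φ x)).ofConv := by
    rw [twistMul, LinearMap.algHom_comp_convMul_distrib, LinearMap.algHom_comp_convMul_distrib,
      TwGroup.diagTwist, map_mul, map_mul]
    have h1 : WithConv.toConv ((eval x).toLinearMap ∘ₗ LinearMap.mul' ℂ (FunAlg G)) =
        formTwo (MonoidAlgebra.single (x, x) 1) := by
      refine WithConv.ext (TensorProduct.ext' fun f g => ?_)
      rw [formTwo_tmul, linExt_single, one_smul]; rfl
    have h2 : ∀ s : FunAlg G ⊗[ℂ] FunAlg G →ₗ[ℂ] ℂ,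
        (eval x).toLinearMap ∘ₗ (Algebra.linearMap ℂ (FunAlg G) ∘ₗ s) = s := by
      intro s
      ext f g
      exact (eval x).commutes _
    simp only [WithConv.toConv_ofConv, h2, h1]
    rfl
  exact (LinearMap.congr_fun h (f ⊗ₜ g)).trans (formTwo_tmul _ f g)

end FunAlg

/-! ### The twisted algebra as a cocycle twist induced from a subgroup -/

namespace TwGroup
variable {M G : Type} [CommGroup M] [Group G] [Fintype G] [DecidableEq G] (T : TwistDatum M)

/-- The identity, from the twist to the untwisted function algebra. -/
noncomputable def coalgEquiv (φ : M →* G) : TwGroup T φ ≃ₗc[ℂ] FunAlg G where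
  toFun f := f
  invFun f := f
  map_add' _ _ := rfl
  map_smul' _ _ := rfl
  left_inv _ := rfl
  right_inv _ := rfl
  counit_comp := rfl
  map_comp_comul := by
    refine LinearMap.ext fun f => ?_
    have h : Coalgebra.comul (R := ℂ) f = ∑ a, ∑ b, f (a * b) •
      ((delta a : TwGroup T φ) ⊗ₜ[ℂ] (delta b : TwGroup T φ)) := rfl
    rw [LinearMap.comp_apply, h]
    simp only [map_sum, map_smul, TensorProduct.map_tmul]
    rfl

lemma isTwistBy (φ : M →* G) : IsTwistBy (TwGroup T φ) (FunAlg.cocycleUnit T φ) :=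
  ⟨coalgEquiv T φ, rfl, fun f g => FunAlg.ext fun x =>
    (mul_eq f g x).trans (FunAlg.twistMul_cocycleUnit T φ f g x).symm⟩

lemma cocycleUnit_comp (K : Subgroup G) [DecidablePred (· ∈ K)] (φ : M →* K) :
    (FunAlg.cocycleUnit T (K.subtype.comp φ)).val.ofConv = (FunAlg.cocycleUnit T φ).val.ofConv ∘ₗ
      TensorProduct.map (FunAlg.restrict K) (FunAlg.restrict K) := by
  refine TensorProduct.ext' fun f g => ?_
  rw [FunAlg.cocycleUnit_tmul, LinearMap.comp_apply, TensorProduct.map_tmul,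
    FunAlg.cocycleUnit_tmul]
  rfl

lemma isTwistInducedFrom (K : Subgroup G) [DecidablePred (· ∈ K)] (φ : M →* K) :
    IsTwistInducedFrom (TwGroup T (K.subtype.comp φ)) K :=
  ⟨FunAlg.cocycleUnit T φ, FunAlg.cocycleUnit T (K.subtype.comp φ),
    FunAlg.isHopfCocycle_cocycleUnit T φ, FunAlg.isHopfCocycle_cocycleUnit T _,
    cocycleUnit_comp T K φ, isTwistBy T _⟩
end TwGroup

/-! ### Corepresentations of the twisted algebra are representations of the group -/

namespace TwGroup

variable {M G : Type} [CommGroup M] [Group G] [Fintype G] [DecidableEq G] {T : TwistDatum M}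
  {φ : M →* G}

/-- Evaluation of the second tensor factor at a point. -/
noncomputable def slice (V : Type) [AddCommGroup V] [Module ℂ V] (x : G) :
    V ⊗[ℂ] TwGroup T φ →ₗ[ℂ] V :=
  (TensorProduct.rid ℂ V).toLinearMap ∘ₗ (TwFun.evalAt x).lTensor V

section Slice
variable {V W : Type} [AddCommGroup V] [Module ℂ V] [AddCommGroup W] [Module ℂ W]

@[simp] lemma slice_tmul (x : G) (v : V) (f : TwGroup T φ) : slice V x (v ⊗ₜ f) = f x • v := rfl

lemma eq_sum_slice (z : V ⊗[ℂ] TwGroup T φ) : z = ∑ x, slice V x z ⊗ₜ delta x := by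
  induction z with
  | zero => simp
  | add z w hz hw =>
    nth_rewrite 1 [hz, hw]
    simp only [map_add, TensorProduct.add_tmul, Finset.sum_add_distrib]
  | tmul v f =>
    conv_lhs => rw [eq_sum_delta f]
    simp only [TensorProduct.tmul_sum, slice_tmul, TensorProduct.smul_tmul]

lemma slice_ext {z w : V ⊗[ℂ] TwGroup T φ} (h : ∀ x, slice V x z = slice V x w) : z = w := by
  rw [eq_sum_slice z, eq_sum_slice w]
  simp only [h]

lemma slice_rTensor (x : G) (f : V →ₗ[ℂ] W) (z : V ⊗[ℂ] TwGroup T φ) :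
    slice W x (f.rTensor _ z) = f (slice V x z) := by
  induction z with
  | zero => simp
  | add z w hz hw => simp only [map_add, hz, hw]
  | tmul v f => simp

/-- Evaluation of the last two tensor factors at a pair of points. -/
noncomputable def sliceTwo (V : Type) [AddCommGroup V] [Module ℂ V] (x y : G) :
    V ⊗[ℂ] (TwGroup T φ ⊗[ℂ] TwGroup T φ) →ₗ[ℂ] V :=
  (TensorProduct.rid ℂ V).toLinearMap ∘ₗ (evalTwo x y).lTensor V

lemma sliceTwo_tmul (x y : G) (v : V) (z : TwGroup T φ ⊗[ℂ] TwGroup T φ) :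
    sliceTwo V x y (v ⊗ₜ z) = evalTwo x y z • v := rfl

lemma sliceTwo_lTensor_comul (x y : G) (z : V ⊗[ℂ] TwGroup T φ) :
    sliceTwo V x y ((Coalgebra.comul (R := ℂ)).lTensor V z) = slice V (x * y) z := by
  induction z with
  | zero => simp
  | add z w hz hw => simp only [map_add, hz, hw]
  | tmul v f => rw [LinearMap.lTensor_tmul, sliceTwo_tmul, evalTwo_comul, slice_tmul]

lemma sliceTwo_assoc (x y : G) (z : (V ⊗[ℂ] TwGroup T φ) ⊗[ℂ] TwGroup T φ) :
    sliceTwo V x y (TensorProduct.assoc ℂ V _ _ z) = slice V x (slice _ y z) := by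
  induction z with
  | zero => simp
  | add z w hz hw => simp only [map_add, hz, hw]
  | tmul z g =>
    induction z with
    | zero => simp
    | add z w hz hw => simp only [TensorProduct.add_tmul, map_add, hz, hw]
    | tmul v f =>
      rw [TensorProduct.assoc_tmul, sliceTwo_tmul, evalTwo_tmul, slice_tmul, map_smul, slice_tmul,
        smul_smul, mul_comm]

lemma sliceTwo_ext {z w : V ⊗[ℂ] (TwGroup T φ ⊗[ℂ] TwGroup T φ)}
    (h : ∀ x y, sliceTwo V x y z = sliceTwo V x y w) : z = w := by
  obtain ⟨z, rfl⟩ := (TensorProduct.assoc ℂ V _ _).surjective z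
  obtain ⟨w, rfl⟩ := (TensorProduct.assoc ℂ V _ _).surjective w
  simp only [sliceTwo_assoc] at h
  exact congrArg _ (slice_ext fun y => slice_ext fun x => h x y)

lemma slice_mulLast (x : G) (s : V ⊗[ℂ] TwGroup T φ) (t : W ⊗[ℂ] TwGroup T φ) :
    slice (V ⊗[ℂ] W) x (Corep.mulLast V W _ (s ⊗ₜ t)) =
      linExt (fun p : G × G => slice V p.1 s ⊗ₜ[ℂ] slice W p.2 t) (diagTwist T φ x) := by
  induction s with
  | zero => simp [linExt_zero]
  | add s s' hs hs' => simp only [TensorProduct.add_tmul, map_add, hs, hs', linExt_add]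
  | tmul v f =>
    induction t with
    | zero => simp [linExt_zero]
    | add t t' ht ht' =>
      simp only [TensorProduct.tmul_add, map_add, ht, ht', linExt_add]
    | tmul w g =>
      rw [Corep.mulLast_tmul, slice_tmul, mul_eq]
      refine (map_linExt ((LinearMap.id (R := ℂ) (M := ℂ)).smulRight (v ⊗ₜ[ℂ] w)) _ _).trans ?_
      congr 2; ext p
      rw [slice_tmul, slice_tmul, TensorProduct.smul_tmul_smul]
      rfl

end Slice

/-- The representation of `G` defined by a corepresentation. -/
noncomputable def act (X : Corep (TwGroup T φ)) : Representation ℂ G X.V where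
  toFun x := slice X.V x ∘ₗ X.coact
  map_one' := LinearMap.ext fun v => X.counit v
  map_mul' x y := LinearMap.ext fun v => by
    change slice X.V (x * y) (X.coact v) = slice X.V x (X.coact (slice X.V y (X.coact v)))
    rw [← sliceTwo_lTensor_comul, ← X.coassoc, sliceTwo_assoc, slice_rTensor]

lemma act_apply (X : Corep (TwGroup T φ)) (x : G) (v : X.V) :
    act X x v = slice X.V x (X.coact v) := rfl

lemma act_comm {X Y : Corep (TwGroup T φ)} (f : X ⟶ Y) (x : G) (v : X.V) :
    Corep.lin f (act X x v) = act Y x (Corep.lin f v) := by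
  rw [act_apply, act_apply, Corep.lin_comm, slice_rTensor]

lemma act_mul (X : Corep (TwGroup T φ)) (x y : G) (v : X.V) :
    act X x (act X y v) = act X (x * y) v := by
  rw [map_mul]; rfl

lemma act_trivial (x : G) (c : (Corep.trivial (TwGroup T φ)).V) : act (Corep.trivial (TwGroup T φ)) x c = c :=
  one_mul (M := ℂ) c

lemma act_tensor (X Y : Corep (TwGroup T φ)) (x : G) (v : X.V) (w : Y.V) :
    act (Corep.tensor X Y) x (v ⊗ₜ w) =
      linExt (fun p : G × G => act X p.1 v ⊗ₜ[ℂ] act Y p.2 w) (diagTwist T φ x) :=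
  slice_mulLast x (X.coact v) (Y.coact w)

/-- The representation of `G × G` on a tensor product. -/
noncomputable def actTwo (X Y : Corep (TwGroup T φ)) :
    MonoidAlgebra ℂ (G × G) →ₐ[ℂ] Module.End ℂ (X.V ⊗[ℂ] Y.V) :=
  MonoidAlgebra.lift ℂ _ (G × G)
    { toFun := fun p => TensorProduct.map (act X p.1) (act Y p.2)
      map_one' := by simp
      map_mul' := fun p q => by
        rw [Prod.fst_mul, Prod.snd_mul, map_mul, map_mul]
        exact TensorProduct.map_mul _ _ _ _ }

lemma actTwo_single (X Y : Corep (TwGroup T φ)) (p : G × G) :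
    actTwo X Y (MonoidAlgebra.single p 1) = TensorProduct.map (act X p.1) (act Y p.2) := by
  rw [actTwo, MonoidAlgebra.lift_single, one_smul]; rfl

lemma actTwo_tmul (X Y : Corep (TwGroup T φ)) (z : MonoidAlgebra ℂ (G × G)) (v : X.V) (w : Y.V) :
    actTwo X Y z (v ⊗ₜ w) = linExt (fun p : G × G => act X p.1 v ⊗ₜ[ℂ] act Y p.2 w) z := by
  refine (linExt_apply_single
    ((LinearMap.applyₗ (v ⊗ₜ[ℂ] w)) ∘ₗ (actTwo X Y).toLinearMap) z).symm.trans ?_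
  simp only [LinearMap.comp_apply, AlgHom.toLinearMap_apply, actTwo_single,
    LinearMap.applyₗ_apply_apply, TensorProduct.map_tmul]

lemma act_tensor_eq_actTwo (X Y : Corep (TwGroup T φ)) (x : G) :
    act (Corep.tensor X Y) x = actTwo X Y (diagTwist T φ x) :=
  TensorProduct.ext' fun v w => (act_tensor X Y x v w).trans (actTwo_tmul X Y _ v w).symm

/-- The action of the twist on a tensor product. -/
noncomputable def twistMap (X Y : Corep (TwGroup T φ)) : X.V ⊗[ℂ] Y.V →ₗ[ℂ] X.V ⊗[ℂ] Y.V :=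
  actTwo X Y (mapG (φ.prodMap φ) T.J)

lemma twistMap_tmul (X Y : Corep (TwGroup T φ)) (v : X.V) (w : Y.V) : twistMap X Y (v ⊗ₜ w) =
    linExt (fun m : M × M => act X (φ m.1) v ⊗ₜ[ℂ] act Y (φ m.2) w) T.J := by
  rw [twistMap, actTwo_tmul, linExt_mapG]; rfl

lemma twistMap_twistMap (X Y : Corep (TwGroup T φ)) (z : X.V ⊗[ℂ] Y.V) :
    twistMap X Y (twistMap X Y z) = z := by
  have h : actTwo X Y (mapG (φ.prodMap φ) T.J * mapG (φ.prodMap φ) T.J) = 1 := by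
    rw [mapG_J_mul_self, map_one]
  rw [map_mul] at h
  exact LinearMap.congr_fun h z

/-- From `J (x, x) J · J = J (x, x)`: the twist carries the ordinary diagonal action of `G` to the
action on the tensor product of corepresentations. It is the tensor constraint of the equivalence.
-/
lemma act_twistMap (X Y : Corep (TwGroup T φ)) (x : G) (z : X.V ⊗[ℂ] Y.V) :
    act (Corep.tensor X Y) x (twistMap X Y z) =
      twistMap X Y (TensorProduct.map (act X x) (act Y x) z) := by
  have h : actTwo X Y (diagTwist T φ x * mapG (φ.prodMap φ) T.J) =
      actTwo X Y (mapG (φ.prodMap φ) T.J * MonoidAlgebra.single (x, x) 1) := by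
    rw [diagTwist, mul_assoc, mapG_J_mul_self, mul_one]
  rw [map_mul, map_mul, actTwo_single] at h
  rw [act_tensor_eq_actTwo]
  exact LinearMap.congr_fun h z

lemma act_tensor_twistMap (X Y : Corep (TwGroup T φ)) (m : M) (v : X.V) (w : Y.V) :
    act (Corep.tensor X Y) (φ m) (twistMap X Y (v ⊗ₜ w)) =
      linExt (fun m' : M × M => act X (φ (m * m'.1)) v ⊗ₜ[ℂ] act Y (φ (m * m'.2)) w) T.J := by
  rw [act_twistMap, TensorProduct.map_tmul, twistMap_tmul]
  simp only [act_mul, ← map_mul, mul_comm m]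
  rfl

lemma twistMap_natural {X X' Y Y' : Corep (TwGroup T φ)} (f : X ⟶ X') (g : Y ⟶ Y')
    (z : X.V ⊗[ℂ] Y.V) :
    twistMap X' Y' (TensorProduct.map (Corep.lin f) (Corep.lin g) z) =
      TensorProduct.map (Corep.lin f) (Corep.lin g) (twistMap X Y z) := by
  refine LinearMap.congr_fun (TensorProduct.ext'
    (g := twistMap X' Y' ∘ₗ TensorProduct.map (Corep.lin f) (Corep.lin g))
    (h := TensorProduct.map (Corep.lin f) (Corep.lin g) ∘ₗ twistMap X Y) fun v w => ?_) z
  rw [LinearMap.comp_apply, LinearMap.comp_apply, TensorProduct.map_tmul, twistMap_tmul,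
    twistMap_tmul, map_linExt]
  simp only [TensorProduct.map_tmul, act_comm]

/-- By `act_tensor_twistMap`, acting after an inner twist only multiplies the points, so the two
sides evaluate `v ⊗ (w ⊗ u)` on the two sides of the cocycle identity. -/
lemma twistMap_assoc (X Y Z : Corep (TwGroup T φ)) (v : X.V) (w : Y.V) (u : Z.V) :
    TensorProduct.assoc ℂ X.V Y.V Z.V (twistMap (Corep.tensor X Y) Z (twistMap X Y (v ⊗ₜ w) ⊗ₜ u)) =
      twistMap X (Corep.tensor Y Z) (v ⊗ₜ twistMap Y Z (w ⊗ₜ u)) := by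
  have h := congrArg (linExt fun p : M × M × M => act X (φ p.1) v ⊗ₜ[ℂ]
    (act Y (φ p.2.1) w ⊗ₜ[ℂ] act Z (φ p.2.2) u)) T.cocycle
  rw [mul_comm, mul_comm (mapG (MonoidHom.inr M (M × M)) T.J), ← linExt_linExt, ← linExt_linExt] at h
  have h1 : twistMap (Corep.tensor X Y) Z (twistMap X Y (v ⊗ₜ w) ⊗ₜ u) =
      linExt (fun m : M × M => linExt (fun m' : M × M => (act X (φ (m.1 * m'.1)) v ⊗ₜ[ℂ]
        act Y (φ (m.1 * m'.2)) w) ⊗ₜ[ℂ] act Z (φ m.2) u) T.J) T.J := by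
    refine (twistMap_tmul (Corep.tensor X Y) Z _ u).trans
      (congrArg (fun k => linExt k T.J) (funext fun m => ?_))
    exact (congrArg (fun z : X.V ⊗[ℂ] Y.V => z ⊗ₜ[ℂ] act Z (φ m.2) u)
      (act_tensor_twistMap X Y m.1 v w)).trans
      (map_linExt ((TensorProduct.mk ℂ _ Z.V).flip (act Z (φ m.2) u)) _ _)
  have h2 : twistMap X (Corep.tensor Y Z) (v ⊗ₜ twistMap Y Z (w ⊗ₜ u)) =
      linExt (fun m : M × M => linExt (fun m' : M × M => act X (φ m.1) v ⊗ₜ[ℂ]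
        (act Y (φ (m.2 * m'.1)) w ⊗ₜ[ℂ] act Z (φ (m.2 * m'.2)) u)) T.J) T.J := by
    refine (twistMap_tmul X (Corep.tensor Y Z) v _).trans
      (congrArg (fun k => linExt k T.J) (funext fun m => ?_))
    exact (congrArg (fun z : Y.V ⊗[ℂ] Z.V => act X (φ m.1) v ⊗ₜ[ℂ] z)
      (act_tensor_twistMap Y Z m.2 w u)).trans
      (map_linExt (TensorProduct.mk ℂ X.V _ (act X (φ m.1) v)) _ _)
  refine (congrArg (TensorProduct.assoc ℂ X.V Y.V Z.V) h1).trans (Eq.trans ?_ h2.symm)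
  refine (map_linExt (TensorProduct.assoc ℂ X.V Y.V Z.V).toLinearMap _ _).trans ?_
  simp only [map_linExt]
  simpa using h

lemma twistMap_trivial_left (X : Corep (TwGroup T φ))
    (c : (Corep.trivial (TwGroup T φ)).V) (v : X.V) :
    twistMap (Corep.trivial (TwGroup T φ)) X (c ⊗ₜ v) = c ⊗ₜ v := by
  rw [twistMap_tmul]
  simp only [act_trivial]
  have h := linExt_mapG (fun m => c ⊗ₜ[ℂ] act X (φ m) v) (MonoidHom.snd M M) T.J
  rw [T.mapG_snd_J, linExt_one, map_one, map_one] at h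
  exact h.symm

lemma twistMap_trivial_right (X : Corep (TwGroup T φ))
    (c : (Corep.trivial (TwGroup T φ)).V) (v : X.V) :
    twistMap X (Corep.trivial (TwGroup T φ)) (v ⊗ₜ c) = v ⊗ₜ c := by
  rw [twistMap_tmul]
  simp only [act_trivial]
  have h := linExt_mapG (fun m => act X (φ m) v ⊗ₜ[ℂ] c) (MonoidHom.fst M M) T.J
  rw [T.mapG_fst_J, linExt_one, map_one, map_one] at h
  exact h.symm

section corepOf
variable {V : Type} [AddCommGroup V] [Module ℂ V]

variable (T φ) in
/-- The coaction defined by a representation of `G`. -/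
noncomputable def coactOf (ρ : Representation ℂ G V) : V →ₗ[ℂ] V ⊗[ℂ] TwGroup T φ :=
  ∑ x, (TensorProduct.mk ℂ V (TwGroup T φ)).flip (delta x) ∘ₗ ρ x

lemma slice_coactOf (ρ : Representation ℂ G V) (x : G) (v : V) :
    slice V x (coactOf T φ ρ v) = ρ x v := by
  rw [coactOf, LinearMap.sum_apply, map_sum, Finset.sum_eq_single x]
  · simp [delta_apply]
  · intro y _ hy
    simp [delta_apply, hy.symm]
  · simp

variable (T φ) in
/-- The corepresentation defined by a representation of `G`. -/
noncomputable def corepOf [Module.Finite ℂ V] (ρ : Representation ℂ G V) :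
    Corep (TwGroup T φ) where
  V := V
  coact := coactOf T φ ρ
  coassoc v := by
    refine sliceTwo_ext fun x y => ?_
    rw [sliceTwo_assoc, slice_rTensor, sliceTwo_lTensor_comul, slice_coactOf, slice_coactOf,
      slice_coactOf, map_mul]
    rfl
  counit v := by
    refine (slice_coactOf ρ 1 v).trans ?_
    rw [map_one]; rfl

lemma act_corepOf [Module.Finite ℂ V] (ρ : Representation ℂ G V) : act (corepOf T φ ρ) = ρ :=
  MonoidHom.ext fun x => LinearMap.ext fun v => slice_coactOf ρ x v

end corepOf

/-- A linear map that commutes with the actions of `G` is an intertwiner. -/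
lemma coact_eq_of_act_comm {X Y : Corep (TwGroup T φ)} (f : X.V →ₗ[ℂ] Y.V)
    (hf : ∀ x v, f (act X x v) = act Y x (f v)) (v : X.V) :
    Y.coact (f v) = f.rTensor _ (X.coact v) :=
  slice_ext fun x => by rw [slice_rTensor]; exact (hf x v).symm

end TwGroup

/-! ### The equivalence of tensor categories -/

namespace FDRep

variable {G : Type} [Group G]

/-- A morphism of representations, from an equivariant linear map. -/
noncomputable def homOfLinear {V W : Type} [AddCommGroup V] [Module ℂ V] [Module.Finite ℂ V]
    [AddCommGroup W] [Module ℂ W] [Module.Finite ℂ W] {ρ : Representation ℂ G V}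
    {ρ' : Representation ℂ G W} (f : V →ₗ[ℂ] W) (hf : ∀ g v, f (ρ g v) = ρ' g (f v)) :
    FDRep.of ρ ⟶ FDRep.of ρ' where
  hom := FGModuleCat.ofHom f
  comm g := FGModuleCat.hom_ext (LinearMap.ext fun v => hf g v)

lemma hom_ext_linear {X Y : FDRep ℂ G} {f g : X ⟶ Y} (h : f.hom.hom.hom = g.hom.hom.hom) : f = g :=
  Action.Hom.ext (FGModuleCat.hom_ext h)

end FDRep

namespace TwGroup

variable {M G : Type} [CommGroup M] [Group G] [Fintype G] [DecidableEq G] {T : TwistDatum M}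
  {φ : M →* G}

open MonoidalCategory

variable (T φ) in
/-- The functor from corepresentations to representations of `G`. -/
noncomputable def toRep : Corep (TwGroup T φ) ⥤ FDRep ℂ G where
  obj X := FDRep.of (act X)
  map f := FDRep.homOfLinear (Corep.lin f) (act_comm f)

noncomputable instance : (toRep T φ).Additive where
  map_add := rfl

noncomputable instance : (toRep T φ).Linear ℂ where
  map_smul _ _ := rfl

instance : (toRep T φ).Faithful where
  map_injective h := Corep.hom_ext
    (congrArg (fun f : FDRep.of _ ⟶ FDRep.of _ => f.hom.hom.hom) h)

instance : (toRep T φ).Full where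
  map_surjective {X Y} f := by
    refine ⟨Corep.mkHom f.hom.hom.hom (coact_eq_of_act_comm _ fun x v => ?_), rfl⟩
    exact LinearMap.congr_fun (congrArg (fun h => h.hom.hom) (f.comm x)) v

instance : (toRep T φ).EssSurj where
  mem_essImage Y := by
    refine ⟨corepOf T φ Y.ρ, ⟨Action.mkIso (Iso.refl _) fun g => FGModuleCat.hom_ext ?_⟩⟩
    exact LinearMap.ext fun v => LinearMap.congr_fun
      (DFunLike.congr_fun (act_corepOf (T := T) (φ := φ) Y.ρ) g) v

/-- The tensor structure of the functor. -/
noncomputable def toRepCoreMonoidal : (toRep T φ).CoreMonoidal where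
  εIso := Action.mkIso (Iso.refl _) fun g => FGModuleCat.hom_ext
    (LinearMap.ext fun c => (act_trivial (T := T) (φ := φ) g c).symm)
  μIso X Y := Action.mkIso
    { hom := FGModuleCat.ofHom (twistMap X Y)
      inv := FGModuleCat.ofHom (twistMap X Y)
      hom_inv_id := FGModuleCat.hom_ext (LinearMap.ext (twistMap_twistMap X Y))
      inv_hom_id := FGModuleCat.hom_ext (LinearMap.ext (twistMap_twistMap X Y)) }
    fun g => FGModuleCat.hom_ext (LinearMap.ext fun z => (act_twistMap X Y g z).symm)
  μIso_hom_natural_left f X' := by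
    refine FDRep.hom_ext_linear (LinearMap.ext fun z => ?_)
    exact twistMap_natural f (𝟙 X') z
  μIso_hom_natural_right X' f := by
    refine FDRep.hom_ext_linear (LinearMap.ext fun z => ?_)
    exact twistMap_natural (𝟙 X') f z
  associativity X Y Z := by
    refine FDRep.hom_ext_linear (TensorProduct.ext_threefold fun v w u => ?_)
    exact twistMap_assoc X Y Z v w u
  left_unitality X := by
    refine FDRep.hom_ext_linear (TensorProduct.ext' fun c v => ?_)
    exact (congrArg (TensorProduct.lid ℂ X.V) (twistMap_trivial_left X c v)).symm
  right_unitality X := by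
    refine FDRep.hom_ext_linear (TensorProduct.ext' fun v c => ?_)
    exact (congrArg (TensorProduct.rid ℂ X.V) (twistMap_trivial_right X c v)).symm

variable (T φ) in
lemma sameTensorCategory : SameTensorCategory (TwGroup T φ) G :=
  ⟨toRep T φ, inferInstance, { }, inferInstance, ⟨toRepCoreMonoidal.toMonoidal⟩⟩

end TwGroup

/-! ### The flips of the pairs -/

section Flip
variable {n : ℕ}

lemma partner_val (i : Fin (2 * n)) :
    (partner i).val = if i.val % 2 = 0 then i.val + 1 else i.val - 1 := by
  unfold partner; split_ifs <;> rfl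

@[simp] lemma partner_partner (i : Fin (2 * n)) : partner (partner i) = i := by
  apply Fin.ext
  have h := partner_val (partner i)
  rw [partner_val i] at h
  split_ifs at h <;> omega

@[simp] lemma pairIndex_partner (i : Fin (2 * n)) : pairIndex (partner i) = pairIndex i := by
  apply Fin.ext
  change (partner i).val / 2 = i.val / 2
  rw [partner_val]
  split_ifs <;> omega

lemma partner_ne (i : Fin (2 * n)) : partner i ≠ i := by
  intro h
  have := congrArg Fin.val h
  rw [partner_val] at this
  split_ifs at this <;> omega

/-- The permutation that flips the pairs on which the sign is `-1`. -/
def flipPerm (m : Fin n → ℤˣ) : Equiv.Perm (Fin (2 * n)) :=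
  Function.Involutive.toPerm (fun i => if m (pairIndex i) = 1 then i else partner i) fun i => by
    by_cases h : m (pairIndex i) = 1 <;> simp [h]

lemma flipPerm_apply (m : Fin n → ℤˣ) (i : Fin (2 * n)) :
    flipPerm m i = if m (pairIndex i) = 1 then i else partner i := rfl

variable (n) in
/-- The group `Z₂ⁿ` of flips, in the group of permutations that preserve the pairs. -/
def flipHom : (Fin n → ℤˣ) →* pairSubgroup n where
  toFun m := ⟨flipPerm m, fun i => by rw [flipPerm_apply]; split_ifs <;> simp⟩
  map_one' := Subtype.ext (Equiv.ext fun i => by simp [flipPerm_apply])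
  map_mul' m m' := Subtype.ext (Equiv.ext fun i => by
    change flipPerm (m * m') i = flipPerm m (flipPerm m' i)
    simp only [flipPerm_apply, Pi.mul_apply]
    rcases Int.units_eq_one_or (m (pairIndex i)) with h | h <;>
      rcases Int.units_eq_one_or (m' (pairIndex i)) with h' | h' <;> simp [h, h'])

variable (n) in
/-- The flips, as permutations. -/
abbrev flips : (Fin n → ℤˣ) →* Equiv.Perm (Fin (2 * n)) := (pairSubgroup n).subtype.comp (flipHom n)

lemma flips_apply (m : Fin n → ℤˣ) (i : Fin (2 * n)) :
    flips n m i = if m (pairIndex i) = 1 then i else partner i := rfl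

lemma flips_mul_apply (m m' : Fin n → ℤˣ) (i : Fin (2 * n)) :
    flips n (m * m') i = flips n m' (flips n m i) := by
  rw [mul_comm m m', map_mul]; rfl

lemma flips_flips (m : Fin n → ℤˣ) (i : Fin (2 * n)) : flips n m (flips n m i) = i := by
  rw [← flips_mul_apply]
  have : m * m = 1 := funext fun i => Int.units_mul_self _
  rw [this, map_one]; rfl

lemma pairIndex_flips (m : Fin n → ℤˣ) (i : Fin (2 * n)) :
    pairIndex (flips n m i) = pairIndex i := (flipHom n m).2 i

lemma partner_flips (m : Fin n → ℤˣ) (i : Fin (2 * n)) :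
    flips n m (partner i) = partner (flips n m i) := by
  rw [flips_apply, flips_apply, pairIndex_partner]
  split_ifs <;> rfl

/-- The flip of one pair. -/
def oneFlip (a : Fin n) : Fin n → ℤˣ := Pi.mulSingle a (-1)

lemma flips_oneFlip_self (i : Fin (2 * n)) : flips n (oneFlip (pairIndex i)) i = partner i := by
  rw [flips_apply, oneFlip, Pi.mulSingle_eq_same, if_neg (by decide)]

lemma flips_oneFlip_of_ne {a : Fin n} {i : Fin (2 * n)} (h : a ≠ pairIndex i) :
    flips n (oneFlip a) i = i := by
  rw [flips_apply, oneFlip, Pi.mulSingle_eq_of_ne h.symm, if_pos rfl]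

open Classical in
/-- The twist datum of a relation between pairs. -/
noncomputable def pairDatum (P : Fin n → Fin n → Prop) : TwistDatum (Fin n → ℤˣ) where
  κ := Fin n × Fin n
  s := Finset.univ.filter fun p => P p.1 p.2
  a p := oneFlip p.1
  b p := oneFlip p.2
  sq _ := funext fun _ => Int.units_mul_self _

/-! ### The twist acting on functions of one or two indices -/

variable {V : Type} [AddCommGroup V] [Module ℂ V]

open Classical in
/-- The operator `h ↦ (h(k, l) + h(k', l) + h(k, l') - h(k', l')) / 2` on the blocks where `P`
holds. -/
noncomputable def pairTwist (P : Fin n → Fin n → Prop) (h : Fin (2 * n) → Fin (2 * n) → V)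
    (k l : Fin (2 * n)) : V :=
  if P (pairIndex k) (pairIndex l) then
    (1 / 2 : ℂ) • (h k l + h (partner k) l + h k (partner l) - h (partner k) (partner l))
  else h k l

/-- The flip of a pair fixes every point outside it, so all factors of `J` act trivially except the
one indexed by the pairs of `k` and `l`, and that one occurs exactly when `P` holds. -/
lemma linExt_pairDatum_J (P : Fin n → Fin n → Prop) (h : Fin (2 * n) → Fin (2 * n) → V)
    (k l : Fin (2 * n)) : linExt (fun m : (Fin n → ℤˣ) × (Fin n → ℤˣ) =>
      h (flips n m.1 k) (flips n m.2 l)) (pairDatum P).J = pairTwist P h k l := by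
  classical
  set E := linExt fun m : (Fin n → ℤˣ) × (Fin n → ℤˣ) => h (flips n m.1 k) (flips n m.2 l) with hE
  have hmul : ∀ m₀ : (Fin n → ℤˣ) × (Fin n → ℤˣ), flips n m₀.1 k = k → flips n m₀.2 l = l →
      ∀ z, E (MonoidAlgebra.single m₀ 1 * z) = E z := by
    intro m₀ h1 h2 z
    refine LinearMap.congr_fun (linearMap_ext_single
      (F := E ∘ₗ LinearMap.mulLeft ℂ (MonoidAlgebra.single m₀ 1)) fun m => ?_) z
    simp only [hE, LinearMap.comp_apply, LinearMap.mulLeft_apply, MonoidAlgebra.single_mul_single,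
      mul_one, linExt_single, Prod.fst_mul, Prod.snd_mul, flips_mul_apply, h1, h2]
  have key := linearMap_twistElt_mul E (Finset.univ.filter fun p : Fin n × Fin n => P p.1 p.2)
    (· = (pairIndex k, pairIndex l))
    (fun p => (oneFlip p.1, 1)) (fun p => (1, oneFlip p.2)) (fun p _ hp => by
      by_cases h1 : p.1 = pairIndex k
      · have h2 : p.2 ≠ pairIndex l := fun h2 => hp (Prod.ext h1 h2)
        exact Or.inr (hmul _ rfl (flips_oneFlip_of_ne h2))
      · exact Or.inl (hmul _ (flips_oneFlip_of_ne h1) rfl)) 1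
  rw [mul_one, mul_one] at key
  have hJ : (pairDatum P).J = twistElt (Finset.univ.filter fun p : Fin n × Fin n => P p.1 p.2)
      (fun p => (oneFlip p.1, 1)) (fun p => (1, oneFlip p.2)) := by
    simp only [TwistDatum.J, pairDatum]
  rw [hJ]
  refine key.trans ?_
  have hs : (Finset.univ.filter fun p : Fin n × Fin n => P p.1 p.2).filter (· = (pairIndex k, pairIndex l)) =
      if P (pairIndex k) (pairIndex l) then {(pairIndex k, pairIndex l)} else ∅ := by
    rw [Finset.filter_eq']
    simp
  rw [hs, pairTwist]
  split_ifs with hP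
  · rw [twistElt, Finset.prod_singleton, signTwist, map_smul, map_sub, map_add, map_add,
      MonoidAlgebra.single_mul_single, MonoidAlgebra.one_def]
    simp only [hE, linExt_single, Prod.mk_mul_mk, one_mul, mul_one, one_smul, Prod.fst_one,
      Prod.snd_one, flips_oneFlip_self]
    simp
  · rw [twistElt, Finset.prod_empty, hE, linExt_one]
    simp

/-- Each factor of `U` involves two different pairs, at least one of which does not contain `k`; so
every factor acts trivially. For this reason the coordinates keep their untwisted adjoints and
antipodes. -/
lemma linExt_pairDatum_U {P : Fin n → Fin n → Prop} (hP : ∀ a, ¬ P a a) (h : Fin (2 * n) → V)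
    (k : Fin (2 * n)) :
    linExt (fun m : Fin n → ℤˣ => h (flips n m k)) (pairDatum P).U = h k := by
  classical
  set E := linExt fun m : Fin n → ℤˣ => h (flips n m k) with hE
  have hmul : ∀ m₀ : Fin n → ℤˣ, flips n m₀ k = k →
      ∀ z, E (MonoidAlgebra.single m₀ 1 * z) = E z := by
    intro m₀ h1 z
    refine LinearMap.congr_fun (linearMap_ext_single
      (F := E ∘ₗ LinearMap.mulLeft ℂ (MonoidAlgebra.single m₀ 1)) fun m => ?_) z
    simp only [hE, LinearMap.comp_apply, LinearMap.mulLeft_apply, MonoidAlgebra.single_mul_single,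
      mul_one, linExt_single, flips_mul_apply, h1]
  have key := linearMap_twistElt_mul E (Finset.univ.filter fun p : Fin n × Fin n => P p.1 p.2)
    (fun _ => False) (fun p => oneFlip p.1) (fun p => oneFlip p.2) (fun p hp _ => by
      have hp' : P p.1 p.2 := (Finset.mem_filter.1 hp).2
      by_cases h1 : p.1 = pairIndex k
      · have h2 : p.2 ≠ pairIndex k := fun h2 => hP _ (by rwa [h1, h2] at hp')
        exact Or.inr (hmul _ (flips_oneFlip_of_ne h2))
      · exact Or.inl (hmul _ (flips_oneFlip_of_ne h1))) 1
  rw [mul_one, mul_one] at key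
  have hU : (pairDatum P).U = twistElt (Finset.univ.filter fun p : Fin n × Fin n => P p.1 p.2)
      (fun p => oneFlip p.1) (fun p => oneFlip p.2) := by
    simp only [TwistDatum.U, pairDatum]
  rw [hU]
  refine key.trans ?_
  rw [Finset.filter_false, twistElt, Finset.prod_empty, hE, linExt_one, map_one]
  rfl

lemma map_pairTwist {W : Type} [AddCommGroup W] [Module ℂ W] (L : V →ₗ[ℂ] W)
    (P : Fin n → Fin n → Prop) (h : Fin (2 * n) → Fin (2 * n) → V) (k l : Fin (2 * n)) :
    L (pairTwist P h k l) = pairTwist P (fun k l => L (h k l)) k l := by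
  by_cases hP : P (pairIndex k) (pairIndex l)
  · simp only [pairTwist, hP, if_true, map_smul, map_add, map_sub]
  · simp only [pairTwist, hP, if_false]

lemma pairTwist_pairTwist (P : Fin n → Fin n → Prop) (h : Fin (2 * n) → Fin (2 * n) → V) :
    pairTwist P (pairTwist P h) = h := by
  funext k l
  by_cases hP : P (pairIndex k) (pairIndex l)
  · simp only [pairTwist, pairIndex_partner, partner_partner, hP, if_true]
    module
  · simp only [pairTwist, hP, if_false]

/-- Exchanging the variables transposes the relation; this is how the product in the other order
comes to involve the opposite half of the graph. -/
lemma pairTwist_swap (P : Fin n → Fin n → Prop) (h : Fin (2 * n) → Fin (2 * n) → V)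
    (k l : Fin (2 * n)) :
    pairTwist P (fun l k => h k l) l k = pairTwist (fun a b => P b a) h k l := by
  by_cases hP : P (pairIndex l) (pairIndex k)
  · simp only [pairTwist, hP, if_true]
    module
  · simp only [pairTwist, hP, if_false]

/-- The operators of two complementary relations. -/
lemma pairTwist_comp {P Q D : Fin n → Fin n → Prop} (hD : ∀ a b, D a b ↔ P a b ∨ Q a b)
    (hPQ : ∀ a b, P a b → ¬ Q a b) (h : Fin (2 * n) → Fin (2 * n) → V) :
    pairTwist P (pairTwist Q h) = pairTwist D h := by
  funext k l
  have h1 := hD (pairIndex k) (pairIndex l)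
  have h2 := hPQ (pairIndex k) (pairIndex l)
  by_cases hP : P (pairIndex k) (pairIndex l)
  · have hd := h1.2 (Or.inl hP)
    have hq := h2 hP
    simp only [pairTwist, pairIndex_partner, partner_partner, hP, hd, hq, if_true, if_false]
  · by_cases hQ : Q (pairIndex k) (pairIndex l)
    · have hd := h1.2 (Or.inr hQ)
      simp only [pairTwist, hP, hd, hQ, if_true, if_false]
    · have hd : ¬ D (pairIndex k) (pairIndex l) := fun hd => (h1.1 hd).elim hP hQ
      simp only [pairTwist, hP, hd, hQ, if_false]

/-- The operator `pairTwist`, on the first two of four variables. -/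
noncomputable def rowTwist (P : Fin n → Fin n → Prop)
    (F : Fin (2 * n) → Fin (2 * n) → Fin (2 * n) → Fin (2 * n) → V)
    (k l j i : Fin (2 * n)) : V := pairTwist P (fun k l => F k l j i) k l

/-- The operator `pairTwist`, on the last two of four variables. -/
noncomputable def colTwist (P : Fin n → Fin n → Prop)
    (F : Fin (2 * n) → Fin (2 * n) → Fin (2 * n) → Fin (2 * n) → V)
    (k l j i : Fin (2 * n)) : V := pairTwist P (F k l) j i

lemma rowTwist_colTwist (P Q : Fin n → Fin n → Prop)
    (F : Fin (2 * n) → Fin (2 * n) → Fin (2 * n) → Fin (2 * n) → V) :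
    rowTwist P (colTwist Q F) = colTwist Q (rowTwist P F) := by
  funext k l j i
  by_cases hP : P (pairIndex k) (pairIndex l) <;> by_cases hQ : Q (pairIndex j) (pairIndex i)
  · simp only [rowTwist, colTwist, pairTwist, hP, hQ, if_true]
    module
  all_goals simp only [rowTwist, colTwist, pairTwist, hP, hQ, if_false, if_true]

section Comp
variable (F : Fin (2 * n) → Fin (2 * n) → Fin (2 * n) → Fin (2 * n) → V)

lemma rowTwist_rowTwist (P : Fin n → Fin n → Prop) : rowTwist P (rowTwist P F) = F := by
  funext k l j i
  exact congrFun (congrFun (pairTwist_pairTwist P fun k l => F k l j i) k) l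

lemma colTwist_colTwist (P : Fin n → Fin n → Prop) : colTwist P (colTwist P F) = F := by
  funext k l j i
  exact congrFun (congrFun (pairTwist_pairTwist P (F k l)) j) i

lemma rowTwist_comp {P Q D : Fin n → Fin n → Prop} (hD : ∀ a b, D a b ↔ P a b ∨ Q a b)
    (hPQ : ∀ a b, P a b → ¬ Q a b) : rowTwist P (rowTwist Q F) = rowTwist D F := by
  funext k l j i
  exact congrFun (congrFun (pairTwist_comp hD hPQ fun k l => F k l j i) k) l

lemma colTwist_comp {P Q D : Fin n → Fin n → Prop} (hD : ∀ a b, D a b ↔ P a b ∨ Q a b)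
    (hPQ : ∀ a b, P a b → ¬ Q a b) : colTwist P (colTwist Q F) = colTwist D F := by
  funext k l j i
  exact congrFun (congrFun (pairTwist_comp hD hPQ (F k l)) j) i

end Comp

lemma pairTwist_self {P : Fin n → Fin n → Prop} (hP : ∀ a, ¬ P a a)
    (h : Fin (2 * n) → Fin (2 * n) → V) (k : Fin (2 * n)) : pairTwist P h k k = h k k :=
  if_neg (hP _)

/-- On a block where `P` holds the two pairs differ, so all four terms are off-diagonal. -/
lemma pairTwist_eq_zero {P : Fin n → Fin n → Prop} (hP : ∀ a, ¬ P a a)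
    {h : Fin (2 * n) → Fin (2 * n) → V} (h0 : ∀ k l, k ≠ l → h k l = 0) {k l : Fin (2 * n)}
    (hkl : k ≠ l) : pairTwist P h k l = 0 := by
  by_cases hP' : P (pairIndex k) (pairIndex l)
  · have hne : ∀ {k' l' : Fin (2 * n)}, pairIndex k' = pairIndex k → pairIndex l' = pairIndex l →
        k' ≠ l' := by
      rintro k' l' hk hl rfl
      exact hP (pairIndex k') (by rwa [← hk, ← hl] at hP')
    simp only [pairTwist, hP', if_true]
    rw [h0 _ _ hkl, h0 (partner k) l (hne (by simp) rfl), h0 k (partner l) (hne rfl (by simp)),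
      h0 (partner k) (partner l) (hne (by simp) (by simp))]
    simp
  · simp only [pairTwist, hP', if_false]
    exact h0 _ _ hkl

end Flip

/-! ### Magic matrices with commuting entries -/

/-- The conditions on magic unitary matrices that do not involve the involution. -/
structure IsMagic {N : ℕ} {B : Type} [Ring B] (v : Matrix (Fin N) (Fin N) B) : Prop where
  idempotent : ∀ i j, v i j * v i j = v i j
  row_orthogonal : ∀ i j k, j ≠ k → v i j * v i k = 0
  col_orthogonal : ∀ i j k, i ≠ k → v i j * v k j = 0
  row_sum : ∀ i, ∑ j, v i j = 1
  col_sum : ∀ j, ∑ i, v i j = 1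

lemma IsMagicUnitary.isMagic {N : ℕ} {B : Type} [Ring B] [StarRing B]
    {v : Matrix (Fin N) (Fin N) B} (h : IsMagicUnitary v) : IsMagic v :=
  ⟨fun i j => (h.isStarProjection i j).isIdempotentElem, h.row_orthogonal, h.col_orthogonal,
    h.row_sum, h.col_sum⟩

namespace IsMagic
variable {N : ℕ} {S : Type} [CommRing S] {v : Matrix (Fin N) (Fin N) S} (hv : IsMagic v)

/-- The products of the entries along a permutation. -/
def diagProd (v : Matrix (Fin N) (Fin N) S) (g : Fin N → Fin N) : S := ∏ j, v (g j) j

include hv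

lemma entry_mul_diagProd (k j : Fin N) (g : Fin N → Fin N) :
    v k j * diagProd v g = if g j = k then diagProd v g else 0 := by
  rw [diagProd, ← Finset.mul_prod_erase _ _ (Finset.mem_univ j), ← mul_assoc]
  split_ifs with h
  · rw [h, hv.idempotent]
  · rw [hv.col_orthogonal _ _ _ (Ne.symm h), zero_mul]

lemma diagProd_mul_diagProd (g h : Fin N → Fin N) :
    diagProd v g * diagProd v h = if g = h then diagProd v g else 0 := by
  split_ifs with hgh
  · subst hgh
    simp only [diagProd, ← Finset.prod_mul_distrib, hv.idempotent]
  · obtain ⟨j, hj⟩ := Function.ne_iff.1 hgh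
    simp only [diagProd, ← Finset.prod_mul_distrib]
    exact Finset.prod_eq_zero (Finset.mem_univ j) (hv.col_orthogonal _ _ _ hj)

lemma diagProd_eq_zero {g : Fin N → Fin N} (hg : ¬ Function.Injective g) : diagProd v g = 0 := by
  obtain ⟨i, j, hij, hne⟩ : ∃ i j, g i = g j ∧ i ≠ j := by
    simpa [Function.Injective] using hg
  have h := hv.entry_mul_diagProd (g i) i g
  rw [if_pos rfl] at h
  have h' := hv.entry_mul_diagProd (g i) j g
  rw [if_pos hij.symm] at h'
  rw [← h, ← h', ← mul_assoc, hv.row_orthogonal _ _ _ hne, zero_mul]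

/-- Expanding the product of the column sums gives a sum over all maps, in which row orthogonality
kills the non-injective ones. -/
lemma sum_diagProd : ∑ g : Equiv.Perm (Fin N), diagProd v g = 1 := by
  have h : ∏ j, ∑ k, v k j = 1 := Finset.prod_eq_one fun j _ => hv.col_sum j
  rw [Finset.prod_univ_sum, Fintype.piFinset_univ] at h
  rw [← h]
  refine Finset.sum_of_injOn (fun g : Equiv.Perm (Fin N) => (g : Fin N → Fin N))
    (fun g _ h _ e => DFunLike.coe_injective e) (fun _ _ => Finset.mem_coe.2 (Finset.mem_univ _))
    (fun g _ hg => ?_) (fun _ _ => rfl)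
  refine hv.diagProd_eq_zero fun hi => hg ⟨Equiv.ofBijective g ?_, by simp, rfl⟩
  exact Finite.injective_iff_bijective.1 hi

lemma sum_diagProd_entry (k j : Fin N) :
    ∑ g : Equiv.Perm (Fin N), (if g j = k then diagProd v g else 0) = v k j := by
  simp only [← hv.entry_mul_diagProd, ← Finset.mul_sum, hv.sum_diagProd, mul_one]

end IsMagic

/-! ### `C(S_N)` and magic matrices with commuting entries -/

namespace FunAlg
variable {N : ℕ}

/-- The function `g ↦ [g j = k]` on the symmetric group. -/
def coord (k j : Fin N) : FunAlg (Equiv.Perm (Fin N)) := fun g => if g j = k then 1 else 0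

lemma coord_apply (k j : Fin N) (g : Equiv.Perm (Fin N)) :
    coord k j g = if g j = k then 1 else 0 := rfl

/-- The indicator function of `g` is the product over `j` of the functions `[x j = g j]`. -/
lemma adjoin_coord :
    Algebra.adjoin ℂ {f : FunAlg (Equiv.Perm (Fin N)) | ∃ k j, f = coord k j} = ⊤ := by
  classical
  refine eq_top_iff.2 fun f _ => ?_
  rw [eq_sum f]
  refine Subalgebra.sum_mem _ fun g _ => Subalgebra.smul_mem _ ?_ _
  have h : delta g = ∏ j, coord (g j) j := by
    refine ext fun x => ?_
    refine Eq.trans ?_ (map_prod (eval x) (fun j => coord (g j) j) Finset.univ).symm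
    simp only [eval_apply, delta_apply, coord_apply, Finset.prod_ite_zero, Finset.prod_const_one]
    simp [Equiv.ext_iff]
  rw [h]
  exact Subalgebra.prod_mem _ fun j _ => Algebra.subset_adjoin ⟨_, _, rfl⟩

/-- The morphism given by a magic matrix with commuting entries. -/
lemma exists_algHom_of_commute {R : Type} [Ring R] [Algebra ℂ R] {w : Matrix (Fin N) (Fin N) R}
    (hw : IsMagic w) (hc : ∀ i j k l, w k j * w l i = w l i * w k j) :
    ∃ Ψ : FunAlg (Equiv.Perm (Fin N)) →ₐ[ℂ] R, ∀ k j, Ψ (coord k j) = w k j := by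
  let s : Set R := {a | ∃ k j, a = w k j}
  let S := Algebra.adjoin ℂ s
  have hS : IsMulCommutative S := Algebra.isMulCommutative_adjoin ℂ (s := s) (by
    rintro _ ⟨k, j, rfl⟩ _ ⟨l, i, rfl⟩
    exact hc _ _ _ _)
  let : CommRing S := { (inferInstance : Ring S) with mul_comm := hS.is_comm.comm }
  let v : Matrix (Fin N) (Fin N) S := fun k j => ⟨w k j, Algebra.subset_adjoin ⟨k, j, rfl⟩⟩
  have hv : IsMagic v :=
    { idempotent := fun i j => Subtype.ext (hw.idempotent i j)
      row_orthogonal := fun i j k h => Subtype.ext (hw.row_orthogonal i j k h)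
      col_orthogonal := fun i j k h => Subtype.ext (hw.col_orthogonal i j k h)
      row_sum := fun i => Subtype.ext
        ((map_sum S.val (fun j => v i j) Finset.univ).trans (hw.row_sum i))
      col_sum := fun j => Subtype.ext
        ((map_sum S.val (fun i => v i j) Finset.univ).trans (hw.col_sum j)) }
  let Ψ : FunAlg (Equiv.Perm (Fin N)) →ₐ[ℂ] S := AlgHom.ofLinearMap
    { toFun := fun f => ∑ g : Equiv.Perm (Fin N), f g • IsMagic.diagProd v g
      map_add' := fun f f' => by
        rw [← Finset.sum_add_distrib]
        exact Finset.sum_congr rfl fun g _ => add_smul _ _ _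
      map_smul' := fun c f => by
        rw [Finset.smul_sum]
        exact Finset.sum_congr rfl fun g _ => mul_smul _ _ _ }
    ((Finset.sum_congr rfl fun g _ => one_smul _ _).trans hv.sum_diagProd)
    (fun f f' => by
      change ∑ g : Equiv.Perm (Fin N), (f g * f' g) • _ = (∑ g : Equiv.Perm (Fin N), f g • _) *
        ∑ g : Equiv.Perm (Fin N), f' g • _
      rw [Finset.sum_mul_sum]
      refine Finset.sum_congr rfl fun g _ => ?_
      simp only [smul_mul_smul_comm, hv.diagProd_mul_diagProd, DFunLike.coe_fn_eq]
      simp)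
  refine ⟨S.val.comp Ψ, fun k j => ?_⟩
  refine (congrArg S.val (?_ : Ψ (coord k j) = v k j)).trans rfl
  refine Eq.trans ?_ (hv.sum_diagProd_entry k j)
  refine Finset.sum_congr rfl fun g _ => ?_
  simp [coord_apply]

end FunAlg

/-! ### Magic matrices over twisted function algebras -/

section PairRelation
variable {n : ℕ}

/-- The pairs `a < b` in a relation `D`. -/
def lowerPart (D : Fin n → Fin n → Prop) (a b : Fin n) : Prop := a < b ∧ D a b

/-- The pairs `b < a` in a relation `D`. -/
def upperPart (D : Fin n → Fin n → Prop) (a b : Fin n) : Prop := lowerPart D b a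

variable {D : Fin n → Fin n → Prop}

lemma lowerPart_irrefl (a : Fin n) : ¬ lowerPart D a a := fun h => lt_irrefl _ h.1

lemma iff_lowerPart_or (hs : ∀ a b, D a b → D b a) (hi : ∀ a, ¬ D a a) (a b : Fin n) :
    D a b ↔ lowerPart D a b ∨ upperPart D a b := by
  constructor
  · intro h
    rcases lt_trichotomy a b with hab | rfl | hab
    · exact Or.inl ⟨hab, h⟩
    · exact (hi _ h).elim
    · exact Or.inr ⟨hab, hs _ _ h⟩
  · rintro (h | h)
    exacts [h.2, hs _ _ h.2]

lemma iff_upperPart_or (hs : ∀ a b, D a b → D b a) (hi : ∀ a, ¬ D a a) (a b : Fin n) :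
    D a b ↔ upperPart D a b ∨ lowerPart D a b := by
  rw [or_comm, iff_lowerPart_or hs hi]

lemma not_upperPart (a b : Fin n) (h : lowerPart D a b) : ¬ upperPart D a b :=
  fun h' => lt_asymm h.1 h'.1

lemma not_lowerPart (a b : Fin n) (h : upperPart D a b) : ¬ lowerPart D a b :=
  fun h' => lt_asymm h.1 h'.1

variable {B : Type} [Ring B] [Algebra ℂ B]

/-- Apply the row operator of the lower half and the column operator of the upper half to both
sides. Since `D` is the composite of its halves and each operator is an involution, the columns keep
the lower half on the left and the rows keep the upper half on the right. -/
lemma colTwist_rowTwist_eq (hs : ∀ a b, D a b → D b a) (hi : ∀ a, ¬ D a a)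
    {F F' : Fin (2 * n) → Fin (2 * n) → Fin (2 * n) → Fin (2 * n) → B}
    (h : colTwist D F = rowTwist D F') :
    colTwist (lowerPart D) (rowTwist (lowerPart D) F) =
      colTwist (upperPart D) (rowTwist (upperPart D) F') := by
  have h1 : colTwist (upperPart D) (rowTwist (lowerPart D) (colTwist D F)) =
      colTwist (upperPart D) (rowTwist (lowerPart D) (rowTwist D F')) := by rw [h]
  rw [← rowTwist_comp F' (iff_lowerPart_or hs hi) not_upperPart, rowTwist_rowTwist,
    rowTwist_colTwist, ← colTwist_comp _ (iff_upperPart_or hs hi) not_lowerPart,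
    colTwist_colTwist] at h1
  exact h1

/-- After cancellation of the repeated halves, both sides are the column operator of the upper half
composed with the row operator of the lower half. -/
lemma colTwist_colTwist_eq (hs : ∀ a b, D a b → D b a) (hi : ∀ a, ¬ D a a)
    (F : Fin (2 * n) → Fin (2 * n) → Fin (2 * n) → Fin (2 * n) → B) :
    colTwist D (colTwist (lowerPart D) (rowTwist (lowerPart D) F)) =
      rowTwist D (colTwist (upperPart D) (rowTwist (upperPart D) F)) := by
  rw [← colTwist_comp _ (iff_upperPart_or hs hi) not_lowerPart, colTwist_colTwist,
    rowTwist_colTwist, ← rowTwist_comp _ (iff_lowerPart_or hs hi) not_upperPart,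
    rowTwist_rowTwist]

end PairRelation

/-! ### The defining relations as a comparison of column and row twists -/

section Commutation
variable {n : ℕ}

/-- The relation between pairs given by the entries `-1` of a sign matrix. -/
def negRel (p : Matrix (Fin n) (Fin n) ℂ) (a b : Fin n) : Prop := p a b = -1

variable {p : Matrix (Fin n) (Fin n) ℂ}

lemma IsSignMatrix.negRel_symm (hp : IsSignMatrix p) (a b : Fin n) (h : negRel p a b) :
    negRel p b a := (hp.symm b a).trans h

lemma IsSignMatrix.not_negRel_self (hp : IsSignMatrix p) (a : Fin n) : ¬ negRel p a a := by
  intro h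
  rw [negRel, hp.diag] at h
  norm_num at h

variable {B : Type} [Ring B] [Algebra ℂ B]

/-- The products of the entries of a matrix. -/
def entryProd (v : Matrix (Fin (2 * n)) (Fin (2 * n)) B) (k l j i : Fin (2 * n)) : B := v k j * v l i

/-- The products of the entries of a matrix, in the other order. -/
def entryProdRev (v : Matrix (Fin (2 * n)) (Fin (2 * n)) B) (k l j i : Fin (2 * n)) : B :=
  v l i * v k j

lemma four_smul_pairTwist (hp : IsSignMatrix p) (h : Fin (2 * n) → Fin (2 * n) → B)
    (k l : Fin (2 * n)) :
    (3 + p (pairIndex k) (pairIndex l)) • h k l +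
      (1 - p (pairIndex k) (pairIndex l)) • h k (partner l) +
      (1 - p (pairIndex k) (pairIndex l)) • h (partner k) l +
      (p (pairIndex k) (pairIndex l) - 1) • h (partner k) (partner l) =
    (4 : ℂ) • pairTwist (negRel p) h k l := by
  rcases hp.sign (pairIndex k) (pairIndex l) with h1 | h1
  · have h2 : ¬ negRel p (pairIndex k) (pairIndex l) := by
      rw [negRel, h1]; norm_num
    rw [h1, pairTwist, if_neg h2]
    module
  · rw [pairTwist, if_pos (show negRel p (pairIndex k) (pairIndex l) from h1), h1]
    module

/-- The relations of `C_p(S_{2n})`, in terms of the operators `pairTwist`. -/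
lemma twistedCommutation_iff (hp : IsSignMatrix p) (v : Matrix (Fin (2 * n)) (Fin (2 * n)) B) :
    TwistedCommutation p v ↔
      colTwist (negRel p) (entryProd v) = rowTwist (negRel p) (entryProdRev v) := by
  have key : ∀ i j k l, ((3 + p (pairIndex i) (pairIndex j)) • (v k j * v l i) +
      (1 - p (pairIndex i) (pairIndex j)) • (v k j * v l (partner i)) +
      (1 - p (pairIndex i) (pairIndex j)) • (v k (partner j) * v l i) +
      (p (pairIndex i) (pairIndex j) - 1) • (v k (partner j) * v l (partner i)) =
      (3 + p (pairIndex l) (pairIndex k)) • (v l i * v k j) +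
      (1 - p (pairIndex l) (pairIndex k)) • (v (partner l) i * v k j) +
      (1 - p (pairIndex l) (pairIndex k)) • (v l i * v (partner k) j) +
      (p (pairIndex l) (pairIndex k) - 1) • (v (partner l) i * v (partner k) j)) ↔
      colTwist (negRel p) (entryProd v) k l j i = rowTwist (negRel p) (entryProdRev v) k l j i := by
    intro i j k l
    have h1 := four_smul_pairTwist hp (fun j i => v k j * v l i) j i
    have h2 := four_smul_pairTwist hp (fun k l => v l i * v k j) k l
    rw [hp.symm (pairIndex i), hp.symm (pairIndex l), h1, h2]
    exact smul_right_inj (show (4 : ℂ) ≠ 0 by norm_num)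
  constructor
  · intro h
    funext k l j i
    exact (key i j k l).1 (h i j k l)
  · intro h i j k l
    exact (key i j k l).2 (by rw [h])

end Commutation

/-! ### Flip-equivariant matrices over twisted function algebras -/

namespace TwFun
variable {n : ℕ} {X B : Type} [Ring B] [Algebra ℂ B] {P : Fin n → Fin n → Prop}
  {α : (Fin n → ℤˣ) × (Fin n → ℤˣ) →* Equiv.Perm X}

/-- The equivariance of a matrix of functions under flips of its rows and columns. -/
def IsFlipEquivariant (w : Matrix (Fin (2 * n)) (Fin (2 * n)) (TwFun (pairDatum P).double α B)) :
    Prop := ∀ k j m x, w k j (α m x) = w (flips n m.1 k) (flips n m.2 j) x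

/-- The values at a point of a matrix of functions. -/
def atPoint (w : Matrix (Fin (2 * n)) (Fin (2 * n)) (TwFun (pairDatum P).double α B)) (x : X) :
    Matrix (Fin (2 * n)) (Fin (2 * n)) B := fun k j => w k j x

variable {w : Matrix (Fin (2 * n)) (Fin (2 * n)) (TwFun (pairDatum P).double α B)}

namespace IsFlipEquivariant

variable (hw : IsFlipEquivariant w)
include hw

lemma translate_eq (m : (Fin n → ℤˣ) × (Fin n → ℤˣ)) (k j : Fin (2 * n)) :
    translate m (w k j) = w (flips n m.1 k) (flips n m.2 j) := ext fun x => hw k j m x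

/-- By equivariance, the first factor of `M × M` flips rows and the second flips columns, so the two
copies of `J` become a row twist and a column twist of the pointwise products. -/
lemma entry_mul_entry (k l j i : Fin (2 * n)) (x : X) : (w k j * w l i) x =
    colTwist P (rowTwist P (entryProd (atPoint w x))) k l j i := by
  rw [mul_apply, TwistDatum.double_J, linExt_mul]
  simp only [linExt_mapG]
  refine Eq.trans ?_ (linExt_pairDatum_J P
    (fun j i => rowTwist P (entryProd (atPoint w x)) k l j i) j i)
  refine congrArg (fun h => linExt h (pairDatum P).J) (funext fun m => ?_)
  refine Eq.trans ?_ (linExt_pairDatum_J P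
    (fun k l => w k (flips n m.1 j) x * w l (flips n m.2 i) x) k l)
  refine congrArg (fun h => linExt h (pairDatum P).J) (funext fun m' => ?_)
  rw [hw, hw]
  simp

lemma entry_mul_entry_rev (k l j i : Fin (2 * n)) (x : X) : (w l i * w k j) x =
    colTwist (fun a b => P b a) (rowTwist (fun a b => P b a) (entryProdRev (atPoint w x))) k l j i := by
  rw [hw.entry_mul_entry]
  refine Eq.trans ?_ (pairTwist_swap P
    (fun j i => rowTwist (fun a b => P b a) (entryProdRev (atPoint w x)) k l j i) j i)
  refine congrArg (fun h => pairTwist P h i j) ?_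
  funext i j
  exact pairTwist_swap P (fun k l => entryProdRev (atPoint w x) k l j i) k l

/-- The magic conditions concern two entries in a common row or column. The twist of two equal
indices is trivial, and the twist of the other two indices preserves vanishing off the diagonal. -/
lemma isMagic (hP : ∀ a, ¬ P a a) (h : ∀ x, IsMagic (atPoint w x)) : IsMagic w where
  idempotent i j := ext fun x => by
    rw [hw.entry_mul_entry, colTwist, pairTwist_self hP, rowTwist, pairTwist_self hP]
    exact (h x).idempotent i j
  row_orthogonal i j k hjk := ext fun x => by
    rw [hw.entry_mul_entry, colTwist]
    refine pairTwist_eq_zero hP (fun j k hjk => ?_) hjk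
    rw [rowTwist, pairTwist_self hP]
    exact (h x).row_orthogonal i j k hjk
  col_orthogonal i j k hik := ext fun x => by
    rw [hw.entry_mul_entry, colTwist, pairTwist_self hP, rowTwist]
    exact pairTwist_eq_zero hP (fun i k hik => (h x).col_orthogonal i j k hik) hik
  row_sum i := ext fun x => (map_sum (evalAt x) _ _).trans ((h x).row_sum i)
  col_sum j := ext fun x => (map_sum (evalAt x) _ _).trans ((h x).col_sum j)

end IsFlipEquivariant

variable {p : Matrix (Fin n) (Fin n) ℂ}
  {w : Matrix (Fin (2 * n)) (Fin (2 * n)) (TwFun (pairDatum (lowerPart (negRel p))).double α B)}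

/-- Pointwise commutation gives the relations of `C_p(S_{2n})`. -/
lemma IsFlipEquivariant.twistedCommutation (hw : IsFlipEquivariant w) (hp : IsSignMatrix p)
    (h : ∀ x i j k l, w k j x * w l i x = w l i x * w k j x) : TwistedCommutation p w := by
  rw [twistedCommutation_iff hp]
  funext k l j i
  refine ext fun x => ?_
  have hx : entryProd (atPoint w x) = entryProdRev (atPoint w x) := by
    funext k l j i; exact h x i j k l
  have h1 := colTwist_colTwist_eq hp.negRel_symm hp.not_negRel_self (entryProd (atPoint w x))
  have e1 : ∀ k l j i, evalAt x (w k j * w l i) = _ := fun k l j i => hw.entry_mul_entry k l j i x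
  have e2 : ∀ k l j i, evalAt x (w l i * w k j) = _ :=
    fun k l j i => hw.entry_mul_entry_rev k l j i x
  rw [← hx] at e2
  change evalAt x (colTwist (negRel p) (entryProd w) k l j i) =
    evalAt x (rowTwist (negRel p) (entryProdRev w) k l j i)
  have h2 := congrFun (congrFun (congrFun (congrFun h1 k) l) j) i
  have c1 : evalAt x (colTwist (negRel p) (entryProd w) k l j i) = colTwist (negRel p) (colTwist
      (lowerPart (negRel p)) (rowTwist (lowerPart (negRel p)) (entryProd (atPoint w x)))) k l j i := by
    refine (map_pairTwist _ _ _ _ _).trans ?_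
    exact congrArg (fun h => pairTwist (negRel p) h j i) (funext fun j => funext fun i => e1 k l j i)
  have c2 : evalAt x (rowTwist (negRel p) (entryProdRev w) k l j i) = rowTwist (negRel p) (colTwist
      (upperPart (negRel p)) (rowTwist (upperPart (negRel p)) (entryProd (atPoint w x)))) k l j i := by
    refine (map_pairTwist _ _ _ _ _).trans ?_
    exact congrArg (fun h => pairTwist (negRel p) h k l) (funext fun k => funext fun l => e2 k l j i)
  rw [c1, c2, h2]

/-- Pointwise, the relations of `C_p(S_{2n})` give commutation. -/
lemma IsFlipEquivariant.commute (hw : IsFlipEquivariant w) (hp : IsSignMatrix p)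
    (h : ∀ x, TwistedCommutation p (atPoint w x)) (i j k l : Fin (2 * n)) :
    w k j * w l i = w l i * w k j := by
  refine ext fun x => ?_
  rw [hw.entry_mul_entry, hw.entry_mul_entry_rev]
  have h1 := colTwist_rowTwist_eq hp.negRel_symm hp.not_negRel_self
    ((twistedCommutation_iff hp _).1 (h x))
  exact congrFun (congrFun (congrFun (congrFun h1 k) l) j) i

end TwFun

/-! ### Equivariant morphisms and the twist -/

lemma linExt_mem {X V : Type} [AddCommGroup V] [Module ℂ V] (S : Submodule ℂ V) {h : X → V}
    (hS : ∀ x, h x ∈ S) (z : MonoidAlgebra ℂ X) : linExt h z ∈ S := by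
  have := map_linExt S.subtype (fun x => (⟨h x, hS x⟩ : S)) z
  exact this ▸ (linExt (fun x => (⟨h x, hS x⟩ : S)) z).2

/-- Composition with a map. -/
noncomputable def FunAlg.precomp {G : Type} (a : G → G) : FunAlg G →ₐ[ℂ] FunAlg G := AlgHom.ofLinearMap
  { toFun := fun f => fun x => f (a x)
    map_add' := fun _ _ => rfl
    map_smul' := fun _ _ => rfl } rfl (fun _ _ => rfl)

/-- Equivariant morphisms are compatible with the twist. -/
lemma TwFun.exists_algHom_of_equivariant {M : Type} [CommGroup M] {T : TwistDatum M} {G X B : Type}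
    [Ring B] [Algebra ℂ B] {α : M →* Equiv.Perm G} {β : M →* Equiv.Perm X}
    (Ψ : FunAlg G →ₐ[ℂ] TwFun T β B) (x₀ : X)
    (h : ∀ m, Ψ.comp (FunAlg.precomp (α m)) = (TwFun.translate m).comp Ψ) :
    ∃ F : TwFun T α ℂ →ₐ[ℂ] B, ∀ f : FunAlg G, F f = Ψ f x₀ := by
  let c : TwFun T α ℂ → FunAlg G := fun f => f
  have hmul : ∀ f f' : TwFun T α ℂ, Ψ (c (f * f')) x₀ = Ψ (c f) x₀ * Ψ (c f') x₀ := by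
    intro f f'
    have h1 : c (f * f') = linExt (fun m : M × M => FunAlg.precomp (α m.1) (c f) *
        FunAlg.precomp (α m.2) (c f')) T.J := by
      refine FunAlg.ext fun x => ?_
      have h3 : ∀ m : M × M, (FunAlg.eval x).toLinearMap (FunAlg.precomp (α m.1) (c f) *
          FunAlg.precomp (α m.2) (c f')) = f (α m.1 x) * f' (α m.2 x) :=
        fun m => map_mul (FunAlg.eval x) _ _
      have h4 := map_linExt (FunAlg.eval x).toLinearMap (fun m : M × M =>
        FunAlg.precomp (α m.1) (c f) * FunAlg.precomp (α m.2) (c f')) T.J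
      simp only [h3] at h4
      exact h4.symm
    -- The twisted product in the source is a `J`-combination of pointwise products of translates;
    -- its image is the same combination of products twisted in the target. Evaluation then gives
    -- `J² = 1`, hence the plain product in `B`.
    have h2 : Ψ (c (f * f')) = linExt (fun m : M × M => TwFun.translate m.1 (Ψ (c f)) *
        TwFun.translate m.2 (Ψ (c f'))) T.J := by
      rw [h1]
      refine (map_linExt Ψ.toLinearMap _ _).trans ?_
      refine congrArg (fun h => linExt h T.J) (funext fun m => ?_)
      refine (map_mul Ψ _ _).trans ?_
      exact congrArg₂ _ (AlgHom.congr_fun (h m.1) (c f)) (AlgHom.congr_fun (h m.2) (c f'))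
    rw [h2]
    exact TwFun.evalAt_linExt_translate_mul _ _ _
  exact ⟨AlgHom.ofLinearMap
    { toFun := fun f => Ψ (c f) x₀
      map_add' := fun f f' => congrArg (TwFun.evalAt x₀) (map_add Ψ (c f) (c f'))
      map_smul' := fun a f => congrArg (TwFun.evalAt x₀) (map_smul Ψ a (c f)) }
    (congrArg (TwFun.evalAt x₀) (map_one Ψ)) hmul, fun _ => rfl⟩

/-! ### The twisted symmetric groups -/

/-- The twist of the algebra of functions on `S_{2n}` by the lower part of a relation between
pairs. -/
abbrev TwSym {n : ℕ} (D : Fin n → Fin n → Prop) : Type :=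
  TwGroup (pairDatum (lowerPart D)) (flips n)

namespace TwSym
variable {n : ℕ}

/-- The function `g ↦ [g j = k]`. -/
def coord (D : Fin n → Fin n → Prop) : Matrix (Fin (2 * n)) (Fin (2 * n)) (TwSym D) :=
  fun k j => FunAlg.coord k j

variable {D : Fin n → Fin n → Prop}

lemma coord_apply (k j : Fin (2 * n)) (g : Equiv.Perm (Fin (2 * n))) :
    coord D k j g = if g j = k then 1 else 0 := rfl

/-- A flip is an involution, so a left flip of `g` is a flip of the row index, and a right flip of
`g` is a flip of the column index. -/
lemma coord_isFlipEquivariant : TwFun.IsFlipEquivariant (coord D) := by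
  intro k j m g
  rw [coord_apply, coord_apply, biAct_apply]
  refine if_congr ?_ rfl rfl
  change flips n m.1 (g (flips n m.2 j)) = k ↔ _
  constructor
  · rintro rfl
    rw [flips_flips]
  · intro h
    rw [h, flips_flips]

lemma coord_isMagic : IsMagic (coord D) := by
  refine coord_isFlipEquivariant.isMagic lowerPart_irrefl fun g => ?_
  refine ⟨fun i j => ?_, fun i j k h => ?_, fun i j k h => ?_, fun i => ?_, fun j => ?_⟩
  · change (if _ then (1 : ℂ) else 0) * (if _ then (1 : ℂ) else 0) = (if _ then (1 : ℂ) else 0)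
    split_ifs <;> simp
  · change (if g j = i then (1 : ℂ) else 0) * (if g k = i then (1 : ℂ) else 0) = 0
    split_ifs with h1 h2
    · exact (h (g.injective (h1.trans h2.symm))).elim
    all_goals simp
  · change (if g j = i then (1 : ℂ) else 0) * (if g j = k then (1 : ℂ) else 0) = 0
    split_ifs with h1 h2
    · exact (h (h1.symm.trans h2)).elim
    all_goals simp
  · change ∑ j, (if g j = i then (1 : ℂ) else 0) = 1
    rw [Finset.sum_eq_single (g.symm i)]
    · simp
    · intro j _ hj
      exact if_neg fun h => hj (by rw [← h, Equiv.symm_apply_apply])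
    · simp
  · change ∑ i, (if g j = i then (1 : ℂ) else 0) = 1
    simp

lemma coord_twistedCommutation {p : Matrix (Fin n) (Fin n) ℂ} (hp : IsSignMatrix p) :
    TwistedCommutation p (coord (negRel p)) :=
  coord_isFlipEquivariant.twistedCommutation hp fun _ _ _ _ _ => mul_comm _ _

lemma linExt_U_coord (k j : Fin (2 * n)) (g : Equiv.Perm (Fin (2 * n))) :
    linExt (fun m' => linExt (fun m => coord D k j (flips n m * g * flips n m'))
      (pairDatum (lowerPart D)).U) (pairDatum (lowerPart D)).U = coord D k j g := by
  refine Eq.trans ?_ (linExt_pairDatum_U (lowerPart_irrefl (D := D)) (fun j => coord D k j g) j)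
  refine congrArg (fun h => linExt h (pairDatum (lowerPart D)).U) (funext fun m' => ?_)
  refine Eq.trans ?_ (linExt_pairDatum_U (lowerPart_irrefl (D := D))
    (fun k => coord D k (flips n m' j) g) k)
  refine congrArg (fun h => linExt h (pairDatum (lowerPart D)).U) (funext fun m => ?_)
  exact coord_isFlipEquivariant k j (m, m') g

lemma star_coord (k j : Fin (2 * n)) : star (coord D k j) = coord D k j := by
  refine TwFun.ext fun g => ?_
  rw [TwGroup.star_eq_nested]
  have h : ∀ x, star (coord D k j x) = coord D k j x := fun x => by
    rw [coord_apply]; split_ifs <;> simp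
  simp only [h, linExt_U_coord]

lemma coord_isMagicUnitary : IsMagicUnitary (coord D) where
  isStarProjection i j := ⟨coord_isMagic.idempotent i j, star_coord i j⟩
  row_orthogonal := coord_isMagic.row_orthogonal
  col_orthogonal := coord_isMagic.col_orthogonal
  row_sum := coord_isMagic.row_sum
  col_sum := coord_isMagic.col_sum

/-- The subalgebra generated is stable under translations, since translates of coordinates are
coordinates. Pointwise products are `J`-combinations of twisted products of translates, so it is
also a subalgebra for the pointwise product, where the coordinates generate everything. -/
lemma adjoin_coord : Algebra.adjoin ℂ {a : TwSym D | ∃ k j, a = coord D k j} = ⊤ := by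
  set S := Algebra.adjoin ℂ {a : TwSym D | ∃ k j, a = coord D k j} with hS
  have htr : ∀ m, ∀ f ∈ S, TwFun.translate m f ∈ S := by
    intro m f hf
    have h1 : S.map (TwFun.translate m) ≤ S := by
      rw [hS, AlgHom.map_adjoin]
      refine Algebra.adjoin_le ?_
      rintro _ ⟨_, ⟨k, j, rfl⟩, rfl⟩
      rw [coord_isFlipEquivariant.translate_eq]
      exact Algebra.subset_adjoin ⟨_, _, rfl⟩
    exact h1 ⟨f, hf, rfl⟩
  let c : FunAlg (Equiv.Perm (Fin (2 * n))) → TwSym D := fun f => f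
  let S' : Subalgebra ℂ (FunAlg (Equiv.Perm (Fin (2 * n)))) :=
    { carrier := {f | c f ∈ S}
      mul_mem' := fun {f f'} hf hf' => by
        have h : c (f * f') =
            linExt (fun m => TwFun.translate m.1 (c f) *
              TwFun.translate m.2 (c f')) (pairDatum (lowerPart D)).double.J :=
          TwFun.ext fun x => (TwFun.evalAt_linExt_translate_mul (α := biAct (flips n))
            (T := (pairDatum (lowerPart D)).double) f f' x).symm
        change c (f * f') ∈ S
        rw [h]
        exact linExt_mem (Subalgebra.toSubmodule S)
          (fun m => S.mul_mem (htr _ _ hf) (htr _ _ hf')) _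
      add_mem' := fun {f f'} hf hf' => S.add_mem hf hf'
      algebraMap_mem' := fun a => by
        have h : c (algebraMap ℂ (FunAlg (Equiv.Perm (Fin (2 * n)))) a) = a • (1 : TwSym D) :=
          (congrArg c (Algebra.algebraMap_eq_smul_one a)).trans rfl
        change c (algebraMap ℂ (FunAlg (Equiv.Perm (Fin (2 * n)))) a) ∈ S
        rw [h]
        exact S.smul_mem S.one_mem a }
  refine eq_top_iff.2 fun f _ => ?_
  have h : (⊤ : Subalgebra ℂ (FunAlg (Equiv.Perm (Fin (2 * n))))) ≤ S' := by
    rw [← FunAlg.adjoin_coord]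
    refine Algebra.adjoin_le ?_
    rintro _ ⟨k, j, rfl⟩
    exact Algebra.subset_adjoin (show coord D k j ∈ _ from ⟨k, j, rfl⟩)
  exact h (show (show FunAlg (Equiv.Perm (Fin (2 * n))) from f) ∈ ⊤ from trivial)

lemma comul_coord (i j : Fin (2 * n)) : Coalgebra.comul (R := ℂ) (coord D i j) =
    ∑ k, coord D i k ⊗ₜ[ℂ] coord D k j := by
  refine TwGroup.evalTwo_ext fun x y => ?_
  rw [TwGroup.evalTwo_comul, map_sum]
  simp only [TwGroup.evalTwo_tmul, coord_apply, Equiv.Perm.mul_apply]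
  rw [Finset.sum_eq_single (y j)]
  · rw [if_pos (rfl : y j = y j), mul_one]
    rfl
  · intro k _ hk
    rw [if_neg (Ne.symm hk), mul_zero]
  · exact fun h => (h (Finset.mem_univ _)).elim

lemma counit_coord (i j : Fin (2 * n)) :
    Coalgebra.counit (R := ℂ) (coord D i j) = if i = j then 1 else 0 := by
  rw [TwGroup.counit_eq, coord_apply]
  simp [eq_comm]

lemma antipode_coord (i j : Fin (2 * n)) :
    HopfAlgebra.antipode ℂ (coord D i j) = coord D j i := by
  refine TwFun.ext fun g => ?_
  rw [TwGroup.antipode_eq, linExt_U_coord, coord_apply, coord_apply]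
  refine if_congr ?_ rfl rfl
  rw [Equiv.Perm.inv_eq_iff_eq, eq_comm]

variable (D) in
lemma isQuantumPermutationGroup : IsQuantumPermutationGroup
    (TwGroup.quantumGroup (pairDatum (lowerPart D)) (flips n)) (coord D) where
  magic := coord_isMagicUnitary
  generates := adjoin_coord
  comul_apply := comul_coord
  counit_apply := counit_coord
  antipode_apply := antipode_coord

/-! ### The universal property -/

section Universal
variable {p : Matrix (Fin n) (Fin n) ℂ} {B : Type} [Ring B] [Algebra ℂ B]

/-- The action of an abelian group on itself by translations. -/
def translationAct (M : Type) [CommGroup M] : M →* Equiv.Perm M := MulAction.toPermHom M M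

/-- The twist is undone by twisting once more: the flipped copies of `v`, as functions on `M × M`,
commute for the twisted product and receive a morphism from `C(S_{2n})`, which evaluation at `1`
makes a morphism from the twist to `B`. -/
lemma exists_algHom (hp : IsSignMatrix p) {v : Matrix (Fin (2 * n)) (Fin (2 * n)) B}
    (hv : IsMagic v) (hc : TwistedCommutation p v) :
    ∃ F : TwSym (negRel p) →ₐ[ℂ] B, ∀ k j, F (coord (negRel p) k j) = v k j := by
  let M := Fin n → ℤˣ
  let R := TwFun (pairDatum (lowerPart (negRel p))).double (translationAct (M × M)) B
  let w : Matrix (Fin (2 * n)) (Fin (2 * n)) R := fun k j x => v (flips n x.1 k) (flips n x.2 j)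
  have hw : TwFun.IsFlipEquivariant w := by
    intro k j m x
    change v (flips n (m.1 * x.1) k) (flips n (m.2 * x.2) j) = _
    rw [flips_mul_apply, flips_mul_apply]
  have hbij : ∀ x : M, Function.Bijective (flips n x) := fun x => (flips n x).bijective
  have hmag : IsMagic w := by
    refine hw.isMagic lowerPart_irrefl fun x => ?_
    exact
      { idempotent := fun i j => hv.idempotent _ _
        row_orthogonal := fun i j k h => hv.row_orthogonal _ _ _ ((hbij x.2).1.ne h)
        col_orthogonal := fun i j k h => hv.col_orthogonal _ _ _ ((hbij x.1).1.ne h)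
        row_sum := fun i => (Equiv.sum_comp (flips n x.2) fun j => v (flips n x.1 i) j).trans
          (hv.row_sum _)
        col_sum := fun j => (Equiv.sum_comp (flips n x.1) fun i => v i (flips n x.2 j)).trans
          (hv.col_sum _) }
  -- The relations are invariant under flips of the indices, since a flip preserves every pair and
  -- commutes with `partner`.
  have hcom : ∀ i j k l, w k j * w l i = w l i * w k j := by
    refine hw.commute hp fun x i j k l => ?_
    have := hc (flips n x.2 i) (flips n x.2 j) (flips n x.1 k) (flips n x.1 l)
    simpa only [TwFun.atPoint, w, pairIndex_flips, ← partner_flips] using this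
  obtain ⟨Ψ, hΨ⟩ := FunAlg.exists_algHom_of_commute hmag hcom
  obtain ⟨F, hF⟩ := TwFun.exists_algHom_of_equivariant (α := biAct (flips n)) Ψ (1 : M × M)
    fun m => by
      refine AlgHom.ext_of_adjoin_eq_top FunAlg.adjoin_coord ?_
      rintro _ ⟨k, j, rfl⟩
      have h1 : FunAlg.precomp (biAct (flips n) m) (FunAlg.coord k j) =
          FunAlg.coord (flips n m.1 k) (flips n m.2 j) :=
        funext fun x => coord_isFlipEquivariant (D := negRel p) k j m x
      rw [AlgHom.comp_apply, AlgHom.comp_apply, h1, hΨ, hΨ, hw.translate_eq]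
  refine ⟨F, fun k j => (hF _).trans ?_⟩
  refine (congrArg (TwFun.evalAt (1 : M × M)) (hΨ k j)).trans ?_
  change v (flips n 1 k) (flips n 1 j) = v k j
  rw [map_one]
  rfl

lemma algHom_ext {F F' : TwSym D →ₐ[ℂ] B} (h : ∀ k j, F (coord D k j) = F' (coord D k j)) :
    F = F' := by
  refine AlgHom.ext_of_adjoin_eq_top adjoin_coord ?_
  rintro _ ⟨k, j, rfl⟩
  exact h k j

end Universal

lemma isTwistedSymmetricAlgebra {p : Matrix (Fin n) (Fin n) ℂ} (hp : IsSignMatrix p) :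
    IsTwistedSymmetricAlgebra p (coord (negRel p)) where
  magic := coord_isMagicUnitary
  relations := coord_twistedCommutation hp
  universal B _ v hv hc := by
    obtain ⟨F, hF⟩ := exists_algHom hp hv.isMagic hc
    -- On the generators this holds because the coordinates and their images are both self-adjoint.
    have hstar : ∀ a, F (star a) = star (F a) := by
      intro a
      have ha : a ∈ Algebra.adjoin ℂ {a : TwSym (negRel p) | ∃ k j, a = coord (negRel p) k j} := by
        rw [adjoin_coord]; trivial
      induction ha using Algebra.adjoin_induction with
      | mem x hx =>
        obtain ⟨k, j, rfl⟩ := hx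
        rw [star_coord, hF, (hv.isStarProjection k j).isSelfAdjoint.star_eq]
      | algebraMap c => rw [← algebraMap_star_comm, AlgHom.commutes, AlgHom.commutes,
          ← algebraMap_star_comm]
      | add x y _ _ hx hy => rw [star_add, map_add, map_add, star_add, hx, hy]
      | mul x y _ _ hx hy => rw [star_mul, map_mul, map_mul, star_mul, hx, hy]
    refine ⟨{ F with map_star' := hstar }, hF, fun f hf => ?_⟩
    have h : f.toAlgHom = F := algHom_ext fun k j => (hf k j).trans (hF k j).symm
    exact StarAlgHom.ext fun a => AlgHom.congr_fun h a

end TwSym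

/-! ### Characters -/

section Character
variable {n : ℕ}

/-- The matrix of a permutation. -/
def permEntries {N : ℕ} (g : Equiv.Perm (Fin N)) : Matrix (Fin N) (Fin N) ℂ :=
  fun k j => if g j = k then 1 else 0

lemma IsMagic.exists_eq_permEntries {N : ℕ} {v : Matrix (Fin N) (Fin N) ℂ} (hv : IsMagic v) :
    ∃ g : Equiv.Perm (Fin N), v = permEntries g := by
  have h1 : ∀ j, ∃ k, v k j ≠ 0 := by
    intro j
    by_contra! h
    have := hv.col_sum j
    simp [h] at this
  choose g hg using h1
  have hone : ∀ j, v (g j) j = 1 := fun j =>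
    mul_left_cancel₀ (hg j) ((hv.idempotent _ _).trans (mul_one _).symm)
  have hzero : ∀ k j, g j ≠ k → v k j = 0 := fun k j h => by
    have := hv.col_orthogonal (g j) j k h
    rwa [hone, one_mul] at this
  have hinj : Function.Injective g := by
    intro i j hij
    by_contra h
    have := hv.row_orthogonal (g i) i j h
    rw [hone, hij, hone] at this
    norm_num at this
  refine ⟨Equiv.ofBijective g (Finite.injective_iff_bijective.1 hinj), ?_⟩
  funext k j
  change v k j = if g j = k then 1 else 0
  split_ifs with h
  · rw [← h, hone]
  · exact hzero k j h

lemma permEntries_isMagic {N : ℕ} (g : Equiv.Perm (Fin N)) : IsMagic (permEntries g) := by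
  refine ⟨fun i j => ?_, fun i j k h => ?_, fun i j k h => ?_, fun i => ?_, fun j => ?_⟩
  · simp only [permEntries]
    split_ifs <;> simp
  · simp only [permEntries]
    split_ifs with h1 h2
    · exact (h (g.injective (h1.trans h2.symm))).elim
    all_goals simp
  · simp only [permEntries]
    split_ifs with h1 h2
    · exact (h (h1.symm.trans h2)).elim
    all_goals simp
  · simp only [permEntries]
    rw [Finset.sum_eq_single (g.symm i)]
    · simp
    · intro j _ hj
      exact if_neg fun h => hj (by rw [← h, Equiv.symm_apply_apply])
    · simp
  · simp [permEntries]

lemma permEntries_injective {N : ℕ} {g g' : Equiv.Perm (Fin N)} (h : permEntries g = permEntries g') :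
    g = g' := by
  ext1 j
  have := congrFun (congrFun h (g j)) j
  simp only [permEntries, if_true] at this
  by_contra hne
  rw [if_neg (Ne.symm hne)] at this
  norm_num at this

lemma TwistedCommutation.map {p : Matrix (Fin n) (Fin n) ℂ} {A B : Type} [Ring A] [Algebra ℂ A]
    [Ring B] [Algebra ℂ B] {u : Matrix (Fin (2 * n)) (Fin (2 * n)) A} (h : TwistedCommutation p u)
    (F : A →ₐ[ℂ] B) : TwistedCommutation p (fun k j => F (u k j)) := by
  intro i j k l
  simpa only [map_add, map_smul, map_mul] using congrArg F (h i j k l)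

lemma IsMagic.map {N : ℕ} {A B : Type} [Ring A] [Algebra ℂ A] [Ring B] [Algebra ℂ B]
    {u : Matrix (Fin N) (Fin N) A} (h : IsMagic u) (F : A →ₐ[ℂ] B) :
    IsMagic (fun k j => F (u k j)) where
  idempotent i j := by rw [← map_mul, h.idempotent]
  row_orthogonal i j k hjk := by rw [← map_mul, h.row_orthogonal i j k hjk, map_zero]
  col_orthogonal i j k hik := by rw [← map_mul, h.col_orthogonal i j k hik, map_zero]
  row_sum i := by rw [← map_sum, h.row_sum, map_one]
  col_sum j := by rw [← map_sum, h.col_sum, map_one]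

/-- The classical points of the quantum group with function algebra `C_p(S_{2n})`. -/
def classicalPoints (p : Matrix (Fin n) (Fin n) ℂ) : Set (Equiv.Perm (Fin (2 * n))) :=
  {g | TwistedCommutation p (permEntries g)}

/-- A scalar magic matrix is a permutation matrix, and by universality characters are the
permutation matrices that satisfy the relations. This number depends only on the algebra, so it also
excludes isomorphisms that ignore the coalgebra. -/
lemma card_character {p : Matrix (Fin n) (Fin n) ℂ} (hp : IsSignMatrix p) :
    Nat.card (TwSym (negRel p) →ₐ[ℂ] ℂ) = (classicalPoints p).ncard := by
  have h : ∀ g : classicalPoints p, ∃ F : TwSym (negRel p) →ₐ[ℂ] ℂ,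
      ∀ k j, F (TwSym.coord (negRel p) k j) = permEntries g.1 k j := fun g =>
    TwSym.exists_algHom hp (permEntries_isMagic g.1) g.2
  choose F hF using h
  refine (Nat.card_congr (Equiv.ofBijective F ⟨fun g g' hg => ?_, fun f => ?_⟩)).symm
  · refine Subtype.ext (permEntries_injective ?_)
    funext k j
    rw [← hF, ← hF, hg]
  · obtain ⟨g, hg⟩ := (TwSym.coord_isMagic.map f).exists_eq_permEntries
    have hg' : TwistedCommutation p (permEntries g) :=
      hg ▸ (TwSym.coord_twistedCommutation hp).map f
    refine ⟨⟨g, hg'⟩, TwSym.algHom_ext fun k j => ?_⟩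
    rw [hF]
    exact (congrFun (congrFun hg k) j).symm

/-! ### Classical points in terms of the graph of `p` -/

variable {p : Matrix (Fin n) (Fin n) ℂ} {g : Equiv.Perm (Fin (2 * n))}

/-- In the relation at `(g j, g i, j, i)`, each side is `1 / 2` if its pairs are joined in the graph
and `1` if they are not. -/
lemma negRel_iff_of_mem (hp : IsSignMatrix p) (hg : g ∈ classicalPoints p) (j i : Fin (2 * n)) :
    negRel p (pairIndex j) (pairIndex i) ↔ negRel p (pairIndex (g j)) (pairIndex (g i)) := by
  have h := congrFun (congrFun (congrFun (congrFun ((twistedCommutation_iff hp _).1 hg)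
    (g j)) (g i)) j) i
  have hj : ∀ j, g (partner j) ≠ g j := fun j => g.injective.ne (partner_ne j)
  have hk : ∀ k : Fin (2 * n), k ≠ partner k := fun k => (partner_ne k).symm
  by_cases h1 : negRel p (pairIndex j) (pairIndex i) <;>
    by_cases h2 : negRel p (pairIndex (g j)) (pairIndex (g i))
  · exact iff_of_true h1 h2
  · simp [colTwist, rowTwist, pairTwist, entryProd, entryProdRev, permEntries, h1, h2, hj] at h
  · simp [colTwist, rowTwist, pairTwist, entryProd, entryProdRev, permEntries, h1, h2, hk] at h
  · exact iff_of_false h1 h2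

/-- In the relation at `(g j', g i, j, i)`, the left side is `1 / 2`, from the flip of the column
`j`. The right side is `0` unless `g j` is the partner of `g j'`. -/
lemma partner_of_mem (hp : IsSignMatrix p) (hg : g ∈ classicalPoints p) {j i : Fin (2 * n)}
    (hD : negRel p (pairIndex j) (pairIndex i)) : g (partner j) = partner (g j) := by
  have h := congrFun (congrFun (congrFun (congrFun ((twistedCommutation_iff hp _).1 hg)
    (g (partner j))) (g i)) j) i
  have hj : ∀ j, g (partner j) ≠ g j := fun j => g.injective.ne (partner_ne j)
  have hk : ∀ k : Fin (2 * n), k ≠ partner k := fun k => (partner_ne k).symm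
  have h2 : negRel p (pairIndex (g (partner j))) (pairIndex (g i)) := by
    rw [← negRel_iff_of_mem hp hg, pairIndex_partner]
    exact hD
  by_contra hne
  have hne' : g j ≠ partner (g (partner j)) := fun h => hne (by rw [h, partner_partner])
  simp [colTwist, rowTwist, pairTwist, entryProd, entryProdRev, permEntries, hD, h2, hj, hk,
    (hj _).symm, hne'] at h

/-- For such a `g`, flipping a column of its matrix amounts to flipping a row. So column and row
twists agree on the blocks that meet the support of the products, and both vanish on the other
blocks. -/
lemma mem_classicalPoints (hp : IsSignMatrix p) (hg : ∀ j, g (partner j) = partner (g j))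
    (hD : ∀ j i, negRel p (pairIndex j) (pairIndex i) ↔
      negRel p (pairIndex (g j)) (pairIndex (g i))) : g ∈ classicalPoints p := by
  refine (twistedCommutation_iff hp _).2 ?_
  funext k l j i
  have hpart : ∀ j k, partner (g j) = k ↔ g j = partner k := fun j k =>
    ⟨fun h => by rw [← h, partner_partner], fun h => by rw [h, partner_partner]⟩
  have hinv : ∀ j k, permEntries g k (partner j) = permEntries g (partner k) j := fun j k => by
    simp only [permEntries, hg, hpart]
  have hcases : ∀ j k, pairIndex k ≠ pairIndex (g j) → permEntries g k j = 0 := fun j k h =>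
    if_neg fun h' => h (by rw [h'])
  by_cases hk : pairIndex k = pairIndex (g j) ∧ pairIndex l = pairIndex (g i)
  · have h1 := hD j i
    rw [← hk.1, ← hk.2] at h1
    by_cases h2 : negRel p (pairIndex j) (pairIndex i)
    · have h3 := h1.1 h2
      simp only [colTwist, rowTwist, pairTwist, entryProd, entryProdRev, h2, h3, if_true, hinv]
      simp only [mul_comm]
    · have h3 : ¬ negRel p (pairIndex k) (pairIndex l) := fun h => h2 (h1.2 h)
      simp only [colTwist, rowTwist, pairTwist, entryProd, entryProdRev, h2, h3, if_false]
      rw [mul_comm]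
  · have h0 : ∀ k' l', pairIndex k' = pairIndex k → pairIndex l' = pairIndex l →
        permEntries g k' j * permEntries g l' i = 0 := by
      intro k' l' hk' hl'
      rcases not_and_or.1 hk with h | h
      · rw [hcases j k' (by rwa [hk']), zero_mul]
      · rw [hcases i l' (by rwa [hl']), mul_zero]
    have e1 : colTwist (negRel p) (entryProd (permEntries g)) k l j i = 0 := by
      by_cases h2 : negRel p (pairIndex j) (pairIndex i)
      · simp only [colTwist, pairTwist, entryProd, h2, if_true, hinv]
        rw [h0 _ _ rfl rfl, h0 _ _ (pairIndex_partner k) rfl, h0 _ _ rfl (pairIndex_partner l),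
          h0 _ _ (pairIndex_partner k) (pairIndex_partner l)]
        simp
      · simp only [colTwist, pairTwist, entryProd, h2, if_false]
        exact h0 _ _ rfl rfl
    have e2 : rowTwist (negRel p) (entryProdRev (permEntries g)) k l j i = 0 := by
      by_cases h2 : negRel p (pairIndex k) (pairIndex l)
      · simp only [rowTwist, pairTwist, entryProdRev, h2, if_true, mul_comm (permEntries g _ i)]
        rw [h0 _ _ rfl rfl, h0 _ _ (pairIndex_partner k) rfl, h0 _ _ rfl (pairIndex_partner l),
          h0 _ _ (pairIndex_partner k) (pairIndex_partner l)]
        simp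
      · simp only [rowTwist, pairTwist, entryProdRev, h2, if_false, mul_comm (permEntries g _ i)]
        exact h0 _ _ rfl rfl
    rw [e1, e2]

end Character

/-! ### Threshold graphs -/

section Threshold
variable {n : ℕ}

/-- The edges of a threshold graph, in which the first `i` vertices are alternately joined to all
the later ones and to none of them. -/
def thresholdRel (i : ℕ) (a b : Fin n) : Prop := a ≠ b ∧ Even (min (min a.val b.val) i)

lemma thresholdRel_comm {i : ℕ} (a b : Fin n) : thresholdRel i a b ↔ thresholdRel i b a := by
  rw [thresholdRel, thresholdRel, min_comm b.val, ne_comm]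

/-- The automorphisms of a threshold graph fix its first vertices. -/
lemma thresholdRel_automorphism {i : ℕ} (hi : i + 2 ≤ n) {π : Fin n → Fin n}
    (hπ : Function.Injective π) (h : ∀ a b, thresholdRel i a b ↔ thresholdRel i (π a) (π b)) :
    ∀ a : Fin n, a.val < i → π a = a := by
  intro a
  induction hm : a.val using Nat.strong_induction_on generalizing a with
  | _ m ih =>
  intro ha
  subst hm
  have hfix : ∀ b : Fin n, b < a → π b = b := fun b hb =>
    ih b.val hb b rfl ((show b.val < a.val from hb).trans ha)
  by_contra hne
  -- A smaller image would already be the image of itself.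
  have hac : a < π a := by
    rcases lt_trichotomy (π a) a with hlt | heq | hgt
    · exact (hne (hπ (hfix _ hlt))).elim
    · exact (hne heq).elim
    · exact hgt
  -- Every later vertex `d` other than `π a` is the image of a later vertex, and `a` is joined to
  -- all its later vertices or to none, according to its parity; so the same parity governs the edge
  -- between `π a` and `d`. A vertex `d` for which the minimum is `a + 1` contradicts this.
  have key : ∀ d : Fin n, a < d → d ≠ π a →
      (Even (min (min (π a).val d.val) i) ↔ Even a.val) := by
    intro d hd hda
    obtain ⟨b, rfl⟩ := (Finite.injective_iff_surjective.1 hπ) d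
    have hab : a < b := by
      rcases lt_trichotomy b a with hlt | rfl | hgt
      · rw [hfix b hlt] at hd
        exact (lt_asymm hd hlt).elim
      · exact (hda rfl).elim
      · exact hgt
    have h1 := h a b
    simp only [thresholdRel, hab.ne, hda.symm, ne_eq, not_false_eq_true, true_and] at h1
    rw [← h1, min_eq_left (show a.val ≤ b.val from hab.le), min_eq_left ha.le]
  have hav : a.val < (π a).val := hac
  have hodd : ¬ (Even (a.val + 1) ↔ Even a.val) := by
    rw [Nat.even_add_one]
    exact not_iff_self
  by_cases hca : (π a).val = a.val + 1
  · have hd : a.val + 2 < n := by omega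
    have h1 := key ⟨a.val + 2, hd⟩ (Fin.lt_def.2 (by simp)) (fun h => by
      have := congrArg Fin.val h
      simp only at this
      omega)
    rw [show min (min (π a).val (a.val + 2)) i = a.val + 1 by omega] at h1
    exact hodd h1
  · have hd : a.val + 1 < n := by omega
    have h1 := key ⟨a.val + 1, hd⟩ (Fin.lt_def.2 (by simp)) (fun h => by
      have := congrArg Fin.val h
      simp only at this
      omega)
    rw [show min (min (π a).val (a.val + 1)) i = a.val + 1 by omega] at h1
    exact hodd h1

/-- Permutations that fix the first vertices are automorphisms. -/
lemma thresholdRel_iff_of_fix {i : ℕ} {π : Fin n → Fin n} (hπ : Function.Injective π)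
    (h : ∀ a : Fin n, a.val < i → π a = a) (a b : Fin n) :
    thresholdRel i a b ↔ thresholdRel i (π a) (π b) := by
  have hmin : ∀ a : Fin n, min (π a).val i = min a.val i := by
    intro a
    by_cases ha : a.val < i
    · rw [h a ha]
    · have h1 : ¬ (π a).val < i := fun h1 => ha (by rwa [← hπ (h _ h1)])
      omega
  have := hmin a
  have := hmin b
  rw [thresholdRel, thresholdRel, hπ.ne_iff,
    show min (min (π a).val (π b).val) i = min (min a.val b.val) i by omega]

open Classical in
variable (n) in
/-- The sign matrices of the empty graph and of the threshold graphs. -/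
noncomputable def thresholdSign (k : ℕ) : Matrix (Fin n) (Fin n) ℂ :=
  -- Without the condition `0 < k`, truncated subtraction would make `k = 0` the complete graph,
  -- which is the case `k = 1`.
  fun a b => if 0 < k ∧ thresholdRel (k - 1) a b then -1 else 1

lemma negRel_thresholdSign (k : ℕ) (a b : Fin n) :
    negRel (thresholdSign n k) a b ↔ 0 < k ∧ thresholdRel (k - 1) a b := by
  rw [negRel, thresholdSign]
  split_ifs with h
  · simp [h]
  · refine iff_of_false ?_ h
    norm_num

lemma isSignMatrix_thresholdSign (k : ℕ) : IsSignMatrix (thresholdSign n k) where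
  diag a := by
    rw [thresholdSign]
    exact if_neg fun h => h.2.1 rfl
  symm a b := by
    have h := thresholdRel_comm (i := k - 1) a b
    by_cases h1 : 0 < k ∧ thresholdRel (k - 1) a b
    · rw [thresholdSign, if_pos h1, thresholdSign, if_pos ⟨h1.1, h.1 h1.2⟩]
    · rw [thresholdSign, if_neg h1, thresholdSign, if_neg fun h2 => h1 ⟨h2.1, h.2 h2.2⟩]
  sign a b := by
    rw [thresholdSign]
    split_ifs <;> simp

/-! ### Permutations of the pairs -/

lemma eq_or_eq_partner {i j : Fin (2 * n)} (h : pairIndex i = pairIndex j) :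
    i = j ∨ i = partner j := by
  have h1 : i.val / 2 = j.val / 2 := congrArg Fin.val h
  have h2 := partner_val j
  by_cases hij : i.val = j.val
  · exact Or.inl (Fin.ext hij)
  · refine Or.inr (Fin.ext ?_)
    rw [h2]
    split_ifs <;> omega

/-- The first point of a pair. -/
def firstPoint (a : Fin n) : Fin (2 * n) := ⟨2 * a.val, by omega⟩

lemma pairIndex_firstPoint (a : Fin n) : pairIndex (firstPoint a) = a :=
  Fin.ext (by simp [pairIndex, firstPoint])

/-- The map on points given by a map on pairs. -/
def pairMap (π : Fin n → Fin n) (j : Fin (2 * n)) : Fin (2 * n) :=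
  ⟨2 * (π (pairIndex j)).val + j.val % 2, by omega⟩

lemma pairIndex_pairMap (π : Fin n → Fin n) (j : Fin (2 * n)) :
    pairIndex (pairMap π j) = π (pairIndex j) := Fin.ext (by
  change (2 * (π (pairIndex j)).val + j.val % 2) / 2 = _
  omega)

lemma pairMap_partner (π : Fin n → Fin n) (j : Fin (2 * n)) :
    pairMap π (partner j) = partner (pairMap π j) := by
  refine Fin.ext ?_
  have h1 := partner_val j
  have h2 := partner_val (pairMap π j)
  have h3 : (pairMap π j).val = 2 * (π (pairIndex j)).val + j.val % 2 := rfl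
  have h4 : (pairMap π (partner j)).val = 2 * (π (pairIndex j)).val + (partner j).val % 2 := by
    rw [← pairIndex_partner j]; rfl
  split_ifs at h1 h2 <;> omega

lemma pairMap_pairMap {π σ : Fin n → Fin n} (h : ∀ a, π (σ a) = a) (j : Fin (2 * n)) :
    pairMap π (pairMap σ j) = j := by
  refine Fin.ext ?_
  change 2 * (π (pairIndex (pairMap σ j))).val + (pairMap σ j).val % 2 = j.val
  rw [pairIndex_pairMap, h]
  simp only [pairMap, pairIndex]
  omega

/-- The permutation of the points given by a permutation of the pairs. -/
def pairPerm (π : Equiv.Perm (Fin n)) : Equiv.Perm (Fin (2 * n)) where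
  toFun := pairMap π
  invFun := pairMap π.symm
  left_inv := pairMap_pairMap π.symm_apply_apply
  right_inv := pairMap_pairMap π.apply_symm_apply

/-! ### The classical points for threshold graphs -/

/-- The map on pairs given by a map on points. -/
def pairQuot (g : Equiv.Perm (Fin (2 * n))) (a : Fin n) : Fin n := pairIndex (g (firstPoint a))

lemma pairQuot_pairIndex {g : Equiv.Perm (Fin (2 * n))} (hg : ∀ j, g (partner j) = partner (g j))
    (j : Fin (2 * n)) : pairQuot g (pairIndex j) = pairIndex (g j) := by
  rw [pairQuot]
  rcases eq_or_eq_partner (pairIndex_firstPoint (pairIndex j)) with h | h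
  · rw [h]
  · rw [h, hg, pairIndex_partner]

lemma pairQuot_injective {g : Equiv.Perm (Fin (2 * n))} (hg : ∀ j, g (partner j) = partner (g j)) :
    Function.Injective (pairQuot g) := by
  intro a b hab
  have h : firstPoint a = firstPoint b ∨ firstPoint a = partner (firstPoint b) := by
    rcases eq_or_eq_partner hab with h | h
    · exact Or.inl (g.injective h)
    · rw [← hg] at h
      exact Or.inr (g.injective h)
  have h' : pairIndex (firstPoint a) = pairIndex (firstPoint b) := by
    rcases h with h | h
    · rw [h]
    · rw [h, pairIndex_partner]
  rwa [pairIndex_firstPoint, pairIndex_firstPoint] at h'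

/-- For `n ≥ 2`, the first vertex of a threshold graph is joined to all the other ones. -/
lemma exists_thresholdRel (hn : 2 ≤ n) (i : ℕ) (a : Fin n) : ∃ b, thresholdRel i a b := by
  by_cases ha : a.val = 0
  · refine ⟨⟨1, by omega⟩, fun h => ?_, by simp [ha]⟩
    have := congrArg Fin.val h
    simp only at this
    omega
  · exact ⟨⟨0, by omega⟩, fun h => ha (congrArg Fin.val h), by simp⟩

/-- No vertex of the graph is isolated, so `g` commutes with `partner` and induces an automorphism
of the graph on pairs, that is, a permutation that fixes the first `i` vertices. -/
lemma mem_classicalPoints_succ {i : ℕ} (hi : i + 2 ≤ n) {g : Equiv.Perm (Fin (2 * n))} :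
    g ∈ classicalPoints (thresholdSign n (i + 1)) ↔
      (∀ j, g (partner j) = partner (g j)) ∧ ∀ a : Fin n, a.val < i → pairQuot g a = a := by
  have hp := isSignMatrix_thresholdSign (n := n) (i + 1)
  have hD : ∀ a b, negRel (thresholdSign n (i + 1)) a b ↔ thresholdRel i a b := fun a b => by
    rw [negRel_thresholdSign]
    simp
  constructor
  · intro hg
    have h1 : ∀ j, g (partner j) = partner (g j) := fun j => by
      obtain ⟨b, hb⟩ := exists_thresholdRel (by omega) i (pairIndex j)
      refine partner_of_mem hp hg (i := firstPoint b) ?_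
      rwa [hD, pairIndex_firstPoint]
    refine ⟨h1, thresholdRel_automorphism hi (pairQuot_injective h1) fun a b => ?_⟩
    have h2 := negRel_iff_of_mem hp hg (firstPoint a) (firstPoint b)
    rwa [hD, hD, pairIndex_firstPoint, pairIndex_firstPoint] at h2
  · rintro ⟨h1, h2⟩
    refine mem_classicalPoints hp h1 fun j i' => ?_
    rw [hD, hD, ← pairQuot_pairIndex h1, ← pairQuot_pairIndex h1]
    exact thresholdRel_iff_of_fix (pairQuot_injective h1) h2 _ _

lemma mem_classicalPoints_zero (g : Equiv.Perm (Fin (2 * n))) :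
    g ∈ classicalPoints (thresholdSign n 0) := by
  have h : ∀ a b, ¬ negRel (thresholdSign n 0) a b := fun a b => by
    rw [negRel_thresholdSign]
    simp
  refine (twistedCommutation_iff (isSignMatrix_thresholdSign 0) _).2 ?_
  funext k l j i
  simp only [colTwist, rowTwist, pairTwist, h, if_false, entryProd, entryProdRev, mul_comm]

lemma classicalPoints_ssubset {k l : ℕ} (hkl : k < l) (hl : l < n) :
    classicalPoints (thresholdSign n l) ⊂ classicalPoints (thresholdSign n k) := by
  obtain ⟨i, rfl⟩ : ∃ i, l = i + 1 := ⟨l - 1, by omega⟩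
  rw [Set.ssubset_iff_exists]
  rcases k with _ | k
  -- The transposition of the points `0` and `2` breaks the pairs `{0, 1}` and `{2, 3}`.
  · refine ⟨fun g _ => mem_classicalPoints_zero g, Equiv.swap ⟨0, by omega⟩ ⟨2, by omega⟩,
      mem_classicalPoints_zero _, fun h => ?_⟩
    have h1 := ((mem_classicalPoints_succ (by omega)).1 h).1 ⟨0, by omega⟩
    rw [Equiv.swap_apply_left, Equiv.swap_apply_of_ne_of_ne] at h1
    · have := congrArg Fin.val h1
      simp [partner_val] at this
    all_goals
      intro h2
      have := congrArg Fin.val h2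
      simp [partner_val] at this
  -- Exchanging the pairs `k` and `k + 1` fixes the first `k` pairs but moves the pair `k`, and `k <
  -- i`.
  · refine ⟨fun g hg => ?_, pairPerm (Equiv.swap ⟨k, by omega⟩ ⟨k + 1, by omega⟩), ?_, fun h => ?_⟩
    · rw [mem_classicalPoints_succ (by omega)] at hg ⊢
      exact ⟨hg.1, fun a ha => hg.2 a (by omega)⟩
    · rw [mem_classicalPoints_succ (by omega)]
      refine ⟨pairMap_partner _, fun a ha => ?_⟩
      refine (pairIndex_pairMap _ _).trans ?_
      rw [pairIndex_firstPoint, Equiv.swap_apply_of_ne_of_ne]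
      · exact fun h => by have := congrArg Fin.val h; simp only at this; omega
      · exact fun h => by have := congrArg Fin.val h; simp only at this; omega
    · have h1 := ((mem_classicalPoints_succ (by omega)).1 h).2 ⟨k, by omega⟩ (show k < i by omega)
      have h2 := (pairIndex_pairMap (Equiv.swap (⟨k, by omega⟩ : Fin n) ⟨k + 1, by omega⟩)
        (firstPoint ⟨k, by omega⟩)).symm.trans h1
      rw [pairIndex_firstPoint, Equiv.swap_apply_left] at h2
      have := congrArg Fin.val h2
      simp at this

lemma isEmpty_algEquiv_of_lt {k l : ℕ} (hkl : k < l) (hl : l < n) :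
    IsEmpty (TwSym (negRel (thresholdSign n k)) ≃ₐ[ℂ] TwSym (negRel (thresholdSign n l))) := by
  refine ⟨fun e => ?_⟩
  have h := Nat.card_congr (e.arrowCongr (AlgEquiv.refl : ℂ ≃ₐ[ℂ] ℂ))
  rw [card_character (isSignMatrix_thresholdSign k), card_character (isSignMatrix_thresholdSign l)]
    at h
  exact (Set.ncard_lt_ncard (classicalPoints_ssubset hkl hl)).ne' h

end Threshold

theorem mainTheorem11 (n : ℕ) :
    ∃ (p : Fin n → Matrix (Fin n) (Fin n) ℂ) (Q : Fin n → FiniteQuantumGroup)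
      (u : ∀ k, Matrix (Fin (2 * n)) (Fin (2 * n)) (Q k).A),
      (∀ k, IsSignMatrix (p k)) ∧
      (∀ k, IsQuantumPermutationGroup (Q k) (u k)) ∧
      (∀ k, IsTwistedSymmetricAlgebra (p k) (u k)) ∧
      (∀ k, IsTwistInducedFrom (Q k).A (pairSubgroup n)) ∧
      (∀ k, SameTensorCategory (Q k).A (Equiv.Perm (Fin (2 * n)))) ∧
      (∀ k l, k ≠ l → IsEmpty ((Q k).A ≃ₐc[ℂ] (Q l).A)) := by
  -- The index `0` gives the untwisted `C(S_{2n})`, and `k ≥ 1` gives the threshold graph with `i =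
  -- k - 1`; the bound `k < n` is exactly `i + 2 ≤ n`.
  refine ⟨fun k => thresholdSign n k, fun k =>
    TwGroup.quantumGroup (pairDatum (lowerPart (negRel (thresholdSign n k)))) (flips n),
    fun k => TwSym.coord (negRel (thresholdSign n k)), fun k => isSignMatrix_thresholdSign k,
    fun k => TwSym.isQuantumPermutationGroup _,
    fun k => TwSym.isTwistedSymmetricAlgebra (isSignMatrix_thresholdSign k),
    fun k => TwGroup.isTwistInducedFrom _ (pairSubgroup n) (flipHom n),
    fun k => TwGroup.sameTensorCategory _ _, fun k l hkl => ⟨fun e => ?_⟩⟩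
  rcases lt_or_gt_of_ne hkl with h | h
  · exact (isEmpty_algEquiv_of_lt h l.2).false (BialgEquiv.toAlgEquiv e)
  · exact (isEmpty_algEquiv_of_lt h k.2).false (AlgEquiv.symm (BialgEquiv.toAlgEquiv e))
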